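/- Let $f\in\mathbb R[x,y,z]$ be a positive semidefinite (psd) quartic form. A representation of $f$ is a triple $(p_1,p_2,p_3)$ of quadratic forms in $\mathbb R[x,y,z]$ with $f=p_1^2+p_2^2+p_3^2$; two representations $(p_i)$, $(p_i')$ of $f$ are (orthogonally) equivalent if there is $S=(s_{ij})\in O_3(\mathbb R)$ with $p_j'=\sum_{i} s_{ij}p_i$ for $j=1,2,3$. **Notation.** For a quartic form $g\in\mathbb R[x,y,z]$ let $g_j\in\mathbb R[x,y]$ ($j=2,3,4$) be the coefficient of $z^{4-j}$ in $g$, a binary form of degree $j$. Where a univariate polynomial is needed, binary forms are dehomogenized by $y=1$, and $'$ is $d/dx$. Put $g_{ij}=i\,g_i g_j'-j\,g_j g_i'\in\mathbb R[x]$ and $$P=g_{23}g_{34}-g_{24}^2,\quad Q=g_4^2g_{23}(2g_4g_{23}-g_3g_{24}),\quad R=(8g_2g_4-3g_3^2)g_{23}+2g_2g_3g_{24}.$$ For univariate $p=a_0x^m+\cdots$ with $a_0\neq0$ and complex roots $\alpha_1,\dots,\alpha_m$, and for $q,r$ of degree at most $n$, let $$\operatorname{disc}_m(p)=a_0^{2m-2}\prod_{i<j}(\alpha_i-\alpha_j)^2,\qquad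 \Phi_{m,n}(p,q,r)=a_0^{(m-1)(n-1)}\prod_{i<j}\frac{q(\alpha_i)r(\alpha_j)-q(\alpha_j)r(\alpha_i)}{\alpha_i-\alpha_j}.$$ These are integral polynomials in the coefficients of $p$ resp. $p,q,r$, and are understood in this sense for all $p$ of degree at most $m$. The exceptional conditions on $(g_2,g_3,g_4)$ are: * (E1) $\operatorname{disc}_2(g_2)=0$; * (E2) $g_2\mid g_3$ in $\mathbb R[x,y]$; * (E3) $\operatorname{disc}_6(4g_2g_4-g_3^2)=0$; * (E4) $\operatorname{disc}_3(g_3)=0$; * (E5) $\gcd(g_3,g_4)\ne1$ in $\mathbb R[x,y]$; * (E6) $\gcd(g_{23},g_{24})\ne1$ in $\mathbb R[x]$; * (E7) $\gcd(g_{24},g_{34})\ne1$ in $\mathbb R[x]$; * (E8) $\Phi_{3,4}(g_3,g_2^2,g_4)=0$; * (E9) $\operatorname{disc}_8(P)=0$; * (E10) $\Phi_{8,18}(P,Q,R^2)=0$; * (E11) $\gcd(g_3,\,4g_4-g_2^2)\ne1$ in $\mathbb R[x,y]$. **Theorem.** Let $g=f\circ A$ be obtained from $f$ by an invertible real linear change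 of coordinates $A$ (for instance $g=f$). (a) If $g(0,0,1)=0$ and $g$ satisfies none of (E1)–(E3), then $f$ has precisely $4$ equivalence classes of representations. (b) If $f$ is strictly positive on $\mathbb R^3\setminus\{0\}$, $g$ is of the form $g=z^4+g_2z^2+g_3z+g_4$ with $g-z^4$ psd, and $g$ satisfies none of (E1)–(E11), then $f$ has precisely $8$ equivalence classes of representations. -/

import Mathlib

open scoped BigOperators

noncomputable section

namespace TernaryQuartic

/-! ### Ternary forms and their representations as sums of three squares

The variables `x, y, z` of a ternary form are `X 0, X 1, X 2`. -/

/-- `f` takes nonnegative values on `ℝ³`. -/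
def IsPSD (f : MvPolynomial (Fin 3) ℝ) : Prop :=
  ∀ v : Fin 3 → ℝ, 0 ≤ MvPolynomial.eval v f

/-- `f` takes positive values on `ℝ³ \ {0}`. -/
def IsPosDef (f : MvPolynomial (Fin 3) ℝ) : Prop :=
  ∀ v : Fin 3 → ℝ, v ≠ 0 → 0 < MvPolynomial.eval v f

/-- The representations `f = p₀² + p₁² + p₂²` with (possibly zero) real quadratic forms `pᵢ`. -/
def Rep (f : MvPolynomial (Fin 3) ℝ) : Type :=
  {p : Fin 3 → MvPolynomial (Fin 3) ℝ // (∀ i, (p i).IsHomogeneous 2) ∧ f = ∑ i, p i ^ 2}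

/-- Orthogonal equivalence: `p'ⱼ = ∑ᵢ sᵢⱼ pᵢ` with an orthogonal real `3 × 3` matrix `S = (sᵢⱼ)`. -/
def Rep.Equivalent {f : MvPolynomial (Fin 3) ℝ} (p p' : Rep f) : Prop :=
  ∃ S ∈ Matrix.orthogonalGroup (Fin 3) ℝ,
    ∀ j, p'.1 j = ∑ i, MvPolynomial.C (S i j) * p.1 i

theorem Rep.equivalent_refl {f : MvPolynomial (Fin 3) ℝ} (p : Rep f) : p.Equivalent p := by
  refine ⟨1, Submonoid.one_mem _, fun j => ?_⟩
  rw [Finset.sum_eq_single j]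
  · simp
  · intro i _ hij
    simp [Matrix.one_apply_ne hij]
  · simp

theorem Rep.equivalent_trans {f : MvPolynomial (Fin 3) ℝ} {p q r : Rep f}
    (h₁ : p.Equivalent q) (h₂ : q.Equivalent r) : p.Equivalent r := by
  obtain ⟨S, hS, hpq⟩ := h₁
  obtain ⟨T, hT, hqr⟩ := h₂
  refine ⟨S * T, Submonoid.mul_mem _ hS hT, fun j => ?_⟩
  rw [hqr j]
  simp only [hpq, Matrix.mul_apply, map_sum, map_mul, Finset.mul_sum, Finset.sum_mul]
  rw [Finset.sum_comm]
  exact Finset.sum_congr rfl fun i _ => Finset.sum_congr rfl fun k _ => by ring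

theorem Rep.equivalent_symm {f : MvPolynomial (Fin 3) ℝ} {p q : Rep f}
    (h : p.Equivalent q) : q.Equivalent p := by
  obtain ⟨S, hS, hpq⟩ := h
  have h1 : S * S.transpose = 1 := (Matrix.mem_orthogonalGroup_iff (Fin 3) ℝ).1 hS
  have h2 : S.transpose * S = 1 := mul_eq_one_comm.1 h1
  refine ⟨S.transpose, (Matrix.mem_orthogonalGroup_iff (Fin 3) ℝ).2 (by simpa using h2),
    fun j => ?_⟩
  have key : ∀ k, ∑ i, S k i * S j i = if k = j then 1 else 0 := by
    intro k
    have := congrFun (congrFun h1 k) j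
    simpa [Matrix.mul_apply, Matrix.one_apply] using this
  simp only [hpq, Matrix.transpose_apply, Finset.mul_sum]
  rw [Finset.sum_comm]
  have : ∀ k, ∑ i, MvPolynomial.C (S j i) * (MvPolynomial.C (S k i) * p.1 k)
      = MvPolynomial.C (∑ i, S k i * S j i) * p.1 k := by
    intro k
    rw [map_sum, Finset.sum_mul]
    exact Finset.sum_congr rfl fun i _ => by rw [map_mul]; ring
  simp only [this, key]
  simp

/-- Orthogonal equivalence as a setoid. -/
def Rep.setoid (f : MvPolynomial (Fin 3) ℝ) : Setoid (Rep f) where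
  r := Rep.Equivalent
  iseqv := ⟨Rep.equivalent_refl, Rep.equivalent_symm, Rep.equivalent_trans⟩

/-- The orthogonal equivalence classes of representations of `f`. -/
def RepClass (f : MvPolynomial (Fin 3) ℝ) : Type := Quotient (Rep.setoid f)

/-! ### Coordinate changes and the expansion in powers of `z` -/

/-- The form `v ↦ f (A v)`. -/
def coordChange (A : Matrix (Fin 3) (Fin 3) ℝ) (f : MvPolynomial (Fin 3) ℝ) :
    MvPolynomial (Fin 3) ℝ :=
  MvPolynomial.aeval (fun i => ∑ j, MvPolynomial.C (A i j) * MvPolynomial.X j) f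

theorem eval_coordChange (A : Matrix (Fin 3) (Fin 3) ℝ) (f : MvPolynomial (Fin 3) ℝ)
    (v : Fin 3 → ℝ) :
    MvPolynomial.eval v (coordChange A f) = MvPolynomial.eval (A.mulVec v) f := by
  induction f using MvPolynomial.induction_on with
  | C a => simp [coordChange]
  | add p q hp hq => rw [map_add, ← hp, ← hq]; simp only [coordChange, map_add]
  | mul_X p i hp =>
    rw [map_mul, ← hp]
    simp only [coordChange, map_mul, MvPolynomial.aeval_X]
    simp [Matrix.mulVec, dotProduct]

/-- For a ternary quartic form `f`, the binary form of degree `j` in `x, y` that is the coefficient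
of `z ^ (4 - j)` in `f` (for `j ≤ 4`). -/
def binForm (f : MvPolynomial (Fin 3) ℝ) (j : ℕ) : MvPolynomial (Fin 2) ℝ :=
  (MvPolynomial.aeval
    ![Polynomial.C (MvPolynomial.X 0), Polynomial.C (MvPolynomial.X 1), Polynomial.X] f :
      Polynomial (MvPolynomial (Fin 2) ℝ)).coeff (4 - j)

/-- The inclusion `ℝ[x, y] ⊆ ℝ[x, y, z]`. -/
def liftXY (f : MvPolynomial (Fin 2) ℝ) : MvPolynomial (Fin 3) ℝ :=
  MvPolynomial.rename (Fin.castSucc : Fin 2 → Fin 3) f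

/-- `f = z⁴ + f₂ z² + f₃ z + f₄` with `fⱼ ∈ ℝ[x, y]` a form of degree `j`, and `f - z⁴` is psd. -/
def IsNormalized (f : MvPolynomial (Fin 3) ℝ) : Prop :=
  f = MvPolynomial.X 2 ^ 4 + liftXY (binForm f 2) * MvPolynomial.X 2 ^ 2
      + liftXY (binForm f 3) * MvPolynomial.X 2 + liftXY (binForm f 4) ∧
    IsPSD (f - MvPolynomial.X 2 ^ 4)

/-! ### The `m`-discriminant and the `Φ`-invariant -/

/-- The `m` roots on the projective line of a nonzero real polynomial `f` of degree at most `m`,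
viewed as a binary form of degree `m`: the point `(α, 1)` for each complex root `α` of `f` (with
multiplicity), and the point `(-1, 0)` at infinity with multiplicity `m - deg f`. If `a` is the
leading coefficient of `f`, the binary form is `a · ∏ (v x - u y)` over the points `(u, v)` of this
list. -/
def projRoots (m : ℕ) (f : Polynomial ℝ) : List (ℂ × ℂ) :=
  (f.aroots ℂ).toList.map (fun α => (α, 1)) ++ List.replicate (m - f.natDegree) (-1, 0)

/-- `∏_{i<j} F (Lᵢ) (Lⱼ)`. -/
def pairProd (L : List (ℂ × ℂ)) (F : ℂ × ℂ → ℂ × ℂ → ℂ) : ℂ :=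
  ∏ i : Fin L.length, ∏ j ∈ Finset.Ioi i, F (L.get i) (L.get j)

/-- The `m`-discriminant of a polynomial `f` of degree at most `m` (`m ≥ 2`). If `deg f = m`, this is
`a₀^(2m-2) ∏_{i<j} (αᵢ - αⱼ)²`; in general it is the value of the same integral polynomial in the
coefficients of `f`, written in homogeneous coordinates of the roots. -/
def disc (m : ℕ) (f : Polynomial ℝ) : ℂ :=
  (f.leadingCoeff : ℂ) ^ (2 * m - 2) *
    pairProd (projRoots m f) (fun P Q => (P.1 * Q.2 - Q.1 * P.2) ^ 2)

/-- The value at `P = (u, v)` of the homogenization of degree `n` of `g` (`deg g ≤ n`). -/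
def homEval (n : ℕ) (g : Polynomial ℝ) (P : ℂ × ℂ) : ℂ :=
  ∑ k ∈ Finset.range (n + 1), (g.coeff k : ℂ) * (P.1 ^ k * P.2 ^ (n - k))

/-- The polynomial quotient `(g(P) h(Q) - g(Q) h(P)) / (u v' - u' v)` for `P = (u, v)`,
`Q = (u', v')` (see `mul_phiFactor`), where `g`, `h` are homogenized to degree `n`. For `P = (α, 1)`,
`Q = (β, 1)` this is `(g(α) h(β) - g(β) h(α)) / (α - β)`. -/
def phiFactor (n : ℕ) (g h : Polynomial ℝ) (P Q : ℂ × ℂ) : ℂ :=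
  ∑ k ∈ Finset.range (n + 1), ∑ l ∈ Finset.range k,
    ((g.coeff k : ℂ) * (h.coeff l : ℂ) - (g.coeff l : ℂ) * (h.coeff k : ℂ)) *
      ∑ r ∈ Finset.range (k - l),
        P.1 ^ (k - 1 - r) * P.2 ^ (n - k + r) * Q.1 ^ (l + r) * Q.2 ^ (n - 1 - l - r)

theorem sum_range_sq_antisymm (F : ℕ → ℕ → ℂ) (hF : ∀ k, F k k = 0) (N : ℕ) :
    ∑ k ∈ Finset.range N, ∑ l ∈ Finset.range N, F k l
      = ∑ k ∈ Finset.range N, ∑ l ∈ Finset.range k, (F k l + F l k) := by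
  induction N with
  | zero => simp
  | succ N ih =>
    rw [Finset.sum_range_succ (fun k => ∑ l ∈ Finset.range k, (F k l + F l k)), ← ih]
    simp only [Finset.sum_range_succ, Finset.sum_add_distrib, hF]
    ring

theorem mul_phiFactor (n : ℕ) (g h : Polynomial ℝ) (P Q : ℂ × ℂ) :
    (P.1 * Q.2 - Q.1 * P.2) * phiFactor n g h P Q
      = homEval n g P * homEval n h Q - homEval n g Q * homEval n h P := by
  have hR : homEval n g P * homEval n h Q - homEval n g Q * homEval n h P
      = ∑ k ∈ Finset.range (n + 1), ∑ l ∈ Finset.range (n + 1),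
        (g.coeff k : ℂ) * (h.coeff l : ℂ) *
          (P.1 ^ k * P.2 ^ (n - k) * (Q.1 ^ l * Q.2 ^ (n - l))
            - P.1 ^ l * P.2 ^ (n - l) * (Q.1 ^ k * Q.2 ^ (n - k))) := by
    simp only [homEval, Finset.sum_mul_sum, ← Finset.sum_sub_distrib]
    exact Finset.sum_congr rfl fun k _ => Finset.sum_congr rfl fun l _ => by ring
  rw [hR, sum_range_sq_antisymm _ (fun k => by ring), phiFactor, Finset.mul_sum]
  refine Finset.sum_congr rfl fun k hk => ?_
  rw [Finset.mul_sum]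
  refine Finset.sum_congr rfl fun l hl => ?_
  obtain ⟨d, rfl⟩ : ∃ d, k = l + d := ⟨k - l, by have := Finset.mem_range.1 hl; omega⟩
  obtain ⟨e, rfl⟩ : ∃ e, n = l + d + e := ⟨n - (l + d), by have := Finset.mem_range.1 hk; omega⟩
  have hd : 0 < d := by have := Finset.mem_range.1 hl; omega
  have h1 : ∑ r ∈ Finset.range (l + d - l),
        P.1 ^ (l + d - 1 - r) * P.2 ^ (l + d + e - (l + d) + r) * Q.1 ^ (l + r)
          * Q.2 ^ (l + d + e - 1 - l - r)
      = P.1 ^ l * Q.1 ^ l * P.2 ^ e * Q.2 ^ e *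
        ∑ r ∈ Finset.range d, (Q.1 * P.2) ^ r * (P.1 * Q.2) ^ (d - 1 - r) := by
    rw [Finset.mul_sum, Nat.add_sub_cancel_left]
    refine Finset.sum_congr rfl fun r hr => ?_
    have hr' := Finset.mem_range.1 hr
    rw [show l + d - 1 - r = l + (d - 1 - r) by omega,
      show l + d + e - (l + d) + r = e + r by omega,
      show l + d + e - 1 - l - r = e + (d - 1 - r) by omega]
    simp only [pow_add, mul_pow]
    ring
  have h2 := (Commute.all (Q.1 * P.2) (P.1 * Q.2)).geom_sum₂_mul d
  rw [h1, show l + d + e - (l + d) = e by omega, show l + d + e - l = d + e by omega]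
  simp only [pow_add, mul_pow] at h2 ⊢
  linear_combination (-((g.coeff (l + d) : ℂ) * (h.coeff l : ℂ)
    - (g.coeff l : ℂ) * (h.coeff (l + d) : ℂ)) * (P.1 ^ l * Q.1 ^ l * P.2 ^ e * Q.2 ^ e)) * h2

/-- The invariant `Φ_{m,n}(f, g, h)` for `deg f ≤ m` and `deg g, deg h ≤ n` (`m, n ≥ 2`). If
`deg f = m`, this is
`a₀^((m-1)(n-1)) ∏_{i<j} (g(αᵢ) h(αⱼ) - g(αⱼ) h(αᵢ)) / (αᵢ - αⱼ)`, where `α₁, …, αₘ` are the roots of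
`f`; in general it is the value of the same integral polynomial in the coefficients of `f, g, h`,
written in homogeneous coordinates of the roots. -/
def Phi (m n : ℕ) (f g h : Polynomial ℝ) : ℂ :=
  (f.leadingCoeff : ℂ) ^ ((m - 1) * (n - 1)) * pairProd (projRoots m f) (phiFactor n g h)

/-! ### The exceptional conditions

In these conditions `f₂, f₃, f₄` are binary forms of degrees `2, 3, 4`. -/

/-- Dehomogenization `y = 1` of a binary form. -/
def dehom (f : MvPolynomial (Fin 2) ℝ) : Polynomial ℝ :=
  MvPolynomial.aeval ![Polynomial.X, 1] f

/-- `i fᵢ fⱼ' - j fⱼ fᵢ'`, where `fᵢ, fⱼ` are dehomogenized by `y = 1` and `'` is `d/dx`. -/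
def gPol (i j : ℕ) (fi fj : MvPolynomial (Fin 2) ℝ) : Polynomial ℝ :=
  (i : Polynomial ℝ) * dehom fi * Polynomial.derivative (dehom fj)
    - (j : Polynomial ℝ) * dehom fj * Polynomial.derivative (dehom fi)

section Exceptional

variable (f₂ f₃ f₄ : MvPolynomial (Fin 2) ℝ)

/-- `P = g₂₃ g₃₄ - g₂₄²`, of degree at most 8. -/
def polP : Polynomial ℝ := gPol 2 3 f₂ f₃ * gPol 3 4 f₃ f₄ - gPol 2 4 f₂ f₄ ^ 2

/-- `Q = f₄² g₂₃ (2 f₄ g₂₃ - f₃ g₂₄)`, of degree at most 18. -/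
def polQ : Polynomial ℝ :=
  dehom f₄ ^ 2 * gPol 2 3 f₂ f₃ *
    (2 * dehom f₄ * gPol 2 3 f₂ f₃ - dehom f₃ * gPol 2 4 f₂ f₄)

/-- `R = (8 f₂ f₄ - 3 f₃²) g₂₃ + 2 f₂ f₃ g₂₄`, of degree at most 9. -/
def polR : Polynomial ℝ :=
  (8 * dehom f₂ * dehom f₄ - 3 * dehom f₃ ^ 2) * gPol 2 3 f₂ f₃
    + 2 * dehom f₂ * dehom f₃ * gPol 2 4 f₂ f₄

def E1 : Prop := disc 2 (dehom f₂) = 0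

def E2 : Prop := f₂ ∣ f₃

def E3 : Prop := disc 6 (dehom (4 * f₂ * f₄ - f₃ ^ 2)) = 0

def E4 : Prop := disc 3 (dehom f₃) = 0

def E5 : Prop := ¬ IsRelPrime f₃ f₄

def E6 : Prop := ¬ IsRelPrime (gPol 2 3 f₂ f₃) (gPol 2 4 f₂ f₄)

def E7 : Prop := ¬ IsRelPrime (gPol 2 4 f₂ f₄) (gPol 3 4 f₃ f₄)

def E8 : Prop := Phi 3 4 (dehom f₃) (dehom f₂ ^ 2) (dehom f₄) = 0

def E9 : Prop := disc 8 (polP f₂ f₃ f₄) = 0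

def E10 : Prop := Phi 8 18 (polP f₂ f₃ f₄) (polQ f₂ f₃ f₄) (polR f₂ f₃ f₄ ^ 2) = 0

def E11 : Prop := ¬ IsRelPrime f₃ (4 * f₄ - f₂ ^ 2)

/-- None of the exceptional conditions (E1)-(E3) holds. -/
def AvoidsE1E3 : Prop := ¬ E1 f₂ ∧ ¬ E2 f₂ f₃ ∧ ¬ E3 f₂ f₃ f₄

/-- None of the exceptional conditions (E1)-(E11) holds. -/
def AvoidsE1E11 : Prop :=
  ¬ E1 f₂ ∧ ¬ E2 f₂ f₃ ∧ ¬ E3 f₂ f₃ f₄ ∧ ¬ E4 f₃ ∧ ¬ E5 f₃ f₄ ∧ ¬ E6 f₂ f₃ f₄ ∧ ¬ E7 f₂ f₃ f₄ ∧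
    ¬ E8 f₂ f₃ f₄ ∧ ¬ E9 f₂ f₃ f₄ ∧ ¬ E10 f₂ f₃ f₄ ∧ ¬ E11 f₂ f₃ f₄

end Exceptional

end TernaryQuartic

end

open TernaryQuartic

/-!
Linear changes of coordinates do not affect the number of classes (`card_repClass_coordChange`), and
in the chart `y = 1` the quartic `g` becomes `s² z⁴ + G₂ z² + G₃ z + G₄` with `Gⱼ ∈ ℝ[x]`, where
`s = 0` in the first case and `s = 1` in the second one. The form `G₂ z² + G₃ z + G₄` is psd in both.

*Normal forms.* An orthogonal transformation brings a representation into the form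
`(s z² + ξ)² + (l₁ z + q₁)² + (l₂ z + q₂)²`. The last two squares represent the quadratic polynomial
`A z² + G₃ z + B` in `z`, where `A = G₂ - 2 s ξ` and `B = G₄ - ξ²`. Such a polynomial is a sum of two
squares if and only if `A` is psd and `4 A B - G₃²` is a square `η²` (`exists_sum_two_squares`). The two
squares are unique up to `O₂(ℝ)` if `(l₁ + i l₂) z + (q₁ + i q₂)` is irreducible in `ℂ[x, z]`
(`exists_orthogonal_of_sum_two_squares`). So, up to the sign of `η`, and for `s = 0` also up to the sign
of `ξ`, the equivalence classes correspond to the pairs `(ξ, η)` in the set `solSet`. It has `16`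
elements for `s = 0` and for `s = 1`, which gives `16 / 4 = 4` and `16 / 2 = 8` classes.

*The case `s = 0`.* The pairs are the solutions of `η² + 4 G₂ ξ² = D`, where `D = 4 G₂ G₄ - G₃²` is
positive, squarefree and of degree `6`. Each of the three positive irreducible quadratic factors of `D`
is itself a value of this norm form, and it splits in two ways; with the choice of a sign there are
`2 · 2³ = 16` solutions (`encard_normSolutions`).

*The case `s = 1`.* When `s` moves from `0` to `1`, the number of solutions is constant: the set of all
`(s, ξ, η)` is compact (`isCompact_solTotal`), it is open among all solutions of the equation
(`eventually_mem_solTotal`), and the derivative of the equation in `(ξ, η)` is invertible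
(`isInvertible_fderiv_solEquation`). Thus its projection to `[0, 1]` is a covering map
(`ncard_solutions_eq`).

*Nondegeneracy.* If the derivative is not invertible at `(s, ξ, η)` with `s ≠ 0`, then `η` and
`s B + ξ A` have a common zero `α`. If `A α ≠ 0`, then the quartic for the parameter `s` has a singular
zero over `α`. This is impossible for real `α` by positivity. For nonreal `α` it implies that `α` is a
zero of `polP` and that `128 s² Q = R²` at `α`. The number `s²` being real, the conjugate zero satisfies
the same equation, and `E10` holds. If `A α = 0`, then `G₃` vanishes at `α` and `G₂² = 4 s² G₄` there,
so that `E8` holds for nonreal `α`; for real `α`, the polynomial `G₃` has a double zero, which is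
`E4`. For `s = 0`, the conditions `E1`, `E2` and `E3` are what is needed.
-/

noncomputable section

namespace TernaryQuartic

section

/-! ### Counting the solutions of a one-parameter family of equations -/

open Topology Set

/-- The fibres of a local homeomorphism from a compact space to a connected one are equinumerous,
because it is a covering map. -/
theorem card_fiber_eq_of_isLocalHomeomorph {E X : Type*} [TopologicalSpace E] [TopologicalSpace X]
    [T2Space E] [T2Space X] [CompactSpace E] [PreconnectedSpace X] {f : E → X}
    (hf : IsLocalHomeomorph f) (x y : X) :
    Nat.card (f ⁻¹' {x}) = Nat.card (f ⁻¹' {y}) := by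
  have hcov : IsCoveringMap f := isLocalHomeomorph_iff_isCoveringMap.1 hf
  have hloc : IsLocallyConstant fun x => Nat.card (f ⁻¹' {x}) := by
    rw [IsLocallyConstant.iff_eventually_eq]
    intro x
    obtain ⟨hd, U, hxU, hU, hfU, H, hH⟩ := hcov x
    have h : ∀ y ∈ U, IsEvenlyCovered f y (f ⁻¹' {x}) := fun y hy => ⟨hd, U, hy, hU, hfU, H, hH⟩
    filter_upwards [hU.mem_nhds hxU] with y hy
    exact (Nat.card_congr (h y hy).fiberHomeomorph.toEquiv).symm
  exact hloc.apply_eq_of_isPreconnected isPreconnected_univ (mem_univ x) (mem_univ y)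

/-- Let `K` be a compact set of solutions `(t, v)`, `0 ≤ t ≤ 1`, of `F (t, v) = 0`, which is open
among all these solutions. If the derivative of `F` in the direction of `v` is invertible at all
points of `K`, then the number of points of `K` over `t` is the same for `t = 0` and `t = 1`. -/
theorem ncard_solutions_eq {V W : Type*} [NormedAddCommGroup V] [NormedSpace ℝ V] [CompleteSpace V]
    [NormedAddCommGroup W] [NormedSpace ℝ W] [CompleteSpace W] {F : ℝ × V → W}
    (hF : ContDiff ℝ 1 F) {K : Set (ℝ × V)} (hK : IsCompact K)
    (hK01 : ∀ p ∈ K, p.1 ∈ Icc (0 : ℝ) 1) (hK0 : ∀ p ∈ K, F p = 0)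
    (hKopen : ∀ p ∈ K, ∀ᶠ q in 𝓝 p, q.1 ∈ Icc (0 : ℝ) 1 → F q = 0 → q ∈ K)
    (hinv : ∀ p ∈ K, (fderiv ℝ F p ∘L .inr ℝ ℝ V).IsInvertible) :
    {v | ((0 : ℝ), v) ∈ K}.ncard = {v | ((1 : ℝ), v) ∈ K}.ncard := by
  classical
  let π : K → Icc (0 : ℝ) 1 := fun p => ⟨p.1.1, hK01 _ p.2⟩
  have hπ : Continuous π := by fun_prop
  have hloc : IsLocalHomeomorph π := by
    rw [show π = fun p => π p from rfl]
    refine IsLocalHomeomorph.mk _ fun p => ?_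
    have hcd : ContDiffAt ℝ 1 F p.1 := hF.contDiffAt
    set ψ : ℝ → V := hcd.implicitFunction one_ne_zero (hinv _ p.2) with hψ
    have hψp : ψ p.1.1 = p.1.2 := hcd.implicitFunction_apply_self _ _
    have hψc : ContDiffAt ℝ 1 ψ p.1.1 := hcd.contDiffAt_implicitFunction _ _
    have h1 := hcd.eventually_apply_eq_iff_implicitFunction one_ne_zero (hinv _ p.2)
    obtain ⟨N, hN, hNo, hpN⟩ := eventually_nhds_iff.1 (h1.and (hKopen _ p.2))
    have hcont : ContinuousAt (fun s => (s, ψ s)) p.1.1 :=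
      continuousAt_id.prodMk hψc.continuousAt
    have hmem : (p.1.1, ψ p.1.1) ∈ N := by rw [hψp]; exact hpN
    obtain ⟨I, hI, hIo, hpI⟩ := eventually_nhds_iff.1
      ((hψc.eventually (by simp)).and (hcont.eventually (hNo.mem_nhds hmem)))
    have hinK : ∀ s : Icc (0 : ℝ) 1, s.1 ∈ I → (s.1, ψ s.1) ∈ K := fun s hs =>
      (hN _ (hI _ hs).2).2 s.2 <| by
        rw [(hN _ (hI _ hs).2).1.2 rfl, hK0 _ p.2]
    refine ⟨{ toFun := π
              invFun := fun s => if h : s.1 ∈ I then ⟨(s.1, ψ s.1), hinK s h⟩ else p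
              source := {q : K | q.1 ∈ N ∧ q.1.1 ∈ I}
              target := {s | s.1 ∈ I}
              map_source' := fun q hq => hq.2
              map_target' := fun s hs => ?_
              left_inv' := fun q hq => ?_
              right_inv' := fun s hs => ?_
              open_source := (hNo.preimage continuous_subtype_val).inter
                (hIo.preimage (continuous_fst.comp continuous_subtype_val))
              open_target := hIo.preimage continuous_subtype_val
              continuousOn_toFun := hπ.continuousOn
              continuousOn_invFun := ?_ }, ⟨hpN, hpI⟩, fun q _ => rfl⟩
    · have hs' : s.1 ∈ I := hs
      simp only [hs', dif_pos]
      exact ⟨(hI _ hs').2, hs'⟩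
    · have hq2 : (π q).1 ∈ I := hq.2
      simp only [hq2, dif_pos]
      refine Subtype.ext (Prod.ext rfl ?_)
      exact (hN _ hq.1).1.1 (by rw [hK0 _ q.2, hK0 _ p.2])
    · have hs' : s.1 ∈ I := hs
      simp only [hs', dif_pos]
      rfl
    · rw [continuousOn_iff_continuous_domRestrict]
      have : Continuous fun s : {s : Icc (0 : ℝ) 1 | s.1 ∈ I} => (s.1.1, ψ s.1.1) := by
        rw [continuous_iff_continuousAt]
        intro s
        refine ContinuousAt.prodMk (by fun_prop) ?_
        exact ContinuousAt.comp (f := fun s : {s : Icc (0 : ℝ) 1 | s.1 ∈ I} => s.1.1)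
          (hI _ s.2).1.continuousAt (by fun_prop)
      refine Continuous.congr (this.subtype_mk fun s => hinK s.1 s.2) fun s => ?_
      have hs' : s.1.1 ∈ I := s.2
      simp only [Set.domRestrict_apply, hs', dif_pos]
  have : CompactSpace K := isCompact_iff_compactSpace.1 hK
  have key : ∀ t : Icc (0 : ℝ) 1, Nat.card (π ⁻¹' {t}) = {v | (t.1, v) ∈ K}.ncard := fun t => by
    rw [← Nat.card_coe_set_eq]
    refine Nat.card_congr
      { toFun := fun q => ⟨q.1.1.2, ?_⟩
        invFun := fun v => ⟨⟨(t.1, v.1), v.2⟩, rfl⟩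
        left_inv := fun q => ?_
        right_inv := fun v => rfl }
    · have : q.1.1.1 = t.1 := congrArg Subtype.val q.2
      simp [← this]
    · have : q.1.1.1 = t.1 := congrArg Subtype.val q.2
      exact Subtype.ext (Subtype.ext (Prod.ext this.symm rfl))
  have h := card_fiber_eq_of_isLocalHomeomorph hloc ⟨0, by simp⟩ ⟨1, by simp⟩
  rwa [key, key] at h

end

section

/-! ### Real polynomials that are nonnegative on the real line -/

open Polynomial

theorem leadingCoeff_nonneg_of_eval_nonneg {p : ℝ[X]} (hp : ∀ x, 0 ≤ p.eval x) :
    0 ≤ p.leadingCoeff := by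
  by_contra! h
  by_cases hd : 0 < p.degree
  · obtain ⟨x, hx⟩ := ((p.tendsto_atBot_of_leadingCoeff_nonpos hd h.le).eventually
      (Filter.eventually_lt_atBot 0)).exists
    exact (hp x).not_gt hx
  · rw [eq_C_of_degree_le_zero (not_lt.1 hd)] at h hp
    have := hp 0
    simp at this h
    linarith

theorem coeff_nonneg_of_eval_nonneg {p : ℝ[X]} {n : ℕ} (hd : p.natDegree ≤ n)
    (hp : ∀ x, 0 ≤ p.eval x) : 0 ≤ p.coeff n := by
  rcases hd.lt_or_eq with h | h
  · rw [coeff_eq_zero_of_natDegree_lt h]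
  · rw [← h]; exact leadingCoeff_nonneg_of_eval_nonneg hp

theorem even_natDegree_of_eval_nonneg {p : ℝ[X]} (hp : ∀ x, 0 ≤ p.eval x) :
    Even p.natDegree := by
  by_contra h
  rw [Nat.not_even_iff_odd] at h
  have h1 := leadingCoeff_nonneg_of_eval_nonneg hp
  have h2 := leadingCoeff_nonneg_of_eval_nonneg (p := p.comp (-X)) fun x => by
    rw [eval_comp]; exact hp _
  rw [leadingCoeff_comp (by simp)] at h2
  simp only [leadingCoeff_neg, leadingCoeff_X, h.neg_one_pow] at h2
  have : p = 0 := leadingCoeff_eq_zero.1 (by linarith)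
  simp [this] at h

theorem X_sub_C_sq_dvd_of_eval_nonneg {p : ℝ[X]} (hp : ∀ x, 0 ≤ p.eval x) {a : ℝ}
    (ha : p.eval a = 0) : (X - C a) ^ 2 ∣ p := by
  obtain ⟨q, rfl⟩ := dvd_iff_isRoot.2 ha
  have hmin : IsLocalMin (fun x => ((X - C a) * q).eval x) a :=
    Filter.Eventually.of_forall fun x => by
      change ((X - C a) * q).eval a ≤ ((X - C a) * q).eval x
      rw [ha]; exact hp x
  have := hmin.hasDerivAt_eq_zero (((X - C a) * q).hasDerivAt a)
  simp only [derivative_mul, derivative_sub, derivative_X, derivative_C, eval_add, eval_mul,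
    eval_sub, eval_X, eval_C, eval_one, sub_self] at this
  obtain ⟨r, rfl⟩ := dvd_iff_isRoot.2 (show IsRoot q a by simpa using this)
  exact ⟨r, by ring⟩

/-- A polynomial that is nonnegative off the zeros of a nonzero polynomial is nonnegative. -/
theorem eval_nonneg_of_ne_zero {p q : ℝ[X]} (hq : q ≠ 0)
    (h : ∀ x, q.eval x ≠ 0 → 0 ≤ p.eval x) (x : ℝ) : 0 ≤ p.eval x := by
  have hd : Dense {x | q.eval x ≠ 0} := by
    have := (q.roots.toFinset.finite_toSet.countable).dense_compl ℝ
    refine this.mono fun x hx => ?_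
    simpa [hq] using hx
  have hc : IsClosed {x | 0 ≤ p.eval x} := isClosed_le continuous_const p.continuous
  exact (hc.closure_subset_iff.2 (show {x | q.eval x ≠ 0} ⊆ {x | 0 ≤ p.eval x} from h))
    (hd x)

theorem eval_pos_of_squarefree {p : ℝ[X]} (hp : ∀ x, 0 ≤ p.eval x) (hs : Squarefree p) (x : ℝ) :
    0 < p.eval x := by
  refine (hp x).lt_of_ne fun h => ?_
  have := hs (X - C x) (by rw [← sq]; exact X_sub_C_sq_dvd_of_eval_nonneg hp h.symm)
  exact not_isUnit_X_sub_C x this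

/-- There is no cancellation between the leading terms of `u²` and `Γ v²`. -/
theorem natDegree_le_of_sq_add_mul_sq {Γ u v D : ℝ[X]} (hΓ : 0 < Γ.leadingCoeff)
    (h : u ^ 2 + Γ * v ^ 2 = D) :
    2 * u.natDegree ≤ D.natDegree ∧ (v ≠ 0 → Γ.natDegree + 2 * v.natDegree ≤ D.natDegree) := by
  have hΓ0 : Γ ≠ 0 := by rintro rfl; simp at hΓ
  by_cases hu : u = 0
  · subst hu
    rw [← h]
    refine ⟨by simp, fun hv => ?_⟩
    rw [zero_pow two_ne_zero, zero_add, natDegree_mul hΓ0 (pow_ne_zero _ hv), natDegree_pow]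
  by_cases hv : v = 0
  · subst hv
    rw [← h]
    simp
  have hlt : (u ^ 2).leadingCoeff + (Γ * v ^ 2).leadingCoeff ≠ 0 := by
    rw [leadingCoeff_mul, leadingCoeff_pow, leadingCoeff_pow]
    have := leadingCoeff_ne_zero.2 hu
    positivity
  have := degree_add_eq_of_leadingCoeff_add_ne_zero hlt
  rw [h] at this
  have hD : D ≠ 0 := by
    rintro rfl
    rw [degree_zero] at this
    have h2 := le_max_left (u ^ 2).degree (Γ * v ^ 2).degree
    rw [← this] at h2
    exact pow_ne_zero 2 hu (degree_eq_bot.1 (le_bot_iff.1 h2))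
  constructor
  · rw [← natDegree_pow]
    exact natDegree_le_natDegree (this ▸ le_max_left _ _)
  · intro _
    rw [← natDegree_pow, ← natDegree_mul hΓ0 (pow_ne_zero _ hv)]
    exact natDegree_le_natDegree (this ▸ le_max_right _ _)

theorem eq_quadratic_of_natDegree_le {R : Type*} [CommRing R] {p : R[X]} (hp : p.natDegree ≤ 2) :
    p = C (p.coeff 2) * X ^ 2 + C (p.coeff 1) * X + C (p.coeff 0) := by
  conv_lhs => rw [p.as_sum_range_C_mul_X_pow' (Nat.lt_succ_of_le hp)]
  simp [Finset.sum_range_succ]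
  ring

/-! ### Representations by the norm form `u² + Γ v²` -/

/-- The solutions `(u, v)` of `u² + Γ v² = D`. -/
def normSolutions (Γ D : ℝ[X]) : Set (ℝ[X] × ℝ[X]) := {p | p.1 ^ 2 + Γ * p.2 ^ 2 = D}

/-- A positive quadratic polynomial is represented by the norm form: `Q - t Γ` has a double root
for the smallest `t` at which it is not positive. -/
theorem exists_normSolution_quadratic {Γ Q : ℝ[X]} (hΓd : Γ.natDegree = 2) (hQd : Q.natDegree = 2)
    (hΓ : ∀ x, 0 < Γ.eval x) (hQ : ∀ x, 0 < Q.eval x) :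
    ∃ (a : ℝ[X]) (b : ℝ), b ≠ 0 ∧ a ^ 2 + Γ * C b ^ 2 = Q := by
  obtain ⟨g2, hg2⟩ : ∃ c, c = Γ.coeff 2 := ⟨_, rfl⟩
  obtain ⟨g1, hg1⟩ : ∃ c, c = Γ.coeff 1 := ⟨_, rfl⟩
  obtain ⟨g0, hg0⟩ : ∃ c, c = Γ.coeff 0 := ⟨_, rfl⟩
  obtain ⟨q2, hq2⟩ : ∃ c, c = Q.coeff 2 := ⟨_, rfl⟩
  obtain ⟨q1, hq1⟩ : ∃ c, c = Q.coeff 1 := ⟨_, rfl⟩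
  obtain ⟨q0, hq0⟩ : ∃ c, c = Q.coeff 0 := ⟨_, rfl⟩
  have hΓe := eq_quadratic_of_natDegree_le hΓd.le
  have hQe := eq_quadratic_of_natDegree_le hQd.le
  rw [← hg2, ← hg1, ← hg0] at hΓe
  rw [← hq2, ← hq1, ← hq0] at hQe
  have hg2p : 0 < g2 := by
    have h := leadingCoeff_nonneg_of_eval_nonneg fun x => (hΓ x).le
    have h' : Γ.leadingCoeff ≠ 0 := leadingCoeff_ne_zero.2 (by rintro rfl; simp at hΓd)
    rw [leadingCoeff, hΓd, ← hg2] at h h'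
    exact h.lt_of_ne' h'
  have hq2p : 0 < q2 := by
    have h := leadingCoeff_nonneg_of_eval_nonneg fun x => (hQ x).le
    have h' : Q.leadingCoeff ≠ 0 := leadingCoeff_ne_zero.2 (by rintro rfl; simp at hQd)
    rw [leadingCoeff, hQd, ← hq2] at h h'
    exact h.lt_of_ne' h'
  have hg0p : 0 < g0 := by have := hΓ 0; rw [hΓe] at this; simpa using this
  have hq0p : 0 < q0 := by have := hQ 0; rw [hQe] at this; simpa using this
  have hdisc : q1 ^ 2 - 4 * q0 * q2 < 0 := by
    have := hQ (-q1 / (2 * q2))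
    rw [hQe] at this
    simp only [eval_add, eval_mul, eval_C, eval_pow, eval_X] at this
    have h2 : q2 * (-q1 / (2 * q2)) ^ 2 + q1 * (-q1 / (2 * q2)) + q0
      = (4 * q0 * q2 - q1 ^ 2) / (4 * q2) := by field_simp; ring
    rw [h2] at this
    have := (div_pos_iff_of_pos_right (by positivity)).1 this
    linarith
  obtain ⟨m, hm0, hm2, hm00, hm⟩ : ∃ m, 0 < m ∧ m * g2 ≤ q2 ∧ m * g0 ≤ q0 ∧
      (q2 - m * g2) * (q0 - m * g0) = 0 := by
    rcases le_total (q2 / g2) (q0 / g0) with h | h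
    · refine ⟨q2 / g2, by positivity, ?_, ?_, ?_⟩
      · rw [div_mul_cancel₀ _ hg2p.ne']
      · exact (le_div_iff₀ hg0p).1 h
      · rw [div_mul_cancel₀ _ hg2p.ne']; ring
    · refine ⟨q0 / g0, by positivity, ?_, ?_, ?_⟩
      · exact (le_div_iff₀ hg2p).1 h
      · rw [div_mul_cancel₀ _ hg0p.ne']
      · rw [div_mul_cancel₀ _ hg0p.ne']; ring
  have hcont : Continuous fun t : ℝ => (q1 - t * g1) ^ 2 - 4 * ((q0 - t * g0) * (q2 - t * g2)) := by
    fun_prop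
  obtain ⟨t, ⟨ht0, htm⟩, ht⟩ := intermediate_value_Icc hm0.le hcont.continuousOn
    (show (0 : ℝ) ∈ Set.Icc _ _ from ⟨by simp; linarith, by
      rw [mul_comm (q0 - _), hm]; nlinarith [sq_nonneg (q1 - m * g1)]⟩)
  have ht' : 0 < t := by
    refine ht0.lt_of_ne ?_
    rintro rfl
    simp at ht
    linarith
  have hα : 0 ≤ q2 - t * g2 := by nlinarith
  have hγ : 0 ≤ q0 - t * g0 := by nlinarith
  set α := √(q2 - t * g2) with hαd
  set γ := √(q0 - t * g0) with hγd
  have hα2 : α ^ 2 = q2 - t * g2 := Real.sq_sqrt hα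
  have hγ2 : γ ^ 2 = q0 - t * g0 := Real.sq_sqrt hγ
  have hsq : (q1 - t * g1) ^ 2 = (2 * α * γ) ^ 2 := by
    rw [mul_pow, mul_pow, hα2, hγ2]; linarith
  have hb : (√t) ^ 2 = t := Real.sq_sqrt ht'.le
  obtain ⟨e, he, hq1'⟩ : ∃ e : ℝ, e ^ 2 = 1 ∧ q1 - t * g1 = 2 * α * (e * γ) := by
    rcases sq_eq_sq_iff_eq_or_eq_neg.1 hsq with h | h
    · exact ⟨1, by norm_num, by rw [h]; ring⟩
    · exact ⟨-1, by norm_num, by rw [h]; ring⟩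
  refine ⟨C α * X + C (e * γ), √t, (Real.sqrt_pos.2 ht').ne', ?_⟩
  rw [hΓe, hQe, ← C_pow, hb]
  have e2 : q2 = α ^ 2 + t * g2 := by linarith
  have e1 : q1 = 2 * α * (e * γ) + t * g1 := by linarith
  have e0 : q0 = (e * γ) ^ 2 + t * g0 := by rw [mul_pow, he]; linarith
  rw [e2, e1, e0]
  simp only [C_add, C_mul, C_pow, C_ofNat]
  ring

/-- Multiplication by the elements `a ± b √(-Γ)` of norm `Q` shows that `QE` has twice as many
representations as `E`. -/
theorem encard_normSolutions_mul {Γ Q E a b : ℝ[X]} (hQ : Prime Q) (hab : a ^ 2 + Γ * b ^ 2 = Q)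
    (hE : ¬ Q ∣ E) (ha : ¬ Q ∣ a) (hb : ¬ Q ∣ b) :
    (normSolutions Γ (Q * E)).encard = 2 * (normSolutions Γ E).encard := by
  let m : ℝ[X] → ℝ[X] × ℝ[X] → ℝ[X] × ℝ[X] :=
    fun e p => (a * p.1 - e * b * p.2 * Γ, a * p.2 + e * b * p.1)
  have hinj : ∀ e : ℝ[X], e ^ 2 = 1 → Function.Injective (m e) := by
    rintro e he ⟨u, v⟩ ⟨u', v'⟩ h
    simp only [m, Prod.mk.injEq] at h
    have h1 : Q * (u - u') = 0 := by
      linear_combination a * h.1 + e * b * Γ * h.2 - (u - u') * hab - b ^ 2 * Γ * (u - u') * he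
    have h2 : Q * (v - v') = 0 := by
      linear_combination a * h.2 - e * b * h.1 - (v - v') * hab - b ^ 2 * Γ * (v - v') * he
    have h1' := (mul_eq_zero.1 h1).resolve_left hQ.ne_zero
    have h2' := (mul_eq_zero.1 h2).resolve_left hQ.ne_zero
    rw [sub_eq_zero.1 h1', sub_eq_zero.1 h2']
  have hmem : ∀ e : ℝ[X], e ^ 2 = 1 → ∀ p ∈ normSolutions Γ E, m e p ∈ normSolutions Γ (Q * E) := by
    rintro e he ⟨u, v⟩ h
    simp only [normSolutions, Set.mem_ofPred_eq, m] at h ⊢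
    linear_combination Q * h + (u ^ 2 + Γ * v ^ 2) * hab
      + (b ^ 2 * v ^ 2 * Γ ^ 2 + Γ * b ^ 2 * u ^ 2) * he
  have hdvd : ∀ e : ℝ[X], e ^ 2 = 1 → ∀ p, Q ∣ a * (m e p).2 - e * b * (m e p).1 := by
    rintro e he ⟨u, v⟩
    refine ⟨v, ?_⟩
    simp only [m]
    linear_combination v * hab + b ^ 2 * v * Γ * he
  have hunion : normSolutions Γ (Q * E)
      = m 1 '' normSolutions Γ E ∪ m (-1) '' normSolutions Γ E := by
    apply Set.Subset.antisymm
    · rintro ⟨U, V⟩ h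
      simp only [normSolutions, Set.mem_ofPred_eq] at h
      have hprod : Q ∣ (a * V - 1 * b * U) * (a * V - (-1) * b * U) :=
        ⟨V ^ 2 - b ^ 2 * E, by linear_combination V ^ 2 * hab - b ^ 2 * h⟩
      have key : ∀ e : ℝ[X], e ^ 2 = 1 → Q ∣ a * V - e * b * U →
          (U, V) ∈ m e '' normSolutions Γ E := by
        rintro e he ⟨v, hv⟩
        have h1 : Q ∣ (a * U + e * b * Γ * V) ^ 2 :=
          ⟨Q * E - Γ * Q * v ^ 2, by
            linear_combination Q * h + (U ^ 2 + Γ * V ^ 2) * hab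
              + (b ^ 2 * Γ ^ 2 * V ^ 2 + Γ * b ^ 2 * U ^ 2) * he
              - Γ * (a * V - e * b * U + Q * v) * hv⟩
        obtain ⟨u, hu⟩ := hQ.dvd_of_dvd_pow h1
        have hQ0 := hQ.ne_zero
        refine ⟨(u, v), ?_, ?_⟩
        · simp only [normSolutions, Set.mem_ofPred_eq]
          apply mul_left_cancel₀ (pow_ne_zero 2 hQ0)
          linear_combination (-(Q * u) - (a * U + e * b * Γ * V)) * hu
            - Γ * (a * V - e * b * U + Q * v) * hv + Q * h + (U ^ 2 + Γ * V ^ 2) * hab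
              + (b ^ 2 * Γ ^ 2 * V ^ 2 + Γ * b ^ 2 * U ^ 2) * he
        · simp only [m]
          refine Prod.ext (mul_left_cancel₀ hQ0 ?_) (mul_left_cancel₀ hQ0 ?_)
          · linear_combination (-a) * hu + e * b * Γ * hv + U * hab + b ^ 2 * Γ * U * he
          · linear_combination (-a) * hv - e * b * hu + V * hab + b ^ 2 * Γ * V * he
      rcases hQ.dvd_or_dvd hprod with h1 | h1
      · exact Or.inl (key 1 (by ring) h1)
      · exact Or.inr (key (-1) (by ring) h1)
    · rintro p (⟨q, hq, rfl⟩ | ⟨q, hq, rfl⟩)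
      · exact hmem 1 (by ring) q hq
      · exact hmem (-1) (by ring) q hq
  have hdisj : Disjoint (m 1 '' normSolutions Γ E) (m (-1) '' normSolutions Γ E) := by
    rw [Set.disjoint_left]
    rintro p ⟨q, hq, rfl⟩ ⟨q', hq', h⟩
    have h1 := hdvd 1 (by ring) q
    have h2 := hdvd (-1) (by ring) q'
    rw [h] at h2
    have hp := hmem 1 (by ring) q hq
    generalize m 1 q = p at h1 h2 hp
    obtain ⟨U, V⟩ := p
    have two : IsUnit (2 : ℝ[X]) := by
      have : (2 : ℝ[X]) = C 2 := (map_ofNat C 2).symm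
      rw [this, isUnit_C]; norm_num
    have hV : Q ∣ V := by
      have : Q ∣ 2 * (a * V) := by convert dvd_add h1 h2 using 1; ring
      exact ((hQ.dvd_or_dvd ((two.dvd_mul_left).1 this))).resolve_left ha
    have hU : Q ∣ U := by
      have : Q ∣ 2 * (b * U) := by convert dvd_sub h2 h1 using 1; ring
      exact ((hQ.dvd_or_dvd ((two.dvd_mul_left).1 this))).resolve_left hb
    obtain ⟨u, rfl⟩ := hU
    obtain ⟨v, rfl⟩ := hV
    simp only [normSolutions, Set.mem_ofPred_eq] at hp
    refine hE ⟨u ^ 2 + Γ * v ^ 2, mul_left_cancel₀ hQ.ne_zero ?_⟩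
    linear_combination -hp
  rw [hunion, Set.encard_union_eq hdisj, (hinj 1 (by ring)).encard_image,
    (hinj (-1) (by ring)).encard_image, two_mul]

/-- A positive squarefree polynomial of degree `2n` that is coprime to the positive quadratic
polynomial `Γ` has `2ⁿ⁺¹` representations by the form `u² + Γ v²`. -/
theorem encard_normSolutions {Γ : ℝ[X]} (hΓd : Γ.natDegree = 2) (hΓ : ∀ x, 0 < Γ.eval x) (n : ℕ) :
    ∀ D : ℝ[X], D.natDegree = 2 * n → (∀ x, 0 < D.eval x) → Squarefree D → IsCoprime D Γ →
      (normSolutions Γ D).encard = 2 ^ (n + 1) := by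
  have hΓlc : 0 < Γ.leadingCoeff :=
    (leadingCoeff_nonneg_of_eval_nonneg fun x => (hΓ x).le).lt_of_ne'
      (leadingCoeff_ne_zero.2 (by rintro rfl; simp at hΓd))
  induction n with
  | zero =>
    intro D hD hDp _ _
    obtain ⟨c, rfl⟩ : ∃ c, D = C c := ⟨_, eq_C_of_natDegree_eq_zero hD⟩
    have hc : 0 < c := by simpa using hDp 0
    have hs : (√c) ^ 2 = c := Real.sq_sqrt hc.le
    have hs0 : √c ≠ 0 := (Real.sqrt_pos.2 hc).ne'
    have : normSolutions Γ (C c) = {(C (√c), 0), (-C (√c), 0)} := by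
      ext ⟨u, v⟩
      simp only [normSolutions, Set.mem_ofPred_eq, Set.mem_insert_iff, Set.mem_singleton_iff,
        Prod.mk.injEq]
      constructor
      · intro h
        have hv : v = 0 := by
          by_contra hv
          have := (natDegree_le_of_sq_add_mul_sq hΓlc h).2 hv
          rw [natDegree_C] at this
          omega
        subst hv
        have : u ^ 2 = C (√c) ^ 2 := by rw [← C_pow, hs]; linear_combination h
        rcases sq_eq_sq_iff_eq_or_eq_neg.1 this with h | h <;> simp [h]
      · rintro (⟨rfl, rfl⟩ | ⟨rfl, rfl⟩) <;> simp [← C_pow, hs]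
    rw [this, Set.encard_pair]
    · norm_num
    · intro h
      have h1 := congrArg (eval 0) (Prod.mk.inj h).1
      simp only [eval_C, eval_neg] at h1
      exact hs0 (by linarith)
  | succ n ih =>
    intro D hD hDp hDs hDΓ
    have hD0 : D ≠ 0 := by rintro rfl; simp at hD
    obtain ⟨Q, hQi, hQD⟩ := exists_irreducible_of_natDegree_pos (f := D) (by omega)
    have hQroot : ∀ x, Q.eval x ≠ 0 := by
      intro x hx
      obtain ⟨r, rfl⟩ := hQD
      have := hDp x
      rw [eval_mul, hx, zero_mul] at this
      exact lt_irrefl _ this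
    have hQd : Q.natDegree = 2 := by
      have h1 := hQi.natDegree_le_two
      have h0 : Q.natDegree ≠ 0 := fun h => hQi.not_isUnit (by
        rw [eq_C_of_natDegree_eq_zero h, isUnit_C, isUnit_iff_ne_zero]
        intro h'
        apply hQi.ne_zero
        rw [eq_C_of_natDegree_eq_zero h, h', C_0])
      have h2 : Q.natDegree ≠ 1 := fun h => by
        obtain ⟨x, hx⟩ := exists_root_of_degree_eq_one
          ((degree_eq_iff_natDegree_eq hQi.ne_zero).2 h)
        exact hQroot x hx
      omega
    -- an irreducible factor can be chosen positive, as it has no real zero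
    obtain ⟨Q, hQi, hQD, hQd, hQp⟩ : ∃ Q : ℝ[X], Irreducible Q ∧ Q ∣ D ∧ Q.natDegree = 2 ∧
        ∀ x, 0 < Q.eval x := by
      have hsign : (∀ x, 0 < Q.eval x) ∨ ∀ x, Q.eval x < 0 := by
        by_contra! h
        obtain ⟨⟨x, hx⟩, y, hy⟩ := h
        obtain ⟨z, hz⟩ := mem_range_of_exists_le_of_exists_ge Q.continuous ⟨x, hx⟩ ⟨y, hy⟩
        exact hQroot z hz
      rcases hsign with h | h
      · exact ⟨Q, hQi, hQD, hQd, h⟩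
      · exact ⟨-Q, (Associated.irreducible_iff ⟨-1, by simp⟩).1 hQi, (neg_dvd).2 hQD,
          by rw [natDegree_neg, hQd], fun x => by rw [eval_neg]; linarith [h x]⟩
    obtain ⟨E, rfl⟩ := hQD
    have hQ0 := hQi.ne_zero
    have hE0 : E ≠ 0 := by rintro rfl; simp at hD0
    have hEd : E.natDegree = 2 * n := by
      rw [natDegree_mul hQ0 hE0, hQd] at hD
      omega
    have hEp : ∀ x, 0 < E.eval x := fun x => by
      have := hDp x
      rw [eval_mul] at this
      exact pos_of_mul_pos_right this (hQp x).le
    have hQE : ¬ Q ∣ E := fun ⟨r, hr⟩ =>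
      hQi.not_isUnit (hDs Q ⟨r, by rw [hr]; ring⟩)
    have hQΓ : ¬ Q ∣ Γ := fun h =>
      hQi.not_isUnit (hDΓ.isUnit_of_dvd' (dvd_mul_right _ _) h)
    obtain ⟨a, b, hb, hab⟩ := exists_normSolution_quadratic hΓd hQd hΓ hQp
    have hbu : IsUnit (C b) := isUnit_C.2 hb.isUnit
    have ha : ¬ Q ∣ a := fun h => by
      refine hQΓ (((hbu.pow 2).dvd_mul_right).1 ?_)
      rw [← sub_eq_iff_eq_add'.2 hab.symm]
      exact dvd_sub dvd_rfl (dvd_pow h two_ne_zero)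
    rw [encard_normSolutions_mul hQi.prime hab hQE ha
      (fun h => hQi.not_isUnit (isUnit_of_dvd_unit h hbu)),
      ih E hEd hEp (hDs.squarefree_of_dvd (dvd_mul_left _ _))
        (hDΓ.of_isCoprime_of_dvd_left (dvd_mul_left _ _)), pow_succ 2 (n + 1), mul_comm]

end

section

/-! ### Consequences of the nonvanishing of `disc` and `Phi` -/

open Polynomial

theorem pairwise_of_pairProd_ne_zero {L : List (ℂ × ℂ)} {F : ℂ × ℂ → ℂ × ℂ → ℂ}
    (h : pairProd L F ≠ 0) : L.Pairwise fun P Q => F P Q ≠ 0 := by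
  rw [List.pairwise_iff_get]
  intro i j hij
  exact Finset.prod_ne_zero_iff.1 (Finset.prod_ne_zero_iff.1 h i (Finset.mem_univ _)) j
    (Finset.mem_Ioi.2 hij)

theorem separable_of_disc_ne_zero {m : ℕ} (hm : 2 ≤ m) {p : ℝ[X]} (h : disc m p ≠ 0) :
    p.Separable ∧ m ≤ p.natDegree + 1 := by
  rw [disc, mul_ne_zero_iff] at h
  have hp : p ≠ 0 := by
    rintro rfl
    refine h.1 ?_
    rw [leadingCoeff_zero, Complex.ofReal_zero, zero_pow (by omega)]
  have hpw := pairwise_of_pairProd_ne_zero h.2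
  rw [projRoots, List.pairwise_append, List.pairwise_map, List.pairwise_replicate] at hpw
  constructor
  · have hnd : (p.aroots ℂ).Nodup := by
      rw [← Multiset.coe_toList (p.aroots ℂ), Multiset.coe_nodup]
      refine hpw.1.imp fun {a b} hab h => hab ?_
      simp [h]
    exact ((nodup_aroots_iff_of_splits hp (IsAlgClosed.splits _)).1 hnd)
  · rcases hpw.2.1 with h1 | h1
    · omega
    · simp at h1

theorem homEval_eq_aeval {n : ℕ} {g : ℝ[X]} (hg : g.natDegree ≤ n) (α : ℂ) :
    homEval n g (α, 1) = aeval α g := by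
  rw [homEval, aeval_eq_sum_range' (Nat.lt_succ_of_le hg)]
  exact Finset.sum_congr rfl fun k _ => by simp [Algebra.smul_def]

/-- If the quotient of the values of `g` and `h` at a nonreal root of `p` is real, it is the same at
the conjugate root, and `Phi` vanishes. -/
theorem Phi_eq_zero_of_nonreal_root {m n : ℕ} (hm : 2 ≤ m) (hn : 2 ≤ n) {p g h : ℝ[X]}
    (hg : g.natDegree ≤ n) (hh : h.natDegree ≤ n) {α : ℂ} (hα : aeval α p = 0) (him : α.im ≠ 0)
    {r : ℝ} (hr : aeval α g = r * aeval α h) : Phi m n p g h = 0 := by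
  by_contra hne
  rw [Phi, ← ne_eq, mul_ne_zero_iff] at hne
  have hp : p ≠ 0 := by
    rintro rfl
    refine hne.1 ?_
    rw [leadingCoeff_zero, Complex.ofReal_zero,
      zero_pow (mul_ne_zero (by omega) (by omega))]
  have hpw := pairwise_of_pairProd_ne_zero hne.2
  rw [projRoots, List.pairwise_append, List.pairwise_map] at hpw
  have hpw' : (p.aroots ℂ).toList.Pairwise fun a b => a ≠ b →
      aeval a g * aeval b h - aeval b g * aeval a h ≠ 0 := by
    refine hpw.1.imp fun {a b} hab hne' => ?_
    have := mul_phiFactor n g h (a, 1) (b, 1)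
    rw [homEval_eq_aeval hg, homEval_eq_aeval hg, homEval_eq_aeval hh, homEval_eq_aeval hh] at this
    rw [← this]
    exact mul_ne_zero (by simpa [sub_eq_zero] using hne') hab
  have hαc : aeval (starRingEnd ℂ α) p = 0 := by rw [aeval_conj, hα, map_zero]
  have hne' : α ≠ starRingEnd ℂ α := fun h => him (Complex.conj_eq_iff_im.1 h.symm)
  have hsymm : ∀ a b : ℂ, (a ≠ b → aeval a g * aeval b h - aeval b g * aeval a h ≠ 0) →
      (b ≠ a → aeval b g * aeval a h - aeval a g * aeval b h ≠ 0) := fun a b hab hba h0 =>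
    hab hba.symm (by linear_combination -h0)
  have : Std.Symm fun a b : ℂ => a ≠ b → aeval a g * aeval b h - aeval b g * aeval a h ≠ 0 :=
    ⟨hsymm⟩
  refine hpw'.forall (by simp [hp, hα]) (by simp [hp, hαc]) hne' hne' ?_
  rw [aeval_conj, aeval_conj, hr, map_mul, Complex.conj_ofReal]
  ring

end

section

/-! ### The family `s² z⁴ + G₂ z² + G₃ z + G₄` and its nondegeneracy -/

open Polynomial

/-- The properties of the dehomogenization `y = 1` of a psd form `g₂ z² + g₃ z + g₄` for which `E1`,
`E2` and `E3` fail. -/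
structure IsRegular (G₂ G₃ G₄ : ℝ[X]) : Prop where
  natDegree_two : G₂.natDegree = 2
  natDegree_three : G₃.natDegree ≤ 3
  natDegree_four : G₄.natDegree ≤ 4
  pos : ∀ x, 0 < G₂.eval x
  coprime : IsCoprime G₂ G₃
  natDegree_disc : (4 * G₂ * G₄ - G₃ ^ 2).natDegree = 6
  separable_disc : (4 * G₂ * G₄ - G₃ ^ 2).Separable
  disc_pos : ∀ x, 0 < (4 * G₂ * G₄ - G₃ ^ 2).eval x

/-- The polynomial `i p q' - j q p'`. -/
def weightedWronskian (i j : ℕ) (p q : ℝ[X]) : ℝ[X] :=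
  (i : ℝ[X]) * p * derivative q - (j : ℝ[X]) * q * derivative p

/-- Genericity conditions under which the curves `s² z⁴ + g₂ z² + g₃ z + g₄ = 0`, for `0 < s ≤ 1`,
have no singular point that could change the number of representations. By the last two fields, at
nonreal zeros of `G₃` the quotient `G₂² / G₄`, and at nonreal zeros of `P` the quotient `Q / R²`, is
not a real number; here `P`, `Q`, `R` are the polynomials `polP`, `polQ`, `polR`. -/
structure IsGeneric (G₂ G₃ G₄ : ℝ[X]) : Prop extends IsRegular G₂ G₃ G₄ where
  separable_three : G₃.Separable
  two_le_natDegree_three : 2 ≤ G₃.natDegree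
  not_real_ratio : ∀ (α : ℂ) (r : ℝ), α.im ≠ 0 → aeval α G₃ = 0 →
    aeval α (G₂ ^ 2) ≠ r * aeval α G₄
  not_real_parameter : ∀ (α : ℂ) (r : ℝ), α.im ≠ 0 →
    aeval α (weightedWronskian 2 3 G₂ G₃ * weightedWronskian 3 4 G₃ G₄
      - weightedWronskian 2 4 G₂ G₄ ^ 2) = 0 →
    aeval α (G₄ ^ 2 * weightedWronskian 2 3 G₂ G₃ *
      (2 * G₄ * weightedWronskian 2 3 G₂ G₃ - G₃ * weightedWronskian 2 4 G₂ G₄)) ≠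
    r * aeval α (((8 * G₂ * G₄ - 3 * G₃ ^ 2) * weightedWronskian 2 3 G₂ G₃
      + 2 * G₂ * G₃ * weightedWronskian 2 4 G₂ G₄) ^ 2)

/-- The pairs `(ξ, η)` with `4 (G₂ - 2 s ξ) (G₄ - ξ²) - G₃² = η²` and `G₂ - 2 s ξ` psd. Up to the sign
of `η`, they correspond to the representations of `s² z⁴ + G₂ z² + G₃ z + G₄` as the sum of
`(s z² + ξ)²` and of the squares of two polynomials that are linear in `z`. -/
def solSet (G₂ G₃ G₄ : ℝ[X]) (s : ℝ) : Set (ℝ[X] × ℝ[X]) :=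
  {p | p.1.natDegree ≤ 2 ∧ p.2.natDegree ≤ 3 ∧ (∀ x, 0 ≤ (G₂ - C (2 * s) * p.1).eval x) ∧
    4 * (G₂ - C (2 * s) * p.1) * (G₄ - p.1 ^ 2) - G₃ ^ 2 = p.2 ^ 2}

/-- Up to a constant, the derivative with respect to `ξ` of the equation that defines `solSet`. -/
def jac (G₂ G₄ : ℝ[X]) (s : ℝ) (ξ : ℝ[X]) : ℝ[X] :=
  C s * (G₄ - ξ ^ 2) + ξ * (G₂ - C (2 * s) * ξ)

/-- At `(ξ, η)`, the differential of the equation that defines `solSet` is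
`(δξ, δη) ↦ -8 jac · δξ - 2 η · δη`. It is injective if `η` and `jac`, as binary forms of degrees `3`
and `4`, have no common zero on the projective line. -/
def IsNondegenerate (G₂ G₄ : ℝ[X]) (s : ℝ) (ξ η : ℝ[X]) : Prop :=
  (∀ α : ℂ, aeval α η = 0 → aeval α (jac G₂ G₄ s ξ) ≠ 0) ∧
    (η.coeff 3 = 0 → (jac G₂ G₄ s ξ).coeff 4 ≠ 0)

variable {G₂ G₃ G₄ : ℝ[X]}

theorem IsRegular.leadingCoeff_pos (h : IsRegular G₂ G₃ G₄) : 0 < G₂.coeff 2 := by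
  have h1 := leadingCoeff_nonneg_of_eval_nonneg fun x => (h.pos x).le
  have h2 : G₂.leadingCoeff ≠ 0 := leadingCoeff_ne_zero.2 fun h0 => by
    have := h.natDegree_two
    simp [h0] at this
  rw [leadingCoeff, h.natDegree_two] at h1 h2
  exact h1.lt_of_ne' h2

theorem coeff_six_mul_sub_sq {A B G : ℝ[X]} (hA : A.natDegree ≤ 2) (hB : B.natDegree ≤ 4)
    (hG : G.natDegree ≤ 3) :
    (4 * A * B - G ^ 2).coeff 6 = 4 * A.coeff 2 * B.coeff 4 - G.coeff 3 ^ 2 := by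
  have h1 : (A * B).coeff (2 + 4) = A.coeff 2 * B.coeff 4 := coeff_mul_add_eq_of_natDegree_le hA hB
  have h2 : (G ^ 2).coeff (2 * 3) = G.coeff 3 ^ 2 := coeff_pow_of_natDegree_le hG
  have h3 : 4 * A * B = C 4 * (A * B) := by rw [map_ofNat]; ring
  rw [coeff_sub, h3, coeff_C_mul]
  norm_num at h1 h2
  rw [h1, h2]; ring

theorem natDegree_pencil_le (h : IsRegular G₂ G₃ G₄) {s : ℝ} {ξ : ℝ[X]} (hξ : ξ.natDegree ≤ 2) :
    (G₂ - C (2 * s) * ξ).natDegree ≤ 2 := by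
  refine (natDegree_sub_le _ _).trans (max_le h.natDegree_two.le ?_)
  exact (natDegree_C_mul_le _ _).trans hξ

theorem natDegree_sub_sq_le (h : IsRegular G₂ G₃ G₄) {ξ : ℝ[X]} (hξ : ξ.natDegree ≤ 2) :
    (G₄ - ξ ^ 2).natDegree ≤ 4 := by
  refine (natDegree_sub_le _ _).trans (max_le h.natDegree_four ?_)
  exact natDegree_pow_le.trans (by omega)

theorem coeff_four_jac (h : IsRegular G₂ G₃ G₄) {s : ℝ} {ξ : ℝ[X]} (hξ : ξ.natDegree ≤ 2) :
    (jac G₂ G₄ s ξ).coeff 4 = s * (G₄ - ξ ^ 2).coeff 4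
      + ξ.coeff 2 * (G₂ - C (2 * s) * ξ).coeff 2 := by
  have h1 : (ξ * (G₂ - C (2 * s) * ξ)).coeff (2 + 2) = ξ.coeff 2 * (G₂ - C (2 * s) * ξ).coeff 2 :=
    coeff_mul_add_eq_of_natDegree_le hξ (natDegree_pencil_le h hξ)
  rw [jac, coeff_add, coeff_C_mul, ← h1]

theorem IsRegular.three_ne_zero (h : IsRegular G₂ G₃ G₄) : G₃ ≠ 0 := by
  rintro rfl
  have h1 := h.coprime
  rw [isCoprime_zero_right] at h1
  have := natDegree_eq_zero_of_isUnit h1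
  rw [h.natDegree_two] at this
  omega

theorem pencil_ne_zero (h : IsRegular G₂ G₃ G₄) {s : ℝ} {ξ η : ℝ[X]}
    (hs : (ξ, η) ∈ solSet G₂ G₃ G₄ s) : G₂ - C (2 * s) * ξ ≠ 0 := by
  intro h0
  have h1 := hs.2.2.2
  simp only [h0, mul_zero, zero_mul, zero_sub] at h1
  refine h.three_ne_zero (Polynomial.funext fun x => ?_)
  have := congrArg (eval x) h1
  simp only [eval_neg, eval_pow] at this
  rw [eval_zero]
  nlinarith [sq_nonneg (eval x G₃), sq_nonneg (eval x η)]

theorem eval_sub_sq_nonneg (h : IsRegular G₂ G₃ G₄) {s : ℝ} {ξ η : ℝ[X]}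
    (hs : (ξ, η) ∈ solSet G₂ G₃ G₄ s) (x : ℝ) : 0 ≤ (G₄ - ξ ^ 2).eval x := by
  refine eval_nonneg_of_ne_zero (pencil_ne_zero h hs) (fun x hx => ?_) x
  have h1 := congrArg (eval x) hs.2.2.2
  have h2 := (hs.2.2.1 x).lt_of_ne' hx
  simp only [eval_sub (p := 4 * _ * _), eval_mul, eval_pow, eval_ofNat] at h1
  nlinarith [sq_nonneg (eval x G₃), sq_nonneg (eval x η)]

theorem IsRegular.isNondegenerate_zero (h : IsRegular G₂ G₃ G₄) {ξ η : ℝ[X]}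
    (hs : (ξ, η) ∈ solSet G₂ G₃ G₄ 0) : IsNondegenerate G₂ G₄ 0 ξ η := by
  obtain ⟨hξ, hη, -, he⟩ := hs
  simp only [mul_zero, C_0, zero_mul, sub_zero] at hξ hη he
  have hD : 4 * G₂ * G₄ - G₃ ^ 2 = η ^ 2 + 4 * G₂ * ξ ^ 2 := by linear_combination he
  have hjac : jac G₂ G₄ 0 ξ = ξ * G₂ := by simp [jac]
  rw [IsNondegenerate, hjac]
  constructor
  · intro α h1 h2
    rw [map_mul, mul_eq_zero] at h2
    rcases h2 with h2 | h2
    · have hsep := h.separable_disc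
      rw [hD, separable_def] at hsep
      rcases aeval_ne_zero_of_isCoprime hsep α with h3 | h3
      · simp [h1, h2] at h3
      · simp [derivative_pow, h1, h2] at h3
    · rcases aeval_ne_zero_of_isCoprime h.coprime α with h3 | h3
      · exact h3 h2
      · have := congrArg (aeval α) he
        simp only [map_sub, map_mul, map_pow, h1, h2, mul_zero, zero_mul, zero_sub] at this
        simp at this
        exact h3 this
  · intro h1 h2
    have h3 : (ξ * G₂).coeff (2 + 2) = ξ.coeff 2 * G₂.coeff 2 :=
      coeff_mul_add_eq_of_natDegree_le hξ h.natDegree_two.le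
    rw [show 2 + 2 = 4 from rfl, h2] at h3
    have h4 : ξ.coeff 2 = 0 :=
      (mul_eq_zero.1 h3.symm).resolve_right h.leadingCoeff_pos.ne'
    have h5 : (4 * G₂ * G₄ - G₃ ^ 2).coeff 6 ≠ 0 := by
      have := leadingCoeff_ne_zero.2 (ne_zero_of_natDegree_gt
        (show 0 < (4 * G₂ * G₄ - G₃ ^ 2).natDegree by rw [h.natDegree_disc]; omega))
      rwa [leadingCoeff, h.natDegree_disc] at this
    refine h5 ?_
    have h6 : 4 * G₂ * G₄ - G₃ ^ 2 = -(4 * (-G₂) * ξ ^ 2 - η ^ 2) := by rw [hD]; ring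
    rw [h6, coeff_neg, coeff_six_mul_sub_sq (by rw [natDegree_neg, h.natDegree_two])
      (natDegree_pow_le.trans (by omega)) hη, h1]
    have h7 : (ξ ^ 2).coeff (2 * 2) = ξ.coeff 2 ^ 2 := coeff_pow_of_natDegree_le hξ
    norm_num at h7
    rw [h7, h4]
    simp

/-- The values at a common zero of `η` and `jac` at which `G₂ - 2 s ξ` does not vanish: the curve
`s² z⁴ + g₂ z² + g₃ z + g₄ = 0` is singular at a point over this zero. In the application, `A` and `B`
are the values of `G₂ - 2 s ξ` and `G₄ - ξ²`. -/
theorem eq_of_degenerate {K : Type*} [Field K] [CharZero K] {s A B g₃ x : K} (hA : A ≠ 0)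
    (h : 4 * A * B = g₃ ^ 2) (hJ : s * B + x * A = 0) :
    ∃ z, g₃ = -2 * A * z ∧ B = A * z ^ 2 ∧ x = -s * z ^ 2 := by
  refine ⟨-g₃ / (2 * A), ?_, ?_, ?_⟩
  · field_simp
  · field_simp; linear_combination h
  · field_simp
    linear_combination 4 * A * hJ - s * h

/-- There are no real degenerate points: `s² z⁴ + g₂ z² + g₃ z + g₄` would have a real zero over such
a point, or `G₃` would have a double zero there. -/
theorem IsGeneric.jac_eval_ne_zero (h : IsGeneric G₂ G₃ G₄) {s : ℝ} (hs0 : s ≠ 0) {ξ η : ℝ[X]}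
    (hs : (ξ, η) ∈ solSet G₂ G₃ G₄ s) (a : ℝ) (hη : η.eval a = 0) :
    (jac G₂ G₄ s ξ).eval a ≠ 0 := by
  intro hJ
  have hB := eval_sub_sq_nonneg h.toIsRegular hs
  obtain ⟨-, -, hA, he⟩ := hs
  have he' : 4 * (G₂ - C (2 * s) * ξ).eval a * (G₄ - ξ ^ 2).eval a - G₃.eval a ^ 2 = 0 := by
    have := congrArg (eval a) he
    simpa [hη] using this
  have hJ' : s * (G₄ - ξ ^ 2).eval a + ξ.eval a * (G₂ - C (2 * s) * ξ).eval a = 0 := by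
    simpa [jac] using hJ
  by_cases hA0 : (G₂ - C (2 * s) * ξ).eval a = 0
  · -- `G₂ - 2 s ξ` and `G₄ - ξ²` have double roots at `a`, so `η² + G₃²` has a fourfold root there
    have hB0 : (G₄ - ξ ^ 2).eval a = 0 := by
      rw [hA0, mul_zero, add_zero, mul_eq_zero] at hJ'
      exact hJ'.resolve_left hs0
    have hG0 : G₃.eval a = 0 := by
      rw [hA0, hB0] at he'
      simpa using he'
    obtain ⟨p, hp⟩ := X_sub_C_sq_dvd_of_eval_nonneg hA hA0
    obtain ⟨q, hq⟩ := X_sub_C_sq_dvd_of_eval_nonneg hB hB0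
    obtain ⟨g, hg⟩ := dvd_iff_isRoot.2 hG0
    obtain ⟨e, rfl⟩ := dvd_iff_isRoot.2 hη
    have h1 : g ^ 2 + e ^ 2 = (X - C a) ^ 2 * (4 * p * q) := by
      refine mul_left_cancel₀ (pow_ne_zero 2 (X_sub_C_ne_zero a)) ?_
      rw [hp, hq, hg] at he
      linear_combination -he
    have h2 := congrArg (eval a) h1
    simp only [eval_add, eval_pow, eval_mul, eval_sub, eval_X, eval_C, sub_self] at h2
    have h3 : IsRoot g a := by
      rw [IsRoot.def]
      nlinarith [sq_nonneg (eval a g), sq_nonneg (eval a e)]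
    obtain ⟨g', hg'⟩ := dvd_iff_isRoot.2 h3
    refine not_isUnit_X_sub_C a (h.separable_three.squarefree (X - C a) ⟨g', ?_⟩)
    rw [hg, hg']; ring
  · obtain ⟨z, hz1, hz2, hz3⟩ := eq_of_degenerate hA0 (sub_eq_zero.1 he') hJ'
    have hD := h.disc_pos a
    have hG := h.pos a
    simp only [eval_sub, eval_mul, eval_pow, eval_C, eval_ofNat] at hz1 hz2 hz3 hD
    have h1 : s ^ 2 * z ^ 4 + G₂.eval a * z ^ 2 + G₃.eval a * z + G₄.eval a = 0 := by
      rw [hz1, hz3] at *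
      linear_combination hz2
    nlinarith [sq_nonneg (s * z ^ 2), sq_nonneg (2 * G₂.eval a * z + G₃.eval a)]

/-- If the curve `s² z⁴ + g₂ z² + g₃ z + g₄ = 0` has a singular point, then its coordinates satisfy
`P = 0`, and `s²` is determined by the values `Q` and `R` at the same point. Here `dᵢ` is the value of
the derivative of `gᵢ`. -/
theorem parameter_of_singular_point {K : Type*} [Field K] {s g₂ g₃ g₄ d₂ d₃ d₄ x z : K}
    (h₃ : g₃ = -2 * (g₂ - 2 * s * x) * z) (hx : x = -s * z ^ 2)
    (h₄ : g₄ - x ^ 2 = (g₂ - 2 * s * x) * z ^ 2) (hd : d₂ * z ^ 2 + d₃ * z + d₄ = 0) :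
    (2 * g₂ * d₃ - 3 * g₃ * d₂) * (3 * g₃ * d₄ - 4 * g₄ * d₃)
      - (2 * g₂ * d₄ - 4 * g₄ * d₂) ^ 2 = 0 ∧
    128 * s ^ 2 * (g₄ ^ 2 * (2 * g₂ * d₃ - 3 * g₃ * d₂) *
      (2 * g₄ * (2 * g₂ * d₃ - 3 * g₃ * d₂) - g₃ * (2 * g₂ * d₄ - 4 * g₄ * d₂))) =
    ((8 * g₂ * g₄ - 3 * g₃ ^ 2) * (2 * g₂ * d₃ - 3 * g₃ * d₂)
      + 2 * g₂ * g₃ * (2 * g₂ * d₄ - 4 * g₄ * d₂)) ^ 2 := by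
  obtain ⟨a, ha⟩ : ∃ a, g₂ = a + 2 * s * x := ⟨g₂ - 2 * s * x, by ring⟩
  have ha' : g₂ - 2 * s * x = a := by rw [ha]; ring
  rw [ha'] at h₃ h₄
  obtain rfl : d₄ = -(d₂ * z ^ 2 + d₃ * z) := by linear_combination hd
  obtain rfl : g₄ = a * z ^ 2 + x ^ 2 := by linear_combination h₄
  subst ha h₃ hx
  constructor <;> ring

/-- There are no nonreal degenerate points, because a real value of `s²` could be computed from the
coordinates of such a point. -/
theorem IsGeneric.jac_aeval_ne_zero (h : IsGeneric G₂ G₃ G₄) {s : ℝ} (hs0 : s ≠ 0) {ξ η : ℝ[X]}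
    (hs : (ξ, η) ∈ solSet G₂ G₃ G₄ s) (α : ℂ) (him : α.im ≠ 0) (hη : aeval α η = 0) :
    aeval α (jac G₂ G₄ s ξ) ≠ 0 := by
  intro hJ
  have he := hs.2.2.2
  have hs0' : (s : ℂ) ≠ 0 := Complex.ofReal_ne_zero.2 hs0
  have he' : 4 * aeval α (G₂ - C (2 * s) * ξ) * aeval α (G₄ - ξ ^ 2) - aeval α G₃ ^ 2 = 0 := by
    have := congrArg (aeval α) he
    simpa [hη, map_ofNat] using this
  have hJ' : (s : ℂ) * aeval α (G₄ - ξ ^ 2) + aeval α ξ * aeval α (G₂ - C (2 * s) * ξ) = 0 := by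
    simpa [jac] using hJ
  have hAe : aeval α (G₂ - C (2 * s) * ξ) = aeval α G₂ - 2 * s * aeval α ξ := by simp
  have hBe : aeval α (G₄ - ξ ^ 2) = aeval α G₄ - aeval α ξ ^ 2 := by simp
  by_cases hA0 : aeval α (G₂ - C (2 * s) * ξ) = 0
  · have hB0 : aeval α (G₄ - ξ ^ 2) = 0 := by
      rw [hA0, mul_zero, add_zero, mul_eq_zero] at hJ'
      exact hJ'.resolve_left hs0'
    have hG0 : aeval α G₃ = 0 := by
      rw [hA0, hB0] at he'
      simpa using he'
    refine h.not_real_ratio α (4 * s ^ 2) him hG0 ?_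
    rw [hAe] at hA0
    rw [hBe] at hB0
    push_cast
    rw [map_pow]
    linear_combination (aeval α G₂ + 2 * s * aeval α ξ) * hA0 - 4 * s ^ 2 * hB0
  · obtain ⟨z, hz1, hz2, hz3⟩ := eq_of_degenerate hA0 (sub_eq_zero.1 he') hJ'
    have hde := congrArg (fun p => aeval α (derivative p)) he
    simp only [derivative_mul, derivative_pow, derivative_C, derivative_ofNat,
      map_sub, map_add, map_mul, map_pow, map_zero, map_ofNat, hη] at hde
    rw [hAe] at hA0 hz1 hz2
    rw [hBe] at hz2
    simp at hde
    -- the derivative of the quartic in the direction of `x` vanishes at the singular point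
    have hx : aeval α (derivative G₂) * z ^ 2 + aeval α (derivative G₃) * z
        + aeval α (derivative G₄) = 0 := by
      refine mul_left_cancel₀ hA0 ?_
      rw [hz1, hz2, hz3] at hde
      rw [hz3] at hA0 ⊢
      linear_combination hde / 4
    obtain ⟨h1, h2⟩ := parameter_of_singular_point (s := (s : ℂ)) hz1 hz3 hz2 hx
    refine h.not_real_parameter α (1 / (128 * s ^ 2)) him ?_ ?_ <;>
      simp only [weightedWronskian, map_sub, map_add, map_mul, map_pow, map_natCast, map_ofNat]
    · exact h1
    · push_cast
      rw [div_mul_eq_mul_div, eq_div_iff (by simpa using hs0')]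
      linear_combination h2

theorem IsGeneric.isNondegenerate (h : IsGeneric G₂ G₃ G₄) {s : ℝ} (hs0 : s ≠ 0) {ξ η : ℝ[X]}
    (hs : (ξ, η) ∈ solSet G₂ G₃ G₄ s) : IsNondegenerate G₂ G₄ s ξ η := by
  constructor
  · intro α hη
    by_cases him : α.im = 0
    · obtain ⟨a, rfl⟩ : ∃ a : ℝ, α = a := ⟨α.re, Complex.ext rfl (by simpa using him)⟩
      have hr : ∀ p : ℝ[X], aeval (a : ℂ) p = ((p.eval a : ℝ) : ℂ) := fun p => by
        rw [← Complex.coe_algebraMap, aeval_algebraMap_apply_eq_algebraMap_eval]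
      rw [hr, Complex.ofReal_eq_zero] at hη
      rw [hr, ne_eq, Complex.ofReal_eq_zero]
      exact h.jac_eval_ne_zero hs0 hs a hη
    · exact h.jac_aeval_ne_zero hs0 hs α him hη
  · -- at infinity, the argument is the same as at a real zero
    intro hη hJ
    have hB := eval_sub_sq_nonneg h.toIsRegular hs
    obtain ⟨hξ, hη3, hA, he⟩ := hs
    simp only at hξ hη3 hA he
    have hAd := natDegree_pencil_le h.toIsRegular (s := s) hξ
    have hBd := natDegree_sub_sq_le h.toIsRegular hξ
    rw [coeff_four_jac h.toIsRegular hξ] at hJ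
    have h6 := coeff_six_mul_sub_sq hAd hBd h.natDegree_three
    have h6' : (η ^ 2).coeff (2 * 3) = η.coeff 3 ^ 2 := coeff_pow_of_natDegree_le hη3
    norm_num at h6'
    rw [he, h6', hη] at h6
    by_cases hA0 : (G₂ - C (2 * s) * ξ).coeff 2 = 0
    · have hAd' : (G₂ - C (2 * s) * ξ).natDegree = 0 := by
        have h1 := even_natDegree_of_eval_nonneg hA
        have h2 : (G₂ - C (2 * s) * ξ).natDegree ≠ 2 := fun h2 => by
          rw [← h2] at hA0
          rw [coeff_natDegree, leadingCoeff_eq_zero] at hA0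
          rw [hA0, natDegree_zero] at h2
          omega
        rcases h1 with ⟨k, hk⟩
        omega
      have hB0 : (G₄ - ξ ^ 2).coeff 4 = 0 := by
        rw [hA0, mul_zero, add_zero, mul_eq_zero] at hJ
        exact hJ.resolve_left hs0
      have hBd' : (G₄ - ξ ^ 2).natDegree ≤ 2 := by
        have h1 := even_natDegree_of_eval_nonneg hB
        have h2 : (G₄ - ξ ^ 2).natDegree ≠ 4 := fun h2 => by
          rw [← h2] at hB0
          rw [coeff_natDegree, leadingCoeff_eq_zero] at hB0
          rw [hB0, natDegree_zero] at h2
          omega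
        rcases h1 with ⟨k, hk⟩
        omega
      have h1 := natDegree_le_of_sq_add_mul_sq (Γ := 1) (u := G₃) (v := η) (by simp) rfl
      have h2 : G₃ ^ 2 + 1 * η ^ 2 = C 4 * ((G₂ - C (2 * s) * ξ) * (G₄ - ξ ^ 2)) := by
        rw [map_ofNat]; linear_combination -he
      have h3 : (C 4 * ((G₂ - C (2 * s) * ξ) * (G₄ - ξ ^ 2))).natDegree ≤ 2 :=
        (natDegree_C_mul_le _ _).trans (natDegree_mul_le.trans (by omega))
      rw [h2] at h1
      have := h.two_le_natDegree_three
      omega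
    · obtain ⟨z, hz1, hz2, hz3⟩ := eq_of_degenerate hA0 (g₃ := G₃.coeff 3)
        (by linear_combination -h6) hJ
      have hD : 0 < 4 * G₂.coeff 2 * G₄.coeff 4 - G₃.coeff 3 ^ 2 := by
        have h1 := leadingCoeff_nonneg_of_eval_nonneg fun x => (h.disc_pos x).le
        have h2 := leadingCoeff_ne_zero.2 (ne_zero_of_natDegree_gt
          (show 0 < (4 * G₂ * G₄ - G₃ ^ 2).natDegree by rw [h.natDegree_disc]; omega))
        rw [leadingCoeff, h.natDegree_disc,
          coeff_six_mul_sub_sq h.natDegree_two.le h.natDegree_four h.natDegree_three] at h1 h2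
        exact h1.lt_of_ne' h2
      have hG := h.leadingCoeff_pos
      have h7 : (ξ ^ 2).coeff (2 * 2) = ξ.coeff 2 ^ 2 := coeff_pow_of_natDegree_le hξ
      norm_num at h7
      simp only [coeff_sub, coeff_C_mul, h7] at hz1 hz2 hz3
      have h1 : s ^ 2 * z ^ 4 + G₂.coeff 2 * z ^ 2 + G₃.coeff 3 * z + G₄.coeff 4 = 0 := by
        rw [hz1, hz3] at *
        linear_combination hz2
      nlinarith [sq_nonneg (s * z ^ 2), sq_nonneg (2 * G₂.coeff 2 * z + G₃.coeff 3)]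

end

section

/-! ### The number of solutions does not depend on the parameter -/

open Polynomial Topology

/-- The polynomial with the coefficients `c 0, …, c (n - 1)`. -/
def ofCoeffs {n : ℕ} (c : Fin n → ℝ) : ℝ[X] := ∑ i, C (c i) * X ^ (i : ℕ)

theorem coeff_ofCoeffs {n : ℕ} (c : Fin n → ℝ) (i : Fin n) : (ofCoeffs c).coeff i = c i := by
  simp [ofCoeffs, finsetSum_coeff, coeff_X_pow, Fin.val_inj]

theorem natDegree_ofCoeffs_le {n : ℕ} (c : Fin (n + 1) → ℝ) : (ofCoeffs c).natDegree ≤ n :=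
  natDegree_sum_le_of_forall_le _ _ fun i _ => (natDegree_C_mul_X_pow_le _ _).trans (by omega)

theorem ofCoeffs_coeff {n : ℕ} {p : ℝ[X]} (hp : p.natDegree ≤ n) :
    ofCoeffs (fun i : Fin (n + 1) => p.coeff i) = p := by
  conv_rhs => rw [p.as_sum_range_C_mul_X_pow' (Nat.lt_succ_of_le hp)]
  rw [ofCoeffs, Finset.sum_range]

theorem ofCoeffs_injective {n : ℕ} : Function.Injective (ofCoeffs (n := n)) := fun c d h => by
  ext i
  rw [← coeff_ofCoeffs c, h, coeff_ofCoeffs]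

theorem eval_ofCoeffs {n : ℕ} (c : Fin n → ℝ) (x : ℝ) :
    (ofCoeffs c).eval x = ∑ i, c i * x ^ (i : ℕ) := by
  simp [ofCoeffs, eval_finsetSum]

theorem eq_zero_of_eval_fin_eq_zero {n : ℕ} {p : ℝ[X]} (hp : p.natDegree < n)
    (h : ∀ k : Fin n, p.eval (k : ℝ) = 0) : p = 0 :=
  p.eq_zero_of_natDegree_lt_card_of_eval_eq_zero (f := fun k : Fin n => (k : ℝ))
    (fun i j hij => Fin.ext (Nat.cast_injective hij)) h (by simpa using hp)

variable {G₂ G₃ G₄ : ℝ[X]}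

/-- The kernel of the differential of the equation that defines `solSet` is zero at nondegenerate
solutions. -/
theorem IsNondegenerate.eq_zero {s : ℝ} {ξ η : ℝ[X]} (h : IsNondegenerate G₂ G₄ s ξ η)
    (hη : η.natDegree ≤ 3) (hJ : (jac G₂ G₄ s ξ).natDegree ≤ 4) {a b : ℝ[X]}
    (ha : a.natDegree ≤ 2) (hb : b.natDegree ≤ 3) (hab : jac G₂ G₄ s ξ * a + η * b = 0) :
    a = 0 ∧ b = 0 := by
  set J := jac G₂ G₄ s ξ with hJd
  have hcop : IsCoprime J η := by
    by_contra hcop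
    obtain ⟨α, h1, h2⟩ : ∃ α : ℂ, aeval α J = 0 ∧ aeval α η = 0 := by
      classical
      have hg : ¬ IsUnit (EuclideanDomain.gcd J η) := fun hu =>
        hcop (EuclideanDomain.gcd_isUnit_iff.1 hu)
      have hd : (EuclideanDomain.gcd J η).degree ≠ 0 := fun hd => hg (isUnit_iff_degree_eq_zero.2 hd)
      obtain ⟨α, hα⟩ := IsAlgClosed.exists_aeval_eq_zero ℂ _ hd
      exact ⟨α, aeval_eq_zero_of_dvd_aeval_eq_zero (EuclideanDomain.gcd_dvd_left _ _) hα,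
        aeval_eq_zero_of_dvd_aeval_eq_zero (EuclideanDomain.gcd_dvd_right _ _) hα⟩
    exact h.1 α h2 h1
  have h3 : η ∣ a := hcop.symm.dvd_of_dvd_mul_left ⟨-b, by linear_combination hab⟩
  have h4 : J ∣ b := hcop.dvd_of_dvd_mul_left ⟨-a, by linear_combination hab⟩
  by_cases hη3 : η.coeff 3 = 0
  · have hJ4 := h.2 hη3
    have hJd : J.natDegree = 4 := le_antisymm hJ (le_natDegree_of_ne_zero hJ4)
    have hb0 : b = 0 := by
      by_contra hb0
      have := natDegree_le_of_dvd h4 hb0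
      omega
    have hJ0 : J ≠ 0 := by rintro h0; simp [h0] at hJd
    rw [hb0, mul_zero, add_zero, mul_eq_zero] at hab
    exact ⟨hab.resolve_left hJ0, hb0⟩
  · have hηd : η.natDegree = 3 := le_antisymm hη (le_natDegree_of_ne_zero hη3)
    have ha0 : a = 0 := by
      by_contra ha0
      have := natDegree_le_of_dvd h3 ha0
      omega
    have hη0 : η ≠ 0 := by rintro h0; simp [h0] at hηd
    rw [ha0, mul_zero, zero_add, mul_eq_zero] at hab
    exact ⟨ha0, hab.resolve_left hη0⟩

theorem natDegree_jac_le (h : IsRegular G₂ G₃ G₄) {s : ℝ} {ξ : ℝ[X]} (hξ : ξ.natDegree ≤ 2) :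
    (jac G₂ G₄ s ξ).natDegree ≤ 4 :=
  natDegree_add_le_of_degree_le ((natDegree_C_mul_le _ _).trans (natDegree_sub_sq_le h hξ))
    (natDegree_mul_le.trans (add_le_add hξ (natDegree_pencil_le h hξ)))

/-- The parameter space: the coefficients of `ξ` and `η`. -/
abbrev Coeffs : Type := (Fin 3 → ℝ) × (Fin 4 → ℝ)

/-- The values at `0, …, 6` of the polynomial of degree at most `6` whose vanishing defines
`solSet`. -/
def solEquation (G₂ G₃ G₄ : ℝ[X]) (p : ℝ × Coeffs) : Fin 7 → ℝ := fun k =>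
  4 * (G₂.eval (k : ℝ) - 2 * p.1 * ∑ i, p.2.1 i * (k : ℝ) ^ (i : ℕ)) *
    (G₄.eval (k : ℝ) - (∑ i, p.2.1 i * (k : ℝ) ^ (i : ℕ)) ^ 2) - G₃.eval (k : ℝ) ^ 2
    - (∑ i, p.2.2 i * (k : ℝ) ^ (i : ℕ)) ^ 2

theorem contDiff_solEquation : ContDiff ℝ 1 (solEquation G₂ G₃ G₄) := by
  rw [contDiff_pi]
  intro k
  unfold solEquation
  fun_prop

theorem solEquation_eq_zero_iff (h : IsRegular G₂ G₃ G₄) (p : ℝ × Coeffs) :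
    solEquation G₂ G₃ G₄ p = 0 ↔ 4 * (G₂ - C (2 * p.1) * ofCoeffs p.2.1) *
      (G₄ - ofCoeffs p.2.1 ^ 2) - G₃ ^ 2 = ofCoeffs p.2.2 ^ 2 := by
  have hev : ∀ k : Fin 7, solEquation G₂ G₃ G₄ p k = (4 * (G₂ - C (2 * p.1) * ofCoeffs p.2.1) *
      (G₄ - ofCoeffs p.2.1 ^ 2) - G₃ ^ 2 - ofCoeffs p.2.2 ^ 2).eval (k : ℝ) := fun k => by
    simp [solEquation, eval_ofCoeffs]
  constructor
  · intro h0
    refine sub_eq_zero.1 (eq_zero_of_eval_fin_eq_zero (n := 7) ?_ fun k => ?_)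
    · have h1 := natDegree_pencil_le h (s := p.1) (natDegree_ofCoeffs_le p.2.1)
      have h2 := natDegree_sub_sq_le h (natDegree_ofCoeffs_le p.2.1)
      have h3 := natDegree_ofCoeffs_le p.2.2
      have h4 := h.natDegree_three
      have h5 : (4 * (G₂ - C (2 * p.1) * ofCoeffs p.2.1) * (G₄ - ofCoeffs p.2.1 ^ 2)).natDegree
          ≤ 6 := by
        rw [← map_ofNat C 4, mul_assoc]
        exact (natDegree_C_mul_le _ _).trans (natDegree_mul_le.trans (by omega))
      refine Nat.lt_succ_of_le ((natDegree_sub_le _ _).trans (max_le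
        ((natDegree_sub_le _ _).trans (max_le h5 ?_)) ?_)) <;>
      exact natDegree_pow_le.trans (by omega)
    · rw [← hev, h0]; rfl
  · intro h0
    ext k
    rw [hev, h0, sub_self, eval_zero, Pi.zero_apply]

theorem isInvertible_fderiv_solEquation (h : IsRegular G₂ G₃ G₄) {p : ℝ × Coeffs}
    (hp : IsNondegenerate G₂ G₄ p.1 (ofCoeffs p.2.1) (ofCoeffs p.2.2)) :
    (fderiv ℝ (solEquation G₂ G₃ G₄) p ∘L .inr ℝ ℝ Coeffs).IsInvertible := by
  set L := fderiv ℝ (solEquation G₂ G₃ G₄) p ∘L .inr ℝ ℝ Coeffs with hL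
  have hval : ∀ (δ : Coeffs) (k : Fin 7), L δ k = (C (-2) *
      (jac G₂ G₄ p.1 (ofCoeffs p.2.1) * (C 4 * ofCoeffs δ.1)
        + ofCoeffs p.2.2 * ofCoeffs δ.2)).eval (k : ℝ) := by
    intro δ k
    have h1 : HasDerivAt (fun t : ℝ => p + t • ((0 : ℝ), δ)) ((0 : ℝ), δ) 0 := by
      simpa using ((hasDerivAt_id (0 : ℝ)).smul_const ((0 : ℝ), δ)).const_add p
    have hF : HasFDerivAt (solEquation G₂ G₃ G₄) (fderiv ℝ (solEquation G₂ G₃ G₄) p)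
        (p + (0 : ℝ) • ((0 : ℝ), δ)) := by
      simpa using (contDiff_solEquation.differentiable one_ne_zero p).hasFDerivAt
    have h2 := hasDerivAt_pi.1 (hF.comp_hasDerivAt 0 h1) k
    set x := (ofCoeffs p.2.1).eval (k : ℝ) with hx
    set y := (ofCoeffs p.2.2).eval (k : ℝ) with hy
    set u := (ofCoeffs δ.1).eval (k : ℝ) with hu
    set v := (ofCoeffs δ.2).eval (k : ℝ) with hv
    have h3 : (fun t : ℝ => (solEquation G₂ G₃ G₄ ∘ fun t : ℝ => p + t • ((0 : ℝ), δ)) t k)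
        = fun t : ℝ => 4 * (G₂.eval (k : ℝ) - 2 * p.1 * (x + t * u)) *
          (G₄.eval (k : ℝ) - (x + t * u) ^ 2) - G₃.eval (k : ℝ) ^ 2 - (y + t * v) ^ 2 := by
      ext t
      simp only [solEquation, Function.comp, hx, hy, hu, hv, eval_ofCoeffs, Finset.mul_sum,
        ← Finset.sum_add_distrib]
      simp [add_mul, mul_assoc]
    rw [h3] at h2
    have hl : ∀ a b : ℝ, HasDerivAt (fun t : ℝ => a + t * b) b 0 := fun a b => by
      simpa using ((hasDerivAt_id (0 : ℝ)).mul_const b).const_add a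
    have h4 := ((((((hl x u).const_mul (2 * p.1)).const_sub (G₂.eval (k : ℝ))).const_mul 4).mul
      (((hl x u).pow 2).const_sub (G₄.eval (k : ℝ)))).sub_const (G₃.eval (k : ℝ) ^ 2)).sub
      ((hl y v).pow 2)
    have h5 := h2.unique h4
    have h6 : L δ k = (fderiv ℝ (solEquation G₂ G₃ G₄) p) (0, δ) k := rfl
    rw [h6, h5]
    simp only [jac, eval_mul, eval_add, eval_sub, eval_pow, eval_C, ← hx, ← hy, ← hu, ← hv]
    norm_num
    ring
  have hinj : Function.Injective L := by
    rw [injective_iff_map_eq_zero]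
    intro δ hδ
    have h0 : C (-2) * (jac G₂ G₄ p.1 (ofCoeffs p.2.1) * (C 4 * ofCoeffs δ.1)
        + ofCoeffs p.2.2 * ofCoeffs δ.2) = 0 := by
      refine eq_zero_of_eval_fin_eq_zero (n := 7) ?_ fun k => by rw [← hval, hδ]; rfl
      have h1 := natDegree_jac_le h (s := p.1) (natDegree_ofCoeffs_le p.2.1)
      have h2 := natDegree_ofCoeffs_le p.2.2
      have h3 := natDegree_ofCoeffs_le δ.1
      have h4 := natDegree_ofCoeffs_le δ.2
      have h5 : (C 4 * ofCoeffs δ.1).natDegree ≤ 2 := (natDegree_C_mul_le _ _).trans h3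
      exact Nat.lt_succ_of_le ((natDegree_C_mul_le _ _).trans (natDegree_add_le_of_degree_le
        (natDegree_mul_le.trans (by omega)) (natDegree_mul_le.trans (by omega))))
    have h1 := (mul_eq_zero.1 h0).resolve_left (by simp)
    obtain ⟨h2, h3⟩ := hp.eq_zero (natDegree_ofCoeffs_le _)
      (natDegree_jac_le h (natDegree_ofCoeffs_le _))
      ((natDegree_C_mul_le _ _).trans (natDegree_ofCoeffs_le δ.1)) (natDegree_ofCoeffs_le δ.2) h1
    have hz : ∀ n, ofCoeffs (0 : Fin n → ℝ) = 0 := fun n => by simp [ofCoeffs]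
    refine Prod.ext (ofCoeffs_injective ?_) (ofCoeffs_injective ?_)
    · rw [Prod.fst_zero, hz]
      exact (mul_eq_zero.1 h2).resolve_left (by simp)
    · rw [Prod.snd_zero, hz]
      exact h3
  have hfr : Module.finrank ℝ Coeffs = Module.finrank ℝ (Fin 7 → ℝ) := by simp [Coeffs]
  exact ⟨(LinearEquiv.ofInjectiveOfFinrankEq L.toLinearMap hinj hfr).toContinuousLinearEquiv,
    ContinuousLinearMap.ext fun _ => rfl⟩

/-- The value at `(c, d)` of the binary form of degree `n` that `p` dehomogenizes. -/
def formEval (n : ℕ) (p : ℝ[X]) (c d : ℝ) : ℝ :=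
  ∑ k ∈ Finset.range (n + 1), p.coeff k * (c ^ k * d ^ (n - k))

theorem formEval_eq {n : ℕ} {p : ℝ[X]} (hp : p.natDegree ≤ n) (c : ℝ) {d : ℝ} (hd : d ≠ 0) :
    formEval n p c d = d ^ n * p.eval (c / d) := by
  rw [formEval, eval_eq_sum_range' (Nat.lt_succ_of_le hp), Finset.mul_sum]
  refine Finset.sum_congr rfl fun k hk => ?_
  have : n = k + (n - k) := by have := Finset.mem_range.1 hk; omega
  conv_rhs => rw [this, pow_add, div_pow]
  field_simp

theorem formEval_one_zero (n : ℕ) (p : ℝ[X]) : formEval n p 1 0 = p.coeff n := by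
  rw [formEval, Finset.sum_range_succ, Finset.sum_eq_zero fun k hk => ?_]
  · simp
  · have : n - k ≠ 0 := by have := Finset.mem_range.1 hk; omega
    simp [this]

/-- The points `(x, 1)` and `(1, x)` with `|x| ≤ 1`: a compact set of representatives for the points
of the real projective line. -/
def lineReps : Set (ℝ × ℝ) := Set.Icc (-1) 1 ×ˢ {1} ∪ {1} ×ˢ Set.Icc (-1) 1

theorem isCompact_lineReps : IsCompact lineReps :=
  (isCompact_Icc.prod isCompact_singleton).union (isCompact_singleton.prod isCompact_Icc)

theorem exists_lineReps (x : ℝ) : ∃ q ∈ lineReps, q.2 ≠ 0 ∧ q.1 / q.2 = x := by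
  by_cases hx : |x| ≤ 1
  · exact ⟨(x, 1), Or.inl ⟨abs_le.1 hx, rfl⟩, one_ne_zero, by simp⟩
  · push Not at hx
    have h0 : x ≠ 0 := by rintro rfl; norm_num at hx
    refine ⟨(1, x⁻¹), Or.inr ⟨rfl, abs_le.1 ?_⟩, inv_ne_zero h0, by simp⟩
    rw [abs_inv]
    exact inv_le_one_of_one_le₀ hx.le

end

section

open Polynomial Topology

variable {G₂ G₃ G₄ : ℝ[X]}

/-- The solutions `(s, ξ, η)` with `0 ≤ s ≤ 1`, in terms of coefficients. -/
def solTotal (G₂ G₃ G₄ : ℝ[X]) : Set (ℝ × Coeffs) :=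
  {p | p.1 ∈ Set.Icc (0 : ℝ) 1 ∧ (ofCoeffs p.2.1, ofCoeffs p.2.2) ∈ solSet G₂ G₃ G₄ p.1}

theorem mem_solTotal_iff (h : IsRegular G₂ G₃ G₄) (p : ℝ × Coeffs) :
    p ∈ solTotal G₂ G₃ G₄ ↔ p.1 ∈ Set.Icc (0 : ℝ) 1 ∧
      (∀ x, 0 ≤ G₂.eval x - 2 * p.1 * ∑ i, p.2.1 i * x ^ (i : ℕ)) ∧
      solEquation G₂ G₃ G₄ p = 0 := by
  rw [solEquation_eq_zero_iff h]
  simp only [solTotal, solSet, Set.mem_ofPred_eq, natDegree_ofCoeffs_le, true_and, eval_sub,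
    eval_mul, eval_C, eval_ofCoeffs]

theorem isCompact_solTotal (h : IsRegular G₂ G₃ G₄) : IsCompact (solTotal G₂ G₃ G₄) := by
  refine Metric.isCompact_of_isClosed_isBounded ?_ ?_
  · have : solTotal G₂ G₃ G₄ = {p | p.1 ∈ Set.Icc (0 : ℝ) 1} ∩
        ((⋂ x : ℝ, {p : ℝ × Coeffs | 0 ≤ G₂.eval x - 2 * p.1 * ∑ i : Fin 3, p.2.1 i * x ^ (i : ℕ)}) ∩
          {p | solEquation G₂ G₃ G₄ p = 0}) := by
      ext p
      rw [mem_solTotal_iff h]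
      simp
    rw [this]
    refine (isClosed_Icc.preimage continuous_fst).inter (IsClosed.inter ?_ ?_)
    · exact isClosed_iInter fun x => isClosed_le continuous_const (by fun_prop)
    · exact isClosed_eq contDiff_solEquation.continuous continuous_const
  · -- the coefficients are bounded by the values at the points `0, 1, 2, 3`
    let E : Coeffs →ₗ[ℝ] (Fin 4 → ℝ) × (Fin 4 → ℝ) :=
      { toFun := fun v => (fun k => ∑ i, v.1 i * (k : ℝ) ^ (i : ℕ),
          fun k => ∑ i, v.2 i * (k : ℝ) ^ (i : ℕ))
        map_add' := fun v w => by
          ext k <;> simp [add_mul, Finset.sum_add_distrib]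
        map_smul' := fun t v => by
          ext k <;> simp [Finset.mul_sum, mul_assoc] }
    have hE : Function.Injective E := by
      rw [injective_iff_map_eq_zero]
      intro v hv
      have hz : ∀ n, ofCoeffs (0 : Fin n → ℝ) = 0 := fun n => by simp [ofCoeffs]
      have h1 : ∀ k, (ofCoeffs v.1).eval ((k : Fin 4) : ℝ) = 0 := fun k => by
        rw [eval_ofCoeffs]; exact congrFun (Prod.mk.inj hv).1 k
      have h2 : ∀ k, (ofCoeffs v.2).eval ((k : Fin 4) : ℝ) = 0 := fun k => by
        rw [eval_ofCoeffs]; exact congrFun (Prod.mk.inj hv).2 k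
      refine Prod.ext (ofCoeffs_injective ?_) (ofCoeffs_injective ?_)
      · rw [Prod.fst_zero, hz]
        exact eq_zero_of_eval_fin_eq_zero
          ((natDegree_ofCoeffs_le v.1).trans_lt (by norm_num)) h1
      · rw [Prod.snd_zero, hz]
        exact eq_zero_of_eval_fin_eq_zero
          ((natDegree_ofCoeffs_le v.2).trans_lt (by norm_num)) h2
    obtain ⟨c, -, hc⟩ := E.exists_antilipschitzWith (LinearMap.ker_eq_bot.2 hE)
    let M : Fin 4 → ℝ := fun k => G₄.eval (k : ℝ) + 1
    let N : Fin 4 → ℝ := fun k => 4 * (G₂.eval (k : ℝ) + 2 * M k) * G₄.eval (k : ℝ) + 1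
    have hbox : Bornology.IsBounded (E ⁻¹' (Set.Icc (-M) M ×ˢ Set.Icc (-N) N)) :=
      hc.isBounded_preimage ((Metric.isBounded_Icc _ _).prod (Metric.isBounded_Icc _ _))
    refine ((Metric.isBounded_Icc (0 : ℝ) 1).prod hbox).subset fun p hp => ⟨hp.1, ?_⟩
    have hB := fun x => eval_sub_sq_nonneg h hp.2 x
    obtain ⟨⟨hs0, hs1⟩, -, -, hA, he⟩ := hp
    simp only at hA he
    have hval : ∀ k : Fin 4, |(ofCoeffs p.2.1).eval (k : ℝ)| ≤ M k ∧
        |(ofCoeffs p.2.2).eval (k : ℝ)| ≤ N k := by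
      intro k
      have hBk := hB k
      have hAk := hA k
      have hek := congrArg (eval (k : ℝ)) he
      simp only [eval_sub, eval_mul, eval_pow, eval_C, eval_ofNat] at hBk hAk hek
      have hG := h.pos k
      simp only [M, N]
      generalize (ofCoeffs p.2.1).eval (k : ℝ) = x at *
      generalize (ofCoeffs p.2.2).eval (k : ℝ) = y at *
      generalize G₂.eval (k : ℝ) = g₂ at *
      generalize G₃.eval (k : ℝ) = g₃ at *
      generalize G₄.eval (k : ℝ) = g₄ at *
      have hx : |x| ≤ g₄ + 1 := abs_le_of_sq_le_sq (by nlinarith) (by nlinarith [sq_nonneg x])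
      refine ⟨hx, ?_⟩
      have hx' := abs_le.1 hx
      have h4 : 0 ≤ g₄ := by nlinarith [sq_nonneg x]
      have h5 : g₂ - 2 * p.1 * x ≤ g₂ + 2 * (g₄ + 1) := by nlinarith
      have h6 : (g₂ - 2 * p.1 * x) * (g₄ - x ^ 2) ≤ (g₂ + 2 * (g₄ + 1)) * g₄ :=
        mul_le_mul h5 (by nlinarith [sq_nonneg x]) hBk (by linarith)
      have h7 : y ^ 2 ≤ 4 * (g₂ + 2 * (g₄ + 1)) * g₄ := by nlinarith [sq_nonneg g₃]
      refine abs_le_of_sq_le_sq ?_ ?_ <;> nlinarith [sq_nonneg y]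
    have h1 : (E p.2).1 = fun k : Fin 4 => (ofCoeffs p.2.1).eval (k : ℝ) := by
      ext k; rw [eval_ofCoeffs]; rfl
    have h2 : (E p.2).2 = fun k : Fin 4 => (ofCoeffs p.2.2).eval (k : ℝ) := by
      ext k; rw [eval_ofCoeffs]; rfl
    refine ⟨⟨?_, ?_⟩, ⟨?_, ?_⟩⟩ <;> intro k <;> simp only [h1, h2, Pi.neg_apply]
    · exact (abs_le.1 (hval k).1).1
    · exact (abs_le.1 (hval k).1).2
    · exact (abs_le.1 (hval k).2).1
    · exact (abs_le.1 (hval k).2).2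

/-- A solution near a nondegenerate solution with psd `G₂ - 2 s ξ` has psd `G₂ - 2 s ξ`, too: the forms
`G₂ - 2 s ξ` and `G₄ - ξ²` have no common real zero, and their product is psd. -/
theorem eventually_mem_solTotal (h : IsRegular G₂ G₃ G₄) {p : ℝ × Coeffs}
    (hp : p ∈ solTotal G₂ G₃ G₄)
    (hnd : IsNondegenerate G₂ G₄ p.1 (ofCoeffs p.2.1) (ofCoeffs p.2.2)) :
    ∀ᶠ q in 𝓝 p, q.1 ∈ Set.Icc (0 : ℝ) 1 → solEquation G₂ G₃ G₄ q = 0 →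
      q ∈ solTotal G₂ G₃ G₄ := by
  let fξ : ℝ × Coeffs → ℝ × ℝ → ℝ := fun q r =>
    ∑ i : Fin 3, q.2.1 i * (r.1 ^ (i : ℕ) * r.2 ^ (2 - (i : ℕ)))
  let fA : ℝ × Coeffs → ℝ × ℝ → ℝ := fun q r => formEval 2 G₂ r.1 r.2 - 2 * q.1 * fξ q r
  let fB : ℝ × Coeffs → ℝ × ℝ → ℝ := fun q r => formEval 4 G₄ r.1 r.2 - fξ q r ^ 2
  have hξ : ∀ q r, fξ q r = formEval 2 (ofCoeffs q.2.1) r.1 r.2 := fun q r => by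
    rw [formEval, Finset.sum_range]
    exact Finset.sum_congr rfl fun i _ => by rw [coeff_ofCoeffs]
  have hA : ∀ q (r : ℝ × ℝ), r.2 ≠ 0 →
      fA q r = r.2 ^ 2 * (G₂ - C (2 * q.1) * ofCoeffs q.2.1).eval (r.1 / r.2) := fun q r hr => by
    simp only [fA, hξ, formEval_eq h.natDegree_two.le _ hr, formEval_eq (natDegree_ofCoeffs_le _) _ hr,
      eval_sub, eval_mul, eval_C]
    ring
  have hB : ∀ q (r : ℝ × ℝ), r.2 ≠ 0 →
      fB q r = r.2 ^ 4 * (G₄ - ofCoeffs q.2.1 ^ 2).eval (r.1 / r.2) := fun q r hr => by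
    simp only [fB, hξ, formEval_eq h.natDegree_four _ hr, formEval_eq (natDegree_ofCoeffs_le _) _ hr,
      eval_sub, eval_pow]
    ring
  have hcont : Continuous fun z : (ℝ × Coeffs) × (ℝ × ℝ) => max (fA z.1 z.2) (fB z.1 z.2) := by
    simp only [fA, fB, fξ, formEval]
    fun_prop
  have hpos : ∀ r ∈ lineReps, 0 < max (fA p r) (fB p r) := by
    intro r hr
    have hBp := eval_sub_sq_nonneg h hp.2
    obtain ⟨-, hξd, hηd, hAp, he⟩ := hp
    simp only at hξd hηd hAp he
    by_cases hr0 : r.2 = 0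
    · have hr1 : r = (1, 0) := by
        rcases hr with hr | hr
        · exact absurd (hr.2.symm.trans hr0) one_ne_zero
        · exact Prod.ext hr.1 hr0
      have hAd := natDegree_pencil_le h (s := p.1) hξd
      have hBd := natDegree_sub_sq_le h hξd
      have hA2 : fA p r = (G₂ - C (2 * p.1) * ofCoeffs p.2.1).coeff 2 := by
        simp only [fA, hξ, hr1, formEval_one_zero, coeff_sub, coeff_C_mul]
      have hB4 : fB p r = (G₄ - ofCoeffs p.2.1 ^ 2).coeff 4 := by
        have : (ofCoeffs p.2.1 ^ 2).coeff (2 * 2) = _ := coeff_pow_of_natDegree_le hξd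
        simp only [fB, hξ, hr1, formEval_one_zero, coeff_sub]
        rw [← this]
      by_contra! hle
      have hA3 := coeff_nonneg_of_eval_nonneg hAd hAp
      have hB3 := coeff_nonneg_of_eval_nonneg hBd hBp
      have hA0 := le_antisymm (hA2 ▸ (le_max_left _ _).trans hle) hA3
      have hB0 := le_antisymm (hB4 ▸ (le_max_right _ _).trans hle) hB3
      have h6 := coeff_six_mul_sub_sq hAd hBd h.natDegree_three
      have h6' : (ofCoeffs p.2.2 ^ 2).coeff (2 * 3) = _ := coeff_pow_of_natDegree_le hηd
      norm_num at h6'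
      rw [he, h6', hA0, hB0] at h6
      refine hnd.2 (by nlinarith [sq_nonneg (G₃.coeff 3), sq_nonneg ((ofCoeffs p.2.2).coeff 3)]) ?_
      rw [coeff_four_jac h hξd, hA0, hB0]
      ring
    · have hA3 := hAp (r.1 / r.2)
      have hB3 := hBp (r.1 / r.2)
      by_contra! hle
      have h2 : 0 < r.2 ^ 2 := by positivity
      have h4 : 0 < r.2 ^ 4 := by positivity
      have hA0 := (hA p r hr0) ▸ (le_max_left _ _).trans hle
      have hB0 := (hB p r hr0) ▸ (le_max_right _ _).trans hle
      have hA0 := le_antisymm (nonpos_of_mul_nonpos_right hA0 h2) hA3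
      have hB0 := le_antisymm (nonpos_of_mul_nonpos_right hB0 h4) hB3
      have hr' : ∀ q : ℝ[X], aeval ((r.1 / r.2 : ℝ) : ℂ) q = ((q.eval (r.1 / r.2) : ℝ) : ℂ) :=
        fun q => by rw [← Complex.coe_algebraMap, aeval_algebraMap_apply_eq_algebraMap_eval]
      refine hnd.1 ((r.1 / r.2 : ℝ) : ℂ) ?_ ?_
      · rw [hr', Complex.ofReal_eq_zero]
        have := congrArg (eval (r.1 / r.2)) he
        simp only [eval_sub (p := 4 * _ * _), eval_mul (p := 4 * _), eval_mul (p := 4), eval_pow,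
          hA0, hB0] at this
        nlinarith [sq_nonneg (eval (r.1 / r.2) G₃), sq_nonneg (eval (r.1 / r.2) (ofCoeffs p.2.2))]
      · rw [hr', Complex.ofReal_eq_zero, jac, eval_add, eval_mul, eval_mul, hA0, hB0]
        ring
  have hev : ∀ᶠ q in 𝓝 p, ∀ r ∈ lineReps, 0 < max (fA q r) (fB q r) :=
    isCompact_lineReps.eventually_forall_of_forall_eventually fun r hr =>
      hcont.continuousAt.eventually (lt_mem_nhds (hpos r hr))
  filter_upwards [hev] with q hq hq1 hq0
  rw [mem_solTotal_iff h]
  refine ⟨hq1, fun x => ?_, hq0⟩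
  rw [solEquation_eq_zero_iff h] at hq0
  obtain ⟨r, hr, hr0, rfl⟩ := exists_lineReps x
  have he := congrArg (eval (r.1 / r.2)) hq0
  have h1 := hq r hr
  rw [hA q r hr0, hB q r hr0] at h1
  have hgoal : 0 ≤ (G₂ - C (2 * q.1) * ofCoeffs q.2.1).eval (r.1 / r.2) := by
    by_contra! hneg
    have h2 : 0 < r.2 ^ 2 := by positivity
    have h4 : 0 < r.2 ^ 4 := by positivity
    have h5 := (lt_max_iff.1 h1).resolve_left (by nlinarith)
    have h6 := pos_of_mul_pos_right h5 h4.le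
    simp only [eval_sub (p := 4 * _ * _), eval_mul (p := 4 * _), eval_mul (p := 4), eval_pow,
      eval_ofNat] at he
    nlinarith [mul_pos (neg_pos.2 hneg) h6, sq_nonneg (eval (r.1 / r.2) G₃),
      sq_nonneg (eval (r.1 / r.2) (ofCoeffs q.2.2))]
  simpa [eval_ofCoeffs] using hgoal

theorem ncard_solTotal_fiber {s : ℝ} (hs : s ∈ Set.Icc (0 : ℝ) 1) :
    {v | (s, v) ∈ solTotal G₂ G₃ G₄}.ncard = (solSet G₂ G₃ G₄ s).ncard := by
  refine Set.ncard_congr (fun v _ => (ofCoeffs v.1, ofCoeffs v.2)) (fun v hv => hv.2)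
    (fun v w _ _ hvw => ?_) fun p hp => ?_
  · exact Prod.ext (ofCoeffs_injective (Prod.mk.inj hvw).1)
      (ofCoeffs_injective (Prod.mk.inj hvw).2)
  · have h1 := ofCoeffs_coeff hp.1
    have h2 := ofCoeffs_coeff hp.2.1
    exact ⟨(fun i => p.1.coeff i, fun i => p.2.coeff i), ⟨hs, by simpa only [h1, h2] using hp⟩,
      Prod.ext h1 h2⟩

/-- For `s = 0`, the solutions are the representations of the discriminant by a norm form. -/
theorem IsRegular.ncard_solSet_zero (h : IsRegular G₂ G₃ G₄) : (solSet G₂ G₃ G₄ 0).ncard = 16 := by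
  have hlc := h.leadingCoeff_pos
  have h4 : (C 4 * G₂).natDegree = 2 := by
    rw [natDegree_C_mul (by norm_num), h.natDegree_two]
  have h4p : ∀ x, 0 < (C 4 * G₂).eval x := fun x => by
    have := h.pos x
    simp only [eval_mul, eval_C]
    positivity
  have hcop : IsCoprime (4 * G₂ * G₄ - G₃ ^ 2) (C 4 * G₂) := by
    rw [isCoprime_mul_unit_left_right (isUnit_C.2 (by norm_num))]
    have h1 : IsCoprime (-(G₃ ^ 2)) G₂ := (h.coprime.symm.pow_left).neg_left
    have h2 : 4 * G₂ * G₄ - G₃ ^ 2 = -(G₃ ^ 2) + G₂ * (4 * G₄) := by ring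
    rw [h2]
    exact h1.add_mul_left_left (4 * G₄)
  have hcard := encard_normSolutions h4 h4p 3 _ h.natDegree_disc h.disc_pos
    h.separable_disc.squarefree hcop
  have hswap : solSet G₂ G₃ G₄ 0 = Prod.swap '' normSolutions (C 4 * G₂) (4 * G₂ * G₄ - G₃ ^ 2) := by
    ext ⟨ξ, η⟩
    simp only [Set.mem_image, Prod.exists, Prod.swap_prod_mk, Prod.mk.injEq, normSolutions,
      Set.mem_ofPred_eq, solSet, mul_zero, C_0, zero_mul, sub_zero]
    constructor
    · rintro ⟨-, -, -, he⟩
      exact ⟨η, ξ, by rw [map_ofNat]; linear_combination -he, rfl, rfl⟩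
    · rintro ⟨η, ξ, he, rfl, rfl⟩
      have hd := natDegree_le_of_sq_add_mul_sq
        (by rw [leadingCoeff, h4, coeff_C_mul]; positivity) he
      rw [h.natDegree_disc, h4] at hd
      refine ⟨?_, by omega, fun x => (h.pos x).le, by
        rw [map_ofNat] at he; linear_combination -he⟩
      by_cases hξ : ξ = 0
      · simp [hξ]
      · have := hd.2 hξ
        omega
  rw [hswap, Set.ncard_image_of_injective _ Prod.swap_injective, Set.ncard, hcard]
  norm_num

/-- Deformation of the parameter from `0` to `1`. -/
theorem IsGeneric.ncard_solSet_one (h : IsGeneric G₂ G₃ G₄) : (solSet G₂ G₃ G₄ 1).ncard = 16 := by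
  have hnd : ∀ p ∈ solTotal G₂ G₃ G₄,
      IsNondegenerate G₂ G₄ p.1 (ofCoeffs p.2.1) (ofCoeffs p.2.2) := fun p hp => by
    by_cases hs : p.1 = 0
    · have := hp.2
      rw [hs] at this ⊢
      exact h.isNondegenerate_zero this
    · exact h.isNondegenerate hs hp.2
  rw [← h.ncard_solSet_zero, ← ncard_solTotal_fiber (by simp),
    ← ncard_solTotal_fiber (by simp)]
  exact (ncard_solutions_eq contDiff_solEquation (isCompact_solTotal h.toIsRegular)
    (fun p hp => hp.1) (fun p hp => ((mem_solTotal_iff h.toIsRegular p).1 hp).2.2)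
    (fun p hp => eventually_mem_solTotal h.toIsRegular hp (hnd p hp))
    fun p hp => isInvertible_fderiv_solEquation h.toIsRegular (hnd p hp)).symm

end

section

/-! ### Sums of two squares of polynomials that are linear in `z` -/

open Polynomial

/-- The complex polynomial `p + i q`. -/
def toComplex (p q : ℝ[X]) : ℂ[X] :=
  p.map (algebraMap ℝ ℂ) + C Complex.I * q.map (algebraMap ℝ ℂ)

theorem C_I_sq : (C Complex.I : ℂ[X]) ^ 2 = -1 := by
  rw [← C_pow, Complex.I_sq, C_neg, C_1]

theorem coeff_toComplex (p q : ℝ[X]) (n : ℕ) :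
    (toComplex p q).coeff n = ⟨p.coeff n, q.coeff n⟩ := by
  apply Complex.ext <;> simp [toComplex]

theorem toComplex_inj {p q p' q' : ℝ[X]} (h : toComplex p q = toComplex p' q') :
    p = p' ∧ q = q' := by
  have h1 : ∀ n, p.coeff n = p'.coeff n ∧ q.coeff n = q'.coeff n := fun n => by
    have := congrArg (fun r => coeff r n) h
    simpa [coeff_toComplex] using this
  exact ⟨Polynomial.ext fun n => (h1 n).1, Polynomial.ext fun n => (h1 n).2⟩

theorem exists_toComplex (p : ℂ[X]) : ∃ a b : ℝ[X], toComplex a b = p ∧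
    a.natDegree ≤ p.natDegree ∧ b.natDegree ≤ p.natDegree := by
  refine ⟨ofCoeffs fun i : Fin (p.natDegree + 1) => (p.coeff i).re,
    ofCoeffs fun i : Fin (p.natDegree + 1) => (p.coeff i).im, ?_, natDegree_ofCoeffs_le _,
    natDegree_ofCoeffs_le _⟩
  ext n
  rw [coeff_toComplex]
  by_cases hn : n < p.natDegree + 1
  · have h : ∀ c : Fin (p.natDegree + 1) → ℝ, (ofCoeffs c).coeff n = c ⟨n, hn⟩ :=
      fun c => coeff_ofCoeffs c ⟨n, hn⟩
    rw [h, h]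
  · have h : ∀ c : Fin (p.natDegree + 1) → ℝ, (ofCoeffs c).coeff n = 0 := fun c =>
      coeff_eq_zero_of_natDegree_lt ((natDegree_ofCoeffs_le c).trans_lt (by omega))
    rw [h, h, coeff_eq_zero_of_natDegree_lt (by omega)]
    rfl

theorem map_conj_toComplex (p q : ℝ[X]) :
    (toComplex p q).map (starRingEnd ℂ) = toComplex p (-q) := by
  ext n
  rw [coeff_map, coeff_toComplex, coeff_toComplex, coeff_neg]
  rfl

theorem toComplex_mul (p q r s : ℝ[X]) :
    toComplex p q * toComplex r s = toComplex (p * r - q * s) (p * s + q * r) := by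
  simp only [toComplex, Polynomial.map_sub, Polynomial.map_add, Polynomial.map_mul]
  linear_combination (q.map (algebraMap ℝ ℂ)) * (s.map (algebraMap ℝ ℂ)) * C_I_sq

theorem eval_toComplex (p q : ℝ[X]) (α : ℂ) :
    (toComplex p q).eval α = aeval α p + Complex.I * aeval α q := by
  simp [toComplex, aeval_def, eval_map]

theorem toComplex_mul_neg (p q : ℝ[X]) :
    toComplex p q * toComplex p (-q) = toComplex (p ^ 2 + q ^ 2) 0 := by
  rw [toComplex_mul]
  congr 1 <;> ring

/-- Two vectors `(l₁, l₂)`, `(m₁, m₂)` of polynomials, together with `(q₁, q₂)`, `(r₁, r₂)`, for which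
`(l₁ z + q₁)² + (l₂ z + q₂)² = (m₁ z + r₁)² + (m₂ z + r₂)²`, differ by an orthogonal
transformation of the plane, provided that `l₁ + i l₂` and `q₁ + i q₂` are coprime: in the factorial
ring `ℂ[x, z]`, the polynomial `(l₁ + i l₂) z + (q₁ + i q₂)` is prime, and therefore it divides
`(m₁ + i m₂) z + (r₁ + i r₂)` or its conjugate. -/
theorem exists_orthogonal_of_sum_two_squares {l₁ l₂ q₁ q₂ m₁ m₂ r₁ r₂ : ℝ[X]}
    (hl : l₁ ^ 2 + l₂ ^ 2 = m₁ ^ 2 + m₂ ^ 2) (hlq : l₁ * q₁ + l₂ * q₂ = m₁ * r₁ + m₂ * r₂)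
    (hq : q₁ ^ 2 + q₂ ^ 2 = r₁ ^ 2 + r₂ ^ 2) (hl0 : l₁ ^ 2 + l₂ ^ 2 ≠ 0)
    (hcop : ∀ α : ℂ, (toComplex l₁ l₂).eval α = 0 → (toComplex q₁ q₂).eval α ≠ 0) :
    ∃ a b ε : ℝ, a ^ 2 + b ^ 2 = 1 ∧ ε ^ 2 = 1 ∧
      (m₁ = C a * l₁ - C (ε * b) * l₂ ∧ m₂ = C b * l₁ + C (ε * a) * l₂) ∧
      (r₁ = C a * q₁ - C (ε * b) * q₂ ∧ r₂ = C b * q₁ + C (ε * a) * q₂) := by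
  have hlc : toComplex l₁ l₂ ≠ 0 := fun h => hl0 (by
    have := toComplex_mul_neg l₁ l₂
    rw [h, zero_mul] at this
    have h0 : toComplex 0 0 = 0 := by simp [toComplex]
    rw [← h0] at this
    exact (toComplex_inj this).1.symm)
  have hrel : IsRelPrime (toComplex q₁ q₂) (toComplex l₁ l₂) := by
    intro d hdq hdl
    by_contra hd
    have hdeg : d.degree ≠ 0 := fun h => hd (isUnit_iff_degree_eq_zero.2 h)
    obtain ⟨α, hα⟩ := IsAlgClosed.exists_root d hdeg
    exact hcop α (eval_eq_zero_of_dvd_of_eval_eq_zero hdl hα)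
      (eval_eq_zero_of_dvd_of_eval_eq_zero hdq hα)
  set h : ℂ[X][X] := C (toComplex l₁ l₂) * X + C (toComplex q₁ q₂) with hh
  have hirr : Irreducible h := irreducible_C_mul_X_add_C hlc hrel.symm
  have hprod : ∀ {l₁ l₂ q₁ q₂ : ℝ[X]}, (C (toComplex l₁ l₂) * X + C (toComplex q₁ q₂) : ℂ[X][X]) *
      (C (toComplex l₁ (-l₂)) * X + C (toComplex q₁ (-q₂))) =
      C (toComplex (l₁ ^ 2 + l₂ ^ 2) 0) * X ^ 2 + C (toComplex (2 * (l₁ * q₁ + l₂ * q₂)) 0) * X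
        + C (toComplex (q₁ ^ 2 + q₂ ^ 2) 0) := by
    intro l₁ l₂ q₁ q₂
    have h1 : toComplex (2 * (l₁ * q₁ + l₂ * q₂)) 0 = toComplex l₁ l₂ * toComplex q₁ (-q₂)
        + toComplex q₁ q₂ * toComplex l₁ (-l₂) := by
      rw [toComplex_mul, toComplex_mul]
      simp only [toComplex, Polynomial.map_zero,
        Polynomial.map_mul, Polynomial.map_neg, Polynomial.map_add, Polynomial.map_sub,
        Polynomial.map_ofNat]
      ring
    rw [← toComplex_mul_neg, ← toComplex_mul_neg, h1]
    simp only [C_mul, C_add]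
    ring
  -- the key step: a vector for which `h` divides the corresponding linear polynomial
  have key : ∀ {m₁ m₂ r₁ r₂ : ℝ[X]}, l₁ ^ 2 + l₂ ^ 2 = m₁ ^ 2 + m₂ ^ 2 →
      h ∣ C (toComplex m₁ m₂) * X + C (toComplex r₁ r₂) →
      ∃ a b : ℝ, a ^ 2 + b ^ 2 = 1 ∧ toComplex m₁ m₂ = toComplex (C a) (C b) * toComplex l₁ l₂ ∧
        toComplex r₁ r₂ = toComplex (C a) (C b) * toComplex q₁ q₂ := by
    rintro m₁ m₂ r₁ r₂ hm ⟨k, hk⟩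
    have hh0 : h ≠ 0 := hirr.ne_zero
    have hdh : h.natDegree = 1 := natDegree_linear hlc
    have hk0 : k ≠ 0 := by
      rintro rfl
      rw [mul_zero] at hk
      have h1 := congrArg (fun p => coeff p 1) hk
      simp at h1
      apply hl0
      rw [hm]
      have h0 : toComplex 0 0 = 0 := by simp [toComplex]
      rw [← h0] at h1
      rw [(toComplex_inj h1).1, (toComplex_inj h1).2]
      ring
    have hdk : k.natDegree = 0 := by
      have h1 := natDegree_mul hh0 hk0
      rw [← hk, hdh] at h1
      have h2 : (C (toComplex m₁ m₂) * X + C (toComplex r₁ r₂) : ℂ[X][X]).natDegree ≤ 1 :=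
        natDegree_linear_le
      omega
    obtain ⟨u, rfl⟩ : ∃ u, k = C u := ⟨_, eq_C_of_natDegree_eq_zero hdk⟩
    have hu1 : toComplex m₁ m₂ = toComplex l₁ l₂ * u := by
      have := congrArg (fun p => coeff p 1) hk
      simpa [hh] using this
    have hu0 : toComplex r₁ r₂ = toComplex q₁ q₂ * u := by
      have := congrArg (fun p => coeff p 0) hk
      simpa [hh] using this
    obtain ⟨a, b, rfl, -, -⟩ := exists_toComplex u
    have hab : a ^ 2 + b ^ 2 = 1 := by
      have h1 : toComplex m₁ (-m₂) = toComplex l₁ (-l₂) * toComplex a (-b) := by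
        rw [← map_conj_toComplex, ← map_conj_toComplex, ← map_conj_toComplex, hu1,
          Polynomial.map_mul]
      have h2 := toComplex_mul_neg m₁ m₂
      rw [hu1, h1, ← hm] at h2
      have h3 : toComplex (l₁ ^ 2 + l₂ ^ 2) 0 * toComplex (a ^ 2 + b ^ 2) 0
          = toComplex (l₁ ^ 2 + l₂ ^ 2) 0 := by
        linear_combination h2 - toComplex (a ^ 2 + b ^ 2) 0 * toComplex_mul_neg l₁ l₂
          - toComplex l₁ l₂ * toComplex l₁ (-l₂) * toComplex_mul_neg a b
      rw [toComplex_mul] at h3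
      have h4 := (toComplex_inj h3).1
      refine mul_left_cancel₀ hl0 ?_
      linear_combination h4
    have h1 := natDegree_le_of_sq_add_mul_sq (Γ := 1) (u := a) (v := b) (by simp) rfl
    have h2 := natDegree_le_of_sq_add_mul_sq (Γ := 1) (u := b) (v := a) (by simp) rfl
    rw [show a ^ 2 + 1 * b ^ 2 = 1 by linear_combination hab, natDegree_one] at h1
    rw [show b ^ 2 + 1 * a ^ 2 = 1 by linear_combination hab, natDegree_one] at h2
    obtain ⟨a, rfl⟩ : ∃ c, a = C c := ⟨_, eq_C_of_natDegree_eq_zero (by omega)⟩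
    obtain ⟨b, rfl⟩ : ∃ c, b = C c := ⟨_, eq_C_of_natDegree_eq_zero (by omega)⟩
    refine ⟨a, b, ?_, by rw [hu1, mul_comm], by rw [hu0, mul_comm]⟩
    have := congrArg (eval 0) hab
    simpa using this
  have hdvd : h ∣ (C (toComplex m₁ m₂) * X + C (toComplex r₁ r₂)) *
      (C (toComplex m₁ (-m₂)) * X + C (toComplex r₁ (-r₂))) := by
    rw [hprod, ← hl, ← hlq, ← hq, ← hprod]
    exact dvd_mul_right _ _
  rcases hirr.prime.dvd_or_dvd hdvd with h1 | h1
  · obtain ⟨a, b, hab, h2, h3⟩ := key hl h1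
    rw [toComplex_mul] at h2 h3
    refine ⟨a, b, 1, hab, by norm_num, ⟨?_, ?_⟩, ?_, ?_⟩
    · rw [(toComplex_inj h2).1, one_mul]
    · rw [(toComplex_inj h2).2, one_mul]; ring
    · rw [(toComplex_inj h3).1, one_mul]
    · rw [(toComplex_inj h3).2, one_mul]; ring
  · obtain ⟨a, b, hab, h2, h3⟩ := key (by rw [hl, neg_sq]) h1
    rw [toComplex_mul] at h2 h3
    refine ⟨a, -b, -1, by rw [neg_sq, hab], by norm_num, ⟨?_, ?_⟩, ?_, ?_⟩
    · rw [(toComplex_inj h2).1]; simp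
    · rw [← neg_neg m₂, (toComplex_inj h2).2]; simp
    · rw [(toComplex_inj h3).1]; simp
    · rw [← neg_neg r₂, (toComplex_inj h3).2]; simp

/-- A psd polynomial of degree at most `2` is the norm of a linear complex polynomial. If it divides
`G² + η²`, the linear polynomial can be chosen such that its conjugate divides `G + i η`. -/
theorem exists_linear_norm_dvd {A B G η : ℝ[X]} (hA : ∀ x, 0 ≤ A.eval x) (hA0 : A ≠ 0)
    (hAd : A.natDegree ≤ 2) (h : 4 * A * B - G ^ 2 = η ^ 2) :
    ∃ l₁ l₂ : ℝ[X], l₁.natDegree ≤ 1 ∧ l₂.natDegree ≤ 1 ∧ l₁ ^ 2 + l₂ ^ 2 = A ∧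
      toComplex l₁ (-l₂) ∣ toComplex G η := by
  have hlc := leadingCoeff_nonneg_of_eval_nonneg hA
  have hlc' : 0 < A.leadingCoeff := hlc.lt_of_ne' (leadingCoeff_ne_zero.2 hA0)
  have hs : √A.leadingCoeff ^ 2 = A.leadingCoeff := Real.sq_sqrt hlc
  have hs0 : √A.leadingCoeff ≠ 0 := (Real.sqrt_pos.2 hlc').ne'
  obtain ⟨k, hk⟩ := even_natDegree_of_eval_nonneg hA
  rcases (show A.natDegree = 0 ∨ A.natDegree = 2 by omega) with hd | hd
  · refine ⟨C √A.leadingCoeff, 0, by simp, by simp, ?_, ?_⟩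
    · rw [← C_pow, hs, leadingCoeff, hd]
      conv_rhs => rw [eq_C_of_natDegree_eq_zero hd]
      simp
    · have : toComplex (C √A.leadingCoeff) (-0) = C ((√A.leadingCoeff : ℝ) : ℂ) := by
        simp [toComplex]
      rw [this]
      exact (isUnit_C.2 (IsUnit.mk0 _ (Complex.ofReal_ne_zero.2 hs0))).dvd
  · -- a common root of `A` and `G + i η`
    obtain ⟨β, hβA, hβ⟩ : ∃ β : ℂ, aeval β A = 0 ∧ (toComplex G η).eval β = 0 := by
      obtain ⟨α, hα⟩ := IsAlgClosed.exists_aeval_eq_zero ℂ A (by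
        rw [degree_eq_natDegree hA0, hd]; norm_num)
      have h1 := congrArg (aeval α) h
      simp only [map_sub, map_mul, map_pow, hα, mul_zero, zero_mul, zero_sub] at h1
      have h2 : (toComplex G η).eval α * (toComplex G (-η)).eval α = 0 := by
        rw [eval_toComplex, eval_toComplex, map_neg]
        linear_combination -h1 - aeval α η ^ 2 * Complex.I_sq
      rcases mul_eq_zero.1 h2 with h3 | h3
      · exact ⟨α, hα, h3⟩
      · refine ⟨starRingEnd ℂ α, by rw [aeval_conj, hα, map_zero], ?_⟩
        rw [eval_toComplex] at h3 ⊢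
        have h4 := congrArg (starRingEnd ℂ) h3
        rw [aeval_conj, aeval_conj]
        simp only [map_add, map_mul, map_neg, Complex.conj_I, map_zero] at h4
        linear_combination h4
    have hdvd : X ^ 2 - C (2 * β.re) * X + C (β.re ^ 2 + β.im ^ 2) ∣ A := by
      by_cases him : β.im = 0
      · have hre : A.eval β.re = 0 := by
          have h1 : β = ((β.re : ℝ) : ℂ) := Complex.ext rfl (by simpa using him)
          rw [h1, ← Complex.coe_algebraMap, aeval_algebraMap_apply_eq_algebraMap_eval,
            Complex.coe_algebraMap, Complex.ofReal_eq_zero] at hβA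
          exact hβA
        convert X_sub_C_sq_dvd_of_eval_nonneg hA hre using 1
        rw [him]
        simp only [C_mul, C_ofNat, C_pow, C_add, C_0]
        ring
      · convert quadratic_dvd_of_aeval_eq_zero_im_ne_zero A hβA him using 3
        rw [← Complex.normSq_eq_norm_sq, Complex.normSq_apply]
        ring
    have hmonic : (X ^ 2 - C (2 * β.re) * X + C (β.re ^ 2 + β.im ^ 2)).Monic := by monicity!
    have hdeg : (X ^ 2 - C (2 * β.re) * X + C (β.re ^ 2 + β.im ^ 2)).natDegree = 2 := by
      compute_degree!
    have hAe : A = C A.leadingCoeff * (X ^ 2 - C (2 * β.re) * X + C (β.re ^ 2 + β.im ^ 2)) := by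
      obtain ⟨r, hr⟩ := hdvd
      have hr0 : r ≠ 0 := by rintro rfl; simp at hr; exact hA0 hr
      have h1 : r.natDegree = 0 := by
        have := natDegree_mul hmonic.ne_zero hr0
        rw [← hr, hd, hdeg] at this
        omega
      have h2 : A.leadingCoeff = r.leadingCoeff := by
        conv_lhs => rw [hr, leadingCoeff_mul, hmonic.leadingCoeff, one_mul]
      rw [h2, leadingCoeff, h1, ← eq_C_of_natDegree_eq_zero h1, mul_comm]
      exact hr
    refine ⟨C √A.leadingCoeff * (X - C β.re), C (√A.leadingCoeff * β.im), ?_, ?_, ?_, ?_⟩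
    · exact (natDegree_C_mul_le _ _).trans (natDegree_X_sub_C_le _)
    · exact (natDegree_C _).le.trans zero_le_one
    · conv_rhs => rw [hAe, ← hs]
      simp only [C_mul, C_ofNat, C_pow, C_add]
      ring
    · have h1 : toComplex (C √A.leadingCoeff * (X - C β.re)) (-C (√A.leadingCoeff * β.im))
          = C ((√A.leadingCoeff : ℝ) : ℂ) * (X - C β) := by
        have h2 : C β = C ((β.re : ℝ) : ℂ) + C Complex.I * C ((β.im : ℝ) : ℂ) := by
          rw [← C_mul, ← C_add, mul_comm, Complex.re_add_im]
        rw [h2]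
        simp [toComplex]
        ring
      rw [h1]
      exact ((isUnit_C.2 (IsUnit.mk0 _ (Complex.ofReal_ne_zero.2 hs0))).mul_left_dvd).2
        (dvd_iff_isRoot.2 hβ)

/-- If `A` and `4 A B - G²` are psd and the latter is a square, then `A z² + G z + B` is a sum of two
squares. -/
theorem exists_sum_two_squares {A B G η : ℝ[X]} (hA : ∀ x, 0 ≤ A.eval x) (hA0 : A ≠ 0)
    (hAd : A.natDegree ≤ 2) (hBd : B.natDegree ≤ 4) (h : 4 * A * B - G ^ 2 = η ^ 2) :
    ∃ l₁ l₂ q₁ q₂ : ℝ[X], l₁.natDegree ≤ 1 ∧ l₂.natDegree ≤ 1 ∧ q₁.natDegree ≤ 2 ∧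
      q₂.natDegree ≤ 2 ∧ l₁ ^ 2 + l₂ ^ 2 = A ∧ 2 * (l₁ * q₁ + l₂ * q₂) = G ∧
      q₁ ^ 2 + q₂ ^ 2 = B := by
  obtain ⟨l₁, l₂, hl₁, hl₂, hl, r, hr⟩ := exists_linear_norm_dvd hA hA0 hAd h
  obtain ⟨r₁, r₂, rfl, -, -⟩ := exists_toComplex r
  rw [toComplex_mul] at hr
  obtain ⟨hr1, hr2⟩ := toComplex_inj hr
  have h2 : (C (1 / 2) : ℝ[X]) * 2 = 1 := by
    rw [← map_ofNat C 2, ← C_mul]; norm_num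
  have hB : (C (1 / 2) * r₁) ^ 2 + (C (1 / 2) * r₂) ^ 2 = B := by
    refine mul_left_cancel₀ hA0 ?_
    have h3 : 4 * A * B = A * (r₁ ^ 2 + r₂ ^ 2) := by
      rw [← hl]
      rw [← hl] at h
      linear_combination h + (G + (l₁ * r₁ - -l₂ * r₂)) * hr1 + (η + (l₁ * r₂ + -l₂ * r₁)) * hr2
    linear_combination (-(C (1 / 2)) ^ 2) * h3 + A * B * (C (1 / 2) * 2 + 1) * h2
  have hd1 := natDegree_le_of_sq_add_mul_sq (Γ := 1) (D := B) (u := C (1 / 2) * r₁)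
    (v := C (1 / 2) * r₂) (by simp) (by rw [one_mul, hB])
  have hd2 := natDegree_le_of_sq_add_mul_sq (Γ := 1) (D := B) (u := C (1 / 2) * r₂)
    (v := C (1 / 2) * r₁) (by simp) (by rw [one_mul, add_comm, hB])
  refine ⟨l₁, l₂, C (1 / 2) * r₁, C (1 / 2) * r₂, hl₁, hl₂, by omega, by omega, hl, ?_, hB⟩
  rw [hr1]
  linear_combination (l₁ * r₁ + l₂ * r₂) * h2

end

section

/-! ### The affine chart `y = 1` of ternary and binary forms -/

open Polynomial

/-- Dehomogenization `y = 1` of a ternary form, as a polynomial in `z` over `ℝ[x]`. -/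
def affine : MvPolynomial (Fin 3) ℝ →ₐ[ℝ] ℝ[X][X] := MvPolynomial.aeval ![C X, 1, X]

/-- The exponent of the monomial `xⁱ yʲ zᵏ`. -/
def expo (i j k : ℕ) : Fin 3 →₀ ℕ := Finsupp.equivFunOnFinite.symm ![i, j, k]

theorem coeff_affine {p : MvPolynomial (Fin 3) ℝ} {d : ℕ} (hp : p.IsHomogeneous d) (j k : ℕ) :
    ((affine p).coeff k).coeff j = if j + k ≤ d then p.coeff (expo j (d - j - k) k) else 0 := by
  have hsum : affine p = ∑ e ∈ p.support, C (C (p.coeff e) * X ^ e 0) * X ^ e 2 := by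
    rw [affine, MvPolynomial.aeval_eq_eval₂Hom, MvPolynomial.coe_eval₂Hom, MvPolynomial.eval₂_eq']
    refine Finset.sum_congr rfl fun e _ => ?_
    simp [Fin.prod_univ_three, Polynomial.algebraMap_apply, mul_assoc]
  have hdeg : ∀ e ∈ p.support, e 0 + e 1 + e 2 = d := fun e he => by
    have := hp (MvPolynomial.mem_support_iff.1 he)
    rw [Finsupp.weight_apply, Finsupp.sum_fintype _ _ (by simp)] at this
    simpa [Fin.sum_univ_three] using this
  have hcoeff : ((affine p).coeff k).coeff j
      = ∑ e ∈ p.support, if e 0 = j ∧ e 2 = k then p.coeff e else 0 := by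
    rw [hsum, finsetSum_coeff, finsetSum_coeff]
    refine Finset.sum_congr rfl fun e _ => ?_
    rw [coeff_C_mul, coeff_X_pow]
    by_cases h2 : e 2 = k
    · rw [if_pos h2.symm, mul_one, coeff_C_mul, coeff_X_pow]
      by_cases h0 : e 0 = j
      · simp [h0, h2]
      · simp [h0, Ne.symm h0]
    · simp [h2, Ne.symm h2]
  rw [hcoeff]
  split_ifs with hjk
  · have hex : ∀ e ∈ p.support, (e 0 = j ∧ e 2 = k) → e = expo j (d - j - k) k := by
      rintro e he ⟨h0, h2⟩
      have := hdeg e he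
      ext i
      fin_cases i
      · exact h0
      · change e 1 = d - j - k; omega
      · exact h2
    rw [Finset.sum_eq_single (expo j (d - j - k) k)]
    · exact if_pos ⟨rfl, rfl⟩
    · intro e he hne
      exact if_neg fun h => hne (hex e he h)
    · intro h
      rw [if_pos ⟨rfl, rfl⟩]
      exact MvPolynomial.notMem_support_iff.1 h
  · refine Finset.sum_eq_zero fun e he => if_neg ?_
    rintro ⟨h0, h2⟩
    have := hdeg e he
    omega

theorem affine_injective {p q : MvPolynomial (Fin 3) ℝ} {d : ℕ} (hp : p.IsHomogeneous d)
    (hq : q.IsHomogeneous d) (h : affine p = affine q) : p = q := by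
  ext e
  by_cases he : e 0 + e 1 + e 2 = d
  · have h1 := coeff_affine hp (e 0) (e 2)
    rw [h, coeff_affine hq, if_pos (by omega), if_pos (by omega)] at h1
    have h2 : expo (e 0) (d - e 0 - e 2) (e 2) = e := by
      ext i
      fin_cases i
      · rfl
      · change d - e 0 - e 2 = e 1; omega
      · rfl
    rw [h2] at h1
    exact h1.symm
  · have h2 : e.degree ≠ d := by
      rw [Finsupp.degree_eq_sum, Fin.sum_univ_three]
      exact he
    rw [hp.coeff_eq_zero h2, hq.coeff_eq_zero h2]

theorem natDegree_coeff_affine_le {p : MvPolynomial (Fin 3) ℝ} {d : ℕ} (hp : p.IsHomogeneous d)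
    (k : ℕ) : ((affine p).coeff k).natDegree ≤ d - k := by
  rw [natDegree_le_iff_coeff_eq_zero]
  intro j hj
  rw [coeff_affine hp, if_neg (by omega)]

theorem natDegree_affine_le {p : MvPolynomial (Fin 3) ℝ} {d : ℕ} (hp : p.IsHomogeneous d) :
    (affine p).natDegree ≤ d := by
  rw [natDegree_le_iff_coeff_eq_zero]
  intro k hk
  ext j
  rw [coeff_affine hp, if_neg (by omega), coeff_zero]

/-- Every polynomial `c z² + l z + q` with `deg l ≤ 1` and `deg q ≤ 2` comes from a quadratic form. -/
theorem exists_affine_eq (c : ℝ) {l q : ℝ[X]} (hl : l.natDegree ≤ 1) (hq : q.natDegree ≤ 2) :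
    ∃ p : MvPolynomial (Fin 3) ℝ, p.IsHomogeneous 2 ∧
      affine p = C (C c) * X ^ 2 + C l * X + C q := by
  have hX : ∀ i j : Fin 3, (MvPolynomial.X i * MvPolynomial.X j :
      MvPolynomial (Fin 3) ℝ).IsHomogeneous 2 := fun i j =>
    (MvPolynomial.isHomogeneous_X ℝ i).mul (MvPolynomial.isHomogeneous_X ℝ j)
  have hCX : ∀ (a : ℝ) (i j : Fin 3), (MvPolynomial.C a * (MvPolynomial.X i * MvPolynomial.X j) :
      MvPolynomial (Fin 3) ℝ).IsHomogeneous 2 := fun a i j => (hX i j).C_mul a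
  refine ⟨MvPolynomial.C c * (MvPolynomial.X 2 * MvPolynomial.X 2)
    + MvPolynomial.C (l.coeff 1) * (MvPolynomial.X 0 * MvPolynomial.X 2)
    + MvPolynomial.C (l.coeff 0) * (MvPolynomial.X 1 * MvPolynomial.X 2)
    + MvPolynomial.C (q.coeff 2) * (MvPolynomial.X 0 * MvPolynomial.X 0)
    + MvPolynomial.C (q.coeff 1) * (MvPolynomial.X 0 * MvPolynomial.X 1)
    + MvPolynomial.C (q.coeff 0) * (MvPolynomial.X 1 * MvPolynomial.X 1), ?_, ?_⟩
  · exact (((((hCX _ _ _).add (hCX _ _ _)).add (hCX _ _ _)).add (hCX _ _ _)).add (hCX _ _ _)).add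
      (hCX _ _ _)
  · conv_rhs => rw [eq_quadratic_of_natDegree_le hq,
      eq_quadratic_of_natDegree_le (hl.trans one_le_two),
      coeff_eq_zero_of_natDegree_lt (show l.natDegree < 2 by omega)]
    simp [affine, Polynomial.algebraMap_apply]
    ring

theorem eval_eq_evalEval_affine (x z : ℝ) (f : MvPolynomial (Fin 3) ℝ) :
    MvPolynomial.eval ![x, 1, z] f = (affine f).evalEval x z := by
  induction f using MvPolynomial.induction_on with
  | C a => simp [affine, Polynomial.algebraMap_apply]
  | add p q hp hq => rw [map_add, map_add, evalEval_add, hp, hq]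
  | mul_X p i hp =>
    rw [map_mul, map_mul, evalEval_mul, hp]
    congr 1
    fin_cases i <;> simp [affine, evalEval]

theorem dehom_binForm (f : MvPolynomial (Fin 3) ℝ) (j : ℕ) :
    dehom (binForm f j) = (affine f).coeff (4 - j) := by
  let φ : MvPolynomial (Fin 2) ℝ →ₐ[ℝ] ℝ[X] := MvPolynomial.aeval ![X, 1]
  have h : (mapAlgHom φ).comp (MvPolynomial.aeval
      ![C (MvPolynomial.X 0), C (MvPolynomial.X 1), X]) = affine := by
    apply MvPolynomial.algHom_ext
    intro i
    fin_cases i <;> simp [affine, φ]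
  rw [← h]
  simp only [AlgHom.comp_apply, coe_mapAlgHom, coeff_map]
  rfl

theorem affine_liftXY (f : MvPolynomial (Fin 2) ℝ) : affine (liftXY f) = C (dehom f) := by
  rw [liftXY, affine, MvPolynomial.aeval_rename, dehom]
  have h : (MvPolynomial.aeval (![C X, 1, X] ∘ Fin.castSucc) : MvPolynomial (Fin 2) ℝ →ₐ[ℝ] ℝ[X][X])
      = (CAlgHom (R := ℝ) (A := ℝ[X])).comp (MvPolynomial.aeval ![X, 1]) := by
    apply MvPolynomial.algHom_ext
    intro i
    fin_cases i <;> simp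
  rw [h]
  rfl

theorem isHomogeneous_binForm {f : MvPolynomial (Fin 3) ℝ} (hf : f.IsHomogeneous 4) {j : ℕ}
    (hj : j ≤ 4) : (binForm f j).IsHomogeneous j := by
  have hsum : binForm f j = ∑ e ∈ f.support, if e 2 = 4 - j then
      MvPolynomial.C (f.coeff e) * (MvPolynomial.X 0 ^ e 0 * MvPolynomial.X 1 ^ e 1) else 0 := by
    rw [binForm, MvPolynomial.aeval_eq_eval₂Hom, MvPolynomial.coe_eval₂Hom, MvPolynomial.eval₂_eq',
      finsetSum_coeff]
    refine Finset.sum_congr rfl fun e _ => ?_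
    have : (algebraMap ℝ (MvPolynomial (Fin 2) ℝ)[X]) (f.coeff e)
        * ∏ i, ![C (MvPolynomial.X 0), C (MvPolynomial.X 1), X] i ^ e i
        = C (MvPolynomial.C (f.coeff e) * (MvPolynomial.X 0 ^ e 0 * MvPolynomial.X 1 ^ e 1))
          * X ^ e 2 := by
      simp [Fin.prod_univ_three, Polynomial.algebraMap_apply, mul_assoc]
    rw [this, coeff_C_mul, coeff_X_pow]
    by_cases h : e 2 = 4 - j
    · simp [h]
    · simp [h, Ne.symm h]
  rw [hsum]
  refine MvPolynomial.IsHomogeneous.sum _ _ _ fun e he => ?_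
  split_ifs with h
  · have hd := hf (MvPolynomial.mem_support_iff.1 he)
    rw [Finsupp.weight_apply, Finsupp.sum_fintype _ _ (by simp)] at hd
    simp only [Pi.one_apply, smul_eq_mul, mul_one, Fin.sum_univ_three] at hd
    have h1 := ((MvPolynomial.isHomogeneous_X_pow (R := ℝ) (0 : Fin 2) (e 0)).mul
      (MvPolynomial.isHomogeneous_X_pow (R := ℝ) (1 : Fin 2) (e 1))).C_mul (f.coeff e)
    convert h1 using 1
    omega
  · exact MvPolynomial.isHomogeneous_zero _ _ _

theorem dehom_injective {p q : MvPolynomial (Fin 2) ℝ} {d : ℕ} (hp : p.IsHomogeneous d)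
    (hq : q.IsHomogeneous d) (h : dehom p = dehom q) : p = q := by
  refine MvPolynomial.rename_injective (Fin.castSucc : Fin 2 → Fin 3) (Fin.castSucc_injective 2) ?_
  refine affine_injective (d := d) hp.rename_isHomogeneous hq.rename_isHomogeneous ?_
  change affine (liftXY p) = affine (liftXY q)
  rw [affine_liftXY, affine_liftXY, h]

end

section

/-! ### Normal forms of representations -/

open Polynomial

variable {g : MvPolynomial (Fin 3) ℝ}

/-- The representation that is obtained by an orthogonal transformation. -/
def Rep.rotate (ρ : Rep g) (S : Matrix (Fin 3) (Fin 3) ℝ)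
    (hS : S ∈ Matrix.orthogonalGroup (Fin 3) ℝ) : Rep g :=
  ⟨fun j => ∑ i, MvPolynomial.C (S i j) * ρ.1 i, fun j =>
    MvPolynomial.IsHomogeneous.sum _ _ _ fun i _ => (ρ.2.1 i).C_mul _, by
    have h1 : ∀ i k, ∑ j, S i j * S k j = if i = k then 1 else 0 := fun i k => by
      have := congrFun (congrFun ((Matrix.mem_orthogonalGroup_iff (Fin 3) ℝ).1 hS) i) k
      simpa [Matrix.mul_apply, Matrix.one_apply] using this
    have h2 : ∀ i k, (∑ j, MvPolynomial.C (S i j) * MvPolynomial.C (S k j) :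
        MvPolynomial (Fin 3) ℝ) = if i = k then 1 else 0 := fun i k => by
      simp only [← map_mul, ← map_sum, h1]
      split_ifs <;> simp
    refine ρ.2.2.trans ?_
    simp only [Fin.sum_univ_three] at h2 ⊢
    have e00 := h2 0 0
    have e11 := h2 1 1
    have e22 := h2 2 2
    have e01 := h2 0 1
    have e02 := h2 0 2
    have e12 := h2 1 2
    simp at e00 e11 e22 e01 e02 e12
    linear_combination (-(ρ.1 0) ^ 2) * e00 - (ρ.1 1) ^ 2 * e11 - (ρ.1 2) ^ 2 * e22
      - 2 * ρ.1 0 * ρ.1 1 * e01 - 2 * ρ.1 0 * ρ.1 2 * e02 - 2 * ρ.1 1 * ρ.1 2 * e12⟩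

theorem Rep.equivalent_rotate (ρ : Rep g) {S : Matrix (Fin 3) (Fin 3) ℝ}
    (hS : S ∈ Matrix.orthogonalGroup (Fin 3) ℝ) : ρ.Equivalent (ρ.rotate S hS) :=
  ⟨S, hS, fun _ => rfl⟩

theorem affine_C_mul (a : ℝ) (p : MvPolynomial (Fin 3) ℝ) :
    affine (MvPolynomial.C a * p) = C (C a) * affine p := by
  rw [map_mul]
  congr 1
  simp [affine, Polynomial.algebraMap_apply]

theorem coeff_affine_of_eq_sum {p : Fin 3 → MvPolynomial (Fin 3) ℝ} {p' : MvPolynomial (Fin 3) ℝ}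
    {n : Fin 3 → ℝ} (h : p' = ∑ i, MvPolynomial.C (n i) * p i) (k : ℕ) :
    (affine p').coeff k = ∑ i, C (n i) * (affine (p i)).coeff k := by
  rw [h, map_sum, finsetSum_coeff]
  exact Finset.sum_congr rfl fun i _ => by rw [affine_C_mul, coeff_C_mul]

theorem Rep.exists_equivalent_coeff_eq (ρ : Rep g) {S : Matrix (Fin 3) (Fin 3) ℝ}
    (hS : S ∈ Matrix.orthogonalGroup (Fin 3) ℝ) : ∃ ρ' : Rep g, ρ.Equivalent ρ' ∧
      ∀ j k, (affine (ρ'.1 j)).coeff k = ∑ i, C (S i j) * (affine (ρ.1 i)).coeff k :=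
  ⟨ρ.rotate S hS, ρ.equivalent_rotate hS, fun j k =>
    coeff_affine_of_eq_sum (n := fun i => S i j) (p := ρ.1) rfl k⟩

/-- Every unit vector is the first column of an orthogonal matrix. -/
theorem exists_orthogonal_of_unit {n : Fin 3 → ℝ} (hn : ∑ i, n i ^ 2 = 1) :
    ∃ S ∈ Matrix.orthogonalGroup (Fin 3) ℝ, ∀ i, S i 0 = n i := by
  have hv : Orthonormal ℝ (({0} : Set (Fin 3)).domRestrict
      fun _ => (WithLp.toLp 2 n : EuclideanSpace ℝ (Fin 3))) := by
    rw [orthonormal_iff_ite]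
    rintro ⟨i, hi⟩ ⟨j, hj⟩
    obtain rfl := Set.mem_singleton_iff.1 hi
    obtain rfl := Set.mem_singleton_iff.1 hj
    change inner ℝ (WithLp.toLp 2 n : EuclideanSpace ℝ (Fin 3)) (WithLp.toLp 2 n) = _
    rw [PiLp.inner_apply]
    simpa [sq] using hn
  obtain ⟨b, hb⟩ := hv.exists_orthonormalBasis_extension_of_card_eq (by simp)
  refine ⟨Matrix.of fun i j => b j i, ?_, fun i => ?_⟩
  · rw [Matrix.mem_orthogonalGroup_iff']
    ext i j
    have := orthonormal_iff_ite.1 b.orthonormal j i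
    rw [PiLp.inner_apply] at this
    rw [Matrix.mul_apply, Matrix.one_apply]
    simpa [eq_comm] using this
  · have := hb 0 rfl
    simp [this]

/-- `c z² + l z + q` for the components `c`, `l`, `q` of a representation. -/
theorem Rep.affine_eq (ρ : Rep g) (i : Fin 3) :
    affine (ρ.1 i) = C ((affine (ρ.1 i)).coeff 2) * X ^ 2 + C ((affine (ρ.1 i)).coeff 1) * X
      + C ((affine (ρ.1 i)).coeff 0) :=
  eq_quadratic_of_natDegree_le (natDegree_affine_le (ρ.2.1 i))

/-- The affine form of the quartics `s² z⁴ + g₂ z² + g₃ z + g₄`. -/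
def IsQuartic (g : MvPolynomial (Fin 3) ℝ) (G₂ G₃ G₄ : ℝ[X]) (s : ℝ) : Prop :=
  g.IsHomogeneous 4 ∧ affine g = C (C (s ^ 2)) * X ^ 4 + C G₂ * X ^ 2 + C G₃ * X + C G₄

variable {G₂ G₃ G₄ : ℝ[X]} {s : ℝ}

theorem eq_of_quartic_eq {R : Type*} [CommRing R] {a b c d e a' b' c' d' e' : R}
    (h : C a * X ^ 4 + C b * X ^ 3 + C c * X ^ 2 + C d * X + C e
      = C a' * X ^ 4 + C b' * X ^ 3 + C c' * X ^ 2 + C d' * X + C e') :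
    a = a' ∧ b = b' ∧ c = c' ∧ d = d' ∧ e = e' := by
  have h' : ∀ n, _ := fun n => congrArg (fun p => coeff p n) h
  have h4 := h' 4
  have h3 := h' 3
  have h2 := h' 2
  have h1 := h' 1
  have h0 := h' 0
  simp [coeff_X_pow, coeff_X, coeff_C] at h4 h3 h2 h1 h0
  exact ⟨h4, h3, h2, h1, h0⟩

/-- Comparison of coefficients in `g = ∑ (cᵢ z² + lᵢ z + qᵢ)²`. -/
theorem Rep.coeff_equations (hg : IsQuartic g G₂ G₃ G₄ s) (ρ : Rep g) {c l q : Fin 3 → ℝ[X]}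
    (h : ∀ i, affine (ρ.1 i) = C (c i) * X ^ 2 + C (l i) * X + C (q i)) :
    ∑ i, c i ^ 2 = C (s ^ 2) ∧ 2 * ∑ i, c i * l i = 0 ∧
      ∑ i, (l i ^ 2 + 2 * c i * q i) = G₂ ∧ 2 * ∑ i, l i * q i = G₃ ∧ ∑ i, q i ^ 2 = G₄ := by
  have h1 := congrArg affine ρ.2.2
  simp only [map_sum, map_pow, h] at h1
  have h2 : ∑ i, (C (c i) * X ^ 2 + C (l i) * X + C (q i)) ^ 2
      = C (∑ i, c i ^ 2) * X ^ 4 + C (2 * ∑ i, c i * l i) * X ^ 3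
        + C (∑ i, (l i ^ 2 + 2 * c i * q i)) * X ^ 2 + C (2 * ∑ i, l i * q i) * X
        + C (∑ i, q i ^ 2) := by
    simp only [Fin.sum_univ_three, C_add, C_mul, C_pow, C_ofNat]
    ring
  rw [hg.2, h2] at h1
  refine eq_of_quartic_eq (h1.symm.trans ?_)
  rw [C_0]
  ring

/-- In a representation in normal form, only the first summand contains `z²`, and it is of the form
`s z² + ξ`. -/
def Rep.IsNormal (ρ : Rep g) (s : ℝ) (ξ : ℝ[X]) : Prop :=
  affine (ρ.1 0) = C (C s) * X ^ 2 + C ξ ∧ (affine (ρ.1 1)).coeff 2 = 0 ∧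
    (affine (ρ.1 2)).coeff 2 = 0

theorem Rep.IsNormal.affine_eq {ρ : Rep g} {ξ : ℝ[X]} (h : ρ.IsNormal s ξ) :
    ∃ l₁ l₂ q₁ q₂ : ℝ[X], l₁.natDegree ≤ 1 ∧ l₂.natDegree ≤ 1 ∧ q₁.natDegree ≤ 2 ∧
      q₂.natDegree ≤ 2 ∧ affine (ρ.1 1) = C l₁ * X + C q₁ ∧ affine (ρ.1 2) = C l₂ * X + C q₂ := by
  refine ⟨_, _, _, _, natDegree_coeff_affine_le (ρ.2.1 1) 1, natDegree_coeff_affine_le (ρ.2.1 2) 1,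
    natDegree_coeff_affine_le (ρ.2.1 1) 0, natDegree_coeff_affine_le (ρ.2.1 2) 0, ?_, ?_⟩
  · conv_lhs => rw [ρ.affine_eq, h.2.1, C_0, zero_mul, zero_add]
  · conv_lhs => rw [ρ.affine_eq, h.2.2, C_0, zero_mul, zero_add]

theorem Rep.IsNormal.natDegree_le {ρ : Rep g} {ξ : ℝ[X]} (h : ρ.IsNormal s ξ) :
    ξ.natDegree ≤ 2 := by
  have h1 := natDegree_coeff_affine_le (ρ.2.1 0) 0
  rw [h.1] at h1
  simpa using h1

theorem Rep.IsNormal.equations (hg : IsQuartic g G₂ G₃ G₄ s) {ρ : Rep g} {ξ : ℝ[X]}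
    (h : ρ.IsNormal s ξ) {l₁ l₂ q₁ q₂ : ℝ[X]} (h₁ : affine (ρ.1 1) = C l₁ * X + C q₁)
    (h₂ : affine (ρ.1 2) = C l₂ * X + C q₂) :
    l₁ ^ 2 + l₂ ^ 2 = G₂ - C (2 * s) * ξ ∧ 2 * (l₁ * q₁ + l₂ * q₂) = G₃ ∧
      q₁ ^ 2 + q₂ ^ 2 = G₄ - ξ ^ 2 := by
  have h0 := ρ.coeff_equations hg (c := ![C s, 0, 0]) (l := ![0, l₁, l₂]) (q := ![ξ, q₁, q₂])
    fun i => by fin_cases i <;> simp [h.1, h₁, h₂]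
  obtain ⟨-, -, e2, e3, e4⟩ := h0
  simp [Fin.sum_univ_three] at e2 e3 e4
  refine ⟨?_, e3, ?_⟩
  · rw [C_mul, C_ofNat]; linear_combination e2
  · linear_combination e4

theorem Rep.IsNormal.mem_solSet (hg : IsQuartic g G₂ G₃ G₄ s) {ρ : Rep g} {ξ : ℝ[X]}
    (h : ρ.IsNormal s ξ) {l₁ l₂ q₁ q₂ : ℝ[X]} (hl₁ : l₁.natDegree ≤ 1) (hl₂ : l₂.natDegree ≤ 1)
    (hq₁ : q₁.natDegree ≤ 2) (hq₂ : q₂.natDegree ≤ 2) (h₁ : affine (ρ.1 1) = C l₁ * X + C q₁)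
    (h₂ : affine (ρ.1 2) = C l₂ * X + C q₂) :
    (ξ, C 2 * (l₁ * q₂ - l₂ * q₁)) ∈ solSet G₂ G₃ G₄ s := by
  obtain ⟨e2, e3, e4⟩ := h.equations hg h₁ h₂
  refine ⟨h.natDegree_le, ?_, fun x => ?_, ?_⟩
  · exact (natDegree_C_mul_le _ _).trans ((natDegree_sub_le _ _).trans (max_le
      (natDegree_mul_le.trans (add_le_add hl₁ hq₂)) (natDegree_mul_le.trans (add_le_add hl₂ hq₁))))
  · change 0 ≤ (G₂ - C (2 * s) * ξ).eval x
    rw [← e2, eval_add, eval_pow, eval_pow]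
    positivity
  · change 4 * (G₂ - C (2 * s) * ξ) * (G₄ - ξ ^ 2) - G₃ ^ 2 = _
    rw [← e2, ← e3, ← e4, C_ofNat]
    ring

/-- A representation with a unit vector `n` such that `∑ nᵢ lᵢ = 0` and `c = s n` is equivalent to one
in normal form. -/
theorem Rep.exists_isNormal (ρ : Rep g) {n : Fin 3 → ℝ} (hn : ∑ i, n i ^ 2 = 1)
    (hc : ∀ i, (affine (ρ.1 i)).coeff 2 = C (s * n i))
    (hl : ∑ i, C (n i) * (affine (ρ.1 i)).coeff 1 = 0) :
    ∃ (ρ' : Rep g) (ξ : ℝ[X]), ρ.Equivalent ρ' ∧ ρ'.IsNormal s ξ := by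
  obtain ⟨S, hS, hSn⟩ := exists_orthogonal_of_unit hn
  obtain ⟨ρ', hρ, hcoeff⟩ := ρ.exists_equivalent_coeff_eq hS
  have h2 : ∀ j, (affine (ρ'.1 j)).coeff 2 = if j = 0 then C s else 0 := fun j => by
    have h1 := congrFun (congrFun ((Matrix.mem_orthogonalGroup_iff' (Fin 3) ℝ).1 hS) j) 0
    rw [Matrix.mul_apply, Matrix.one_apply] at h1
    simp only [Matrix.transpose_apply, hSn] at h1
    have h3 : ∀ i, C (S i j) * C (s * n i) = C (s * (S i j * n i)) := fun i => by
      rw [← C_mul]; ring_nf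
    simp only [hcoeff, hc, h3]
    rw [← map_sum, ← Finset.mul_sum, h1]
    split_ifs <;> simp
  have h1 : (affine (ρ'.1 0)).coeff 1 = 0 := by
    rw [hcoeff]
    simpa only [hSn] using hl
  refine ⟨ρ', (affine (ρ'.1 0)).coeff 0, hρ, ?_, ?_, ?_⟩
  · conv_lhs => rw [Rep.affine_eq, h2, h1, if_pos rfl, C_0, zero_mul, add_zero]
  · rw [h2, if_neg (by simp)]
  · rw [h2, if_neg (by simp)]

theorem Rep.exists_coeff_two_eq_C (ρ : Rep g) (i : Fin 3) :
    ∃ c : ℝ, (affine (ρ.1 i)).coeff 2 = C c :=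
  ⟨_, eq_C_of_natDegree_eq_zero (Nat.le_zero.1 (natDegree_coeff_affine_le (ρ.2.1 i) 2))⟩

/-- For `s = 1`, the vector of the coefficients of `z²` is the required unit vector. -/
theorem Rep.exists_isNormal_one (hg : IsQuartic g G₂ G₃ G₄ 1) (ρ : Rep g) :
    ∃ (ρ' : Rep g) (ξ : ℝ[X]), ρ.Equivalent ρ' ∧ ρ'.IsNormal 1 ξ := by
  obtain ⟨h1, h2, -⟩ := ρ.coeff_equations hg ρ.affine_eq
  choose c hc using ρ.exists_coeff_two_eq_C
  refine ρ.exists_isNormal (n := c) ?_ (fun i => ?_) ?_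
  · have := congrArg (eval 0) h1
    simp only [hc] at this
    simpa [eval_finsetSum] using this
  · rw [one_mul, hc]
  · simp only [← hc]
    exact (mul_eq_zero.1 h2).resolve_left two_ne_zero

/-- For `s = 0` there are no terms `z²`, and the coefficients of `z` are linearly dependent. -/
theorem Rep.exists_isNormal_zero (hg : IsQuartic g G₂ G₃ G₄ 0) (ρ : Rep g) :
    ∃ (ρ' : Rep g) (ξ : ℝ[X]), ρ.Equivalent ρ' ∧ ρ'.IsNormal 0 ξ := by
  obtain ⟨h1, -⟩ := ρ.coeff_equations hg ρ.affine_eq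
  choose c hc using ρ.exists_coeff_two_eq_C
  -- the three polynomials `lᵢ` lie in a space of dimension two
  let L : (Fin 3 → ℝ) →ₗ[ℝ] (Fin 2 → ℝ) :=
    Matrix.mulVecLin (Matrix.of fun k i => ((affine (ρ.1 i)).coeff 1).coeff k)
  obtain ⟨m, hm, hm0⟩ : ∃ m ∈ LinearMap.ker L, m ≠ 0 :=
    (Submodule.ne_bot_iff _).1 (LinearMap.ker_ne_bot_of_finrank_lt (by simp))
  have hpos : 0 < ∑ i, m i ^ 2 := by
    obtain ⟨i, hi⟩ := Function.ne_iff.1 hm0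
    refine Finset.sum_pos' (fun i _ => sq_nonneg _) ⟨i, Finset.mem_univ _, ?_⟩
    have : m i ≠ 0 := hi
    positivity
  have hs : √(∑ i, m i ^ 2) ^ 2 = ∑ i, m i ^ 2 := Real.sq_sqrt hpos.le
  refine ρ.exists_isNormal (n := fun i => (√(∑ i, m i ^ 2))⁻¹ * m i) ?_ (fun i => ?_) ?_
  · simp only [mul_pow]
    rw [← Finset.mul_sum, inv_pow, hs, inv_mul_cancel₀ hpos.ne']
  · have h3 : ∑ i, c i ^ 2 = 0 := by
      have := congrArg (eval 0) h1
      simp only [hc] at this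
      simpa [eval_finsetSum] using this
    have h4 := (Finset.sum_eq_zero_iff_of_nonneg fun i _ => sq_nonneg _).1 h3 i (Finset.mem_univ _)
    rw [hc, pow_eq_zero_iff two_ne_zero |>.1 h4, zero_mul]
  · have h3 : ∀ k : Fin 2, ∑ i, ((affine (ρ.1 i)).coeff 1).coeff k * m i = 0 := fun k =>
      congrFun (LinearMap.mem_ker.1 hm) k
    ext k
    simp only [finsetSum_coeff, coeff_C_mul, coeff_zero, mul_assoc]
    rw [← Finset.mul_sum]
    by_cases hk : k < 2
    · have := h3 ⟨k, hk⟩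
      simp only [mul_comm (m _)]
      rw [this, mul_zero]
    · refine mul_eq_zero_of_right _ (Finset.sum_eq_zero fun i _ => ?_)
      rw [coeff_eq_zero_of_natDegree_lt ((natDegree_coeff_affine_le (ρ.2.1 i) 1).trans_lt
        (by omega)), mul_zero]

/-- Every solution comes from a representation in normal form. -/
theorem exists_isNormal_of_mem_solSet (hg : IsQuartic g G₂ G₃ G₄ s) (h : IsRegular G₂ G₃ G₄)
    {ξ η : ℝ[X]} (hs : (ξ, η) ∈ solSet G₂ G₃ G₄ s) : ∃ ρ : Rep g, ρ.IsNormal s ξ := by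
  have hA0 := pencil_ne_zero h hs
  obtain ⟨hξ, hη, hA, he⟩ := hs
  obtain ⟨l₁, l₂, q₁, q₂, hl₁, hl₂, hq₁, hq₂, e2, e3, e4⟩ := exists_sum_two_squares hA hA0
    (natDegree_pencil_le h hξ) (natDegree_sub_sq_le h hξ) he
  obtain ⟨p₀, hp₀, ha₀⟩ := exists_affine_eq s (l := 0) (by simp) hξ
  obtain ⟨p₁, hp₁, ha₁⟩ := exists_affine_eq 0 hl₁ hq₁
  obtain ⟨p₂, hp₂, ha₂⟩ := exists_affine_eq 0 hl₂ hq₂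
  simp only [C_0, zero_mul, zero_add, add_zero] at ha₀ ha₁ ha₂ e2 e4
  refine ⟨⟨![p₀, p₁, p₂], fun i => ?_, ?_⟩, ha₀, ?_, ?_⟩
  · fin_cases i
    exacts [hp₀, hp₁, hp₂]
  · refine affine_injective hg.1 ?_ ?_
    · refine MvPolynomial.IsHomogeneous.sum _ _ _ fun i _ => ?_
      fin_cases i
      exacts [hp₀.pow 2, hp₁.pow 2, hp₂.pow 2]
    · rw [hg.2]
      simp only [Fin.sum_univ_three, map_add, map_pow]
      change _ = affine p₀ ^ 2 + affine p₁ ^ 2 + affine p₂ ^ 2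
      rw [ha₀, ha₁, ha₂]
      have e2' : G₂ = l₁ ^ 2 + l₂ ^ 2 + 2 * C s * ξ := by
        rw [C_mul, C_ofNat] at e2; linear_combination -e2
      have e4' : G₄ = q₁ ^ 2 + q₂ ^ 2 + ξ ^ 2 := by linear_combination -e4
      rw [e2', ← e3, e4']
      simp only [C_add, C_mul, C_pow, C_ofNat]
      ring
  · change (affine p₁).coeff 2 = 0
    rw [ha₁]
    compute_degree!
  · change (affine p₂).coeff 2 = 0
    rw [ha₂]
    compute_degree!

/-- At a nondegenerate solution, `ξ` determines the representation up to equivalence. -/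
theorem Rep.IsNormal.equivalent (hg : IsQuartic g G₂ G₃ G₄ s) (h : IsRegular G₂ G₃ G₄)
    (hnd : ∀ ξ η, (ξ, η) ∈ solSet G₂ G₃ G₄ s → IsNondegenerate G₂ G₄ s ξ η) {ρ ρ' : Rep g}
    {ξ : ℝ[X]} (hρ : ρ.IsNormal s ξ) (hρ' : ρ'.IsNormal s ξ) : ρ.Equivalent ρ' := by
  obtain ⟨l₁, l₂, q₁, q₂, hl₁, hl₂, hq₁, hq₂, h₁, h₂⟩ := hρ.affine_eq
  obtain ⟨m₁, m₂, r₁, r₂, -, -, -, -, h₁', h₂'⟩ := hρ'.affine_eq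
  have hs := hρ.mem_solSet hg hl₁ hl₂ hq₁ hq₂ h₁ h₂
  obtain ⟨e2, e3, e4⟩ := hρ.equations hg h₁ h₂
  obtain ⟨f2, f3, f4⟩ := hρ'.equations hg h₁' h₂'
  obtain ⟨a, b, ε, hab, hε, ⟨hm₁, hm₂⟩, hr₁, hr₂⟩ := exists_orthogonal_of_sum_two_squares
    (e2.trans f2.symm) (mul_left_cancel₀ two_ne_zero (e3.trans f3.symm)) (e4.trans f4.symm)
    (by rw [e2]; exact pencil_ne_zero h hs) (fun α hl hq => by
      -- a common zero of `l₁ + i l₂` and `q₁ + i q₂` would be a degenerate point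
      rw [eval_toComplex] at hl hq
      refine (hnd _ _ hs).1 α ?_ ?_
      · simp only [map_mul, map_sub]
        refine mul_eq_zero_of_right _ ?_
        linear_combination aeval α q₂ * hl - aeval α l₂ * hq
      · rw [jac, ← e2, ← e4]
        simp only [map_add, map_mul, map_pow]
        linear_combination aeval α (C s) * (aeval α q₁ - Complex.I * aeval α q₂) * hq
          + aeval α ξ * (aeval α l₁ - Complex.I * aeval α l₂) * hl
          + (aeval α (C s) * aeval α q₂ ^ 2 + aeval α ξ * aeval α l₂ ^ 2) * Complex.I_sq)
  refine ⟨!![1, 0, 0; 0, a, b; 0, -(ε * b), ε * a], ?_, fun j => ?_⟩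
  · rw [Matrix.mem_orthogonalGroup_iff]
    ext i j
    rw [Matrix.mul_apply, Matrix.one_apply, Fin.sum_univ_three]
    fin_cases i <;> fin_cases j <;> simp
    · linear_combination hab
    · ring
    · ring
    · linear_combination ε ^ 2 * hab + hε
  · refine affine_injective (ρ'.2.1 j) (MvPolynomial.IsHomogeneous.sum _ _ _ fun i _ =>
      (ρ.2.1 i).C_mul _) ?_
    rw [map_sum]
    simp only [affine_C_mul, Fin.sum_univ_three, hρ.1, h₁, h₂]
    fin_cases j
    · simp [hρ'.1]
    · simp [h₁', hm₁, hr₁]; ring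
    · simp [h₂', hm₂, hr₂]; ring

theorem Rep.IsNormal.eq_of_equivalent_one {ρ ρ' : Rep g} {ξ ξ' : ℝ[X]} (hρ : ρ.IsNormal 1 ξ)
    (hρ' : ρ'.IsNormal 1 ξ') (h : ρ.Equivalent ρ') : ξ = ξ' := by
  obtain ⟨S, hS, hp⟩ := h
  have h2 : (affine (ρ'.1 0)).coeff 2 = C (S 0 0) := by
    rw [coeff_affine_of_eq_sum (hp 0), Fin.sum_univ_three, hρ.2.1, hρ.2.2, hρ.1]
    simp
  have h00 : S 0 0 = 1 := by
    rw [hρ'.1] at h2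
    simp at h2
    exact (C_injective h2).symm
  have hcol := congrFun (congrFun ((Matrix.mem_orthogonalGroup_iff' (Fin 3) ℝ).1 hS) 0) 0
  rw [Matrix.mul_apply, Matrix.one_apply, Fin.sum_univ_three] at hcol
  simp [h00] at hcol
  have h10 : S 1 0 = 0 := by nlinarith [sq_nonneg (S 1 0), sq_nonneg (S 2 0)]
  have h20 : S 2 0 = 0 := by nlinarith [sq_nonneg (S 1 0), sq_nonneg (S 2 0)]
  have h0 := coeff_affine_of_eq_sum (hp 0) 0
  rw [Fin.sum_univ_three, hρ.1, hρ'.1, h00, h10, h20] at h0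
  simpa using h0.symm

theorem Rep.IsNormal.eq_of_equivalent_zero (hg : IsQuartic g G₂ G₃ G₄ 0) (hr : IsRegular G₂ G₃ G₄)
    {ρ ρ' : Rep g} {ξ ξ' : ℝ[X]} (hρ : ρ.IsNormal 0 ξ) (hρ' : ρ'.IsNormal 0 ξ')
    (h : ρ.Equivalent ρ') : ξ' = ξ ∨ ξ' = -ξ := by
  obtain ⟨S, hS, hp⟩ := h
  obtain ⟨l₁, l₂, q₁, q₂, hl₁, hl₂, -, -, h₁, h₂⟩ := hρ.affine_eq
  obtain ⟨e2, -, -⟩ := hρ.equations hg h₁ h₂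
  simp only [mul_zero, C_0, zero_mul, sub_zero] at e2
  have h1 : C (S 1 0) * l₁ + C (S 2 0) * l₂ = 0 := by
    have := coeff_affine_of_eq_sum (hp 0) 1
    rw [Fin.sum_univ_three, hρ.1, hρ'.1, h₁, h₂] at this
    simpa using this.symm
  -- otherwise `l₁² + l₂²` would be a multiple of the square of a linear polynomial
  have h12 : S 1 0 = 0 ∧ S 2 0 = 0 := by
    by_contra hne
    have ht : 0 < S 1 0 ^ 2 + S 2 0 ^ 2 := by
      by_contra! hle
      exact hne ⟨by nlinarith [sq_nonneg (S 1 0), sq_nonneg (S 2 0)],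
        by nlinarith [sq_nonneg (S 1 0), sq_nonneg (S 2 0)]⟩
    set t := S 1 0 ^ 2 + S 2 0 ^ 2 with htd
    set m := C (S 2 0) * l₁ - C (S 1 0) * l₂ with hm
    have hG : C t * G₂ = m ^ 2 := by
      rw [← e2, htd, hm, C_add, C_pow, C_pow]
      linear_combination (C (S 1 0) * l₁ + C (S 2 0) * l₂) * h1
    have hd : m.natDegree = 1 := by
      have h3 := congrArg natDegree hG
      rw [natDegree_C_mul ht.ne', hr.natDegree_two, natDegree_pow] at h3
      omega
    obtain ⟨x, hx⟩ := exists_root_of_degree_eq_one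
      ((degree_eq_iff_natDegree_eq (ne_zero_of_natDegree_gt (hd ▸ zero_lt_one))).2 hd)
    have h3 := congrArg (eval x) hG
    rw [eval_mul, eval_C, eval_pow, hx.eq_zero, zero_pow two_ne_zero] at h3
    exact (mul_pos ht (hr.pos x)).ne' h3
  have hcol := congrFun (congrFun ((Matrix.mem_orthogonalGroup_iff' (Fin 3) ℝ).1 hS) 0) 0
  rw [Matrix.mul_apply, Matrix.one_apply, Fin.sum_univ_three] at hcol
  simp [h12.1, h12.2] at hcol
  have h0 := coeff_affine_of_eq_sum (hp 0) 0
  rw [Fin.sum_univ_three, hρ.1, hρ'.1, h12.1, h12.2] at h0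
  simp at h0
  rcases mul_self_eq_one_iff.1 hcol with h | h
  · left; rw [h0, h]; simp
  · right; rw [h0, h]; simp

theorem Rep.IsNormal.exists_neg {ρ : Rep g} {ξ : ℝ[X]} (hρ : ρ.IsNormal 0 ξ) :
    ∃ ρ' : Rep g, ρ.Equivalent ρ' ∧ ρ'.IsNormal 0 (-ξ) := by
  have hS : Matrix.diagonal ![-1, 1, 1] ∈ Matrix.orthogonalGroup (Fin 3) ℝ := by
    rw [Matrix.mem_orthogonalGroup_iff]
    ext i j
    rw [Matrix.mul_apply, Matrix.one_apply, Fin.sum_univ_three]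
    fin_cases i <;> fin_cases j <;> simp [Matrix.diagonal]
  obtain ⟨ρ', he, hcoeff⟩ := ρ.exists_equivalent_coeff_eq hS
  have hk : ∀ j k, (affine (ρ'.1 j)).coeff k
      = C (![-1, 1, 1] j) * (affine (ρ.1 j)).coeff k := fun j k => by
    rw [hcoeff, Finset.sum_eq_single j]
    · simp
    · intro i _ hij
      simp [Matrix.diagonal_apply_ne _ hij]
    · simp
  refine ⟨ρ', he, ?_, ?_, ?_⟩
  · ext1 k
    rw [hk, hρ.1]
    simp [coeff_C]
    split_ifs <;> simp
  · rw [hk, hρ.2.1, mul_zero]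
  · rw [hk, hρ.2.2, mul_zero]

end

section

/-! ### Counting equivalence classes -/

open Polynomial

/-- A surjective map whose fibres are the pairs `{x, τ x}` is two-to-one. -/
theorem card_eq_two_mul_of_fiber {α β : Type*} {f : α → β} (hf : Function.Surjective f) {τ : α → α}
    (hτ : ∀ x, τ x ≠ x) (h : ∀ x y, f y = f x ↔ y = x ∨ y = τ x) :
    Nat.card α = 2 * Nat.card β := by
  obtain ⟨σ, hσ⟩ := hf.hasRightInverse
  have hτf : ∀ x, f (τ x) = f x := fun x => (h x (τ x)).2 (Or.inr rfl)
  let F : Bool × β → α := fun p => if p.1 then τ (σ p.2) else σ p.2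
  have hF : ∀ p, f (F p) = p.2 := fun p => by
    by_cases hp : p.1
    · simp [F, hp, hτf, hσ p.2]
    · simp [F, hp, hσ p.2]
  have hbij : Function.Bijective F := by
    refine ⟨fun ⟨e, b⟩ ⟨e', b'⟩ hb => ?_, fun x => ?_⟩
    · obtain rfl : b = b' := by simpa [hF] using congrArg f hb
      cases e <;> cases e' <;> simp_all [F]
      exact hτ _ hb.symm
    · rcases (h (σ (f x)) x).1 (hσ (f x)).symm with hx | hx
      · exact ⟨(false, f x), by simpa [F] using hx.symm⟩
      · exact ⟨(true, f x), by simpa [F] using hx.symm⟩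
  rw [← Nat.card_eq_of_bijective F hbij, Nat.card_prod]
  simp

variable {G₂ G₃ G₄ : ℝ[X]} {s : ℝ} {g : MvPolynomial (Fin 3) ℝ}

theorem exists_aeval_eq_zero_of_coeff_ne_zero {p : ℝ[X]} {n : ℕ} (hn : n ≠ 0)
    (hp : p.coeff n ≠ 0) : ∃ α : ℂ, aeval α p = 0 := by
  refine IsAlgClosed.exists_aeval_eq_zero ℂ p fun h => ?_
  have h1 := le_degree_of_ne_zero hp
  rw [h] at h1
  exact hn (Nat.le_zero.1 (by exact_mod_cast h1))

theorem IsNondegenerate.ne_zero {ξ η : ℝ[X]} (h : IsNondegenerate G₂ G₄ s ξ η) : η ≠ 0 := by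
  rintro rfl
  obtain ⟨α, hα⟩ := exists_aeval_eq_zero_of_coeff_ne_zero (by simp) (h.2 (coeff_zero 3))
  exact h.1 α (map_zero _) hα

theorem IsNondegenerate.fst_ne_zero {ξ η : ℝ[X]} (h : IsNondegenerate G₂ G₄ 0 ξ η) : ξ ≠ 0 := by
  rintro rfl
  have hj : jac G₂ G₄ 0 0 = 0 := by simp [jac]
  rw [IsNondegenerate, hj] at h
  obtain ⟨α, hα⟩ := exists_aeval_eq_zero_of_coeff_ne_zero (by simp)
    (fun h3 => h.2 h3 (coeff_zero 4) : η.coeff 3 ≠ 0)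
  exact h.1 α hα (map_zero _)

/-- The solutions `(ξ, η)` and `(ξ, -η)` are distinct. -/
theorem card_solSet_eq_two_mul
    (hnd : ∀ ξ η, (ξ, η) ∈ solSet G₂ G₃ G₄ s → IsNondegenerate G₂ G₄ s ξ η) :
    (solSet G₂ G₃ G₄ s).ncard = 2 * Nat.card (Prod.fst '' solSet G₂ G₃ G₄ s) := by
  rw [← Nat.card_coe_set_eq]
  refine card_eq_two_mul_of_fiber (f := fun p => ⟨p.1.1, p.1, p.2, rfl⟩)
    (τ := fun p => ⟨(p.1.1, -p.1.2), p.2.1, by rw [natDegree_neg]; exact p.2.2.1, p.2.2.2.1, by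
      rw [neg_sq]; exact p.2.2.2.2⟩) ?_ ?_ ?_
  · rintro ⟨_, p, hp, rfl⟩
    exact ⟨⟨p, hp⟩, rfl⟩
  · rintro ⟨⟨ξ, η⟩, hp⟩ h
    have h1 : -η = η := congrArg (fun p => p.1.2) h
    exact (hnd ξ η hp).ne_zero (self_eq_neg.1 h1.symm)
  · rintro ⟨⟨ξ, η⟩, hp⟩ ⟨⟨ξ', η'⟩, hp'⟩
    simp only [Subtype.ext_iff, Prod.ext_iff]
    constructor
    · rintro rfl
      have h1 : η' ^ 2 = η ^ 2 := hp'.2.2.2.symm.trans hp.2.2.2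
      simpa using sq_eq_sq_iff_eq_or_eq_neg.1 h1
    · rintro (h | h) <;> exact h.1

theorem Rep.IsNormal.mem_image (hg : IsQuartic g G₂ G₃ G₄ s) {ρ : Rep g} {ξ : ℝ[X]}
    (h : ρ.IsNormal s ξ) : ξ ∈ Prod.fst '' solSet G₂ G₃ G₄ s := by
  obtain ⟨l₁, l₂, q₁, q₂, hl₁, hl₂, hq₁, hq₂, h₁, h₂⟩ := h.affine_eq
  exact ⟨_, h.mem_solSet hg hl₁ hl₂ hq₁ hq₂ h₁ h₂, rfl⟩

theorem exists_isNormal_of_mem_image (hg : IsQuartic g G₂ G₃ G₄ s) (h : IsRegular G₂ G₃ G₄)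
    (ξ : Prod.fst '' solSet G₂ G₃ G₄ s) : ∃ ρ : Rep g, ρ.IsNormal s ξ := by
  obtain ⟨_, ⟨ξ, η⟩, hs, rfl⟩ := ξ
  exact exists_isNormal_of_mem_solSet hg h hs

/-- For `s = 0`, the normal forms of the representations of a class are those with `ξ` and `-ξ`. -/
theorem IsRegular.card_repClass (h : IsRegular G₂ G₃ G₄) (hg : IsQuartic g G₂ G₃ G₄ 0) :
    Nat.card (RepClass g) = 4 := by
  have hnd : ∀ ξ η, (ξ, η) ∈ solSet G₂ G₃ G₄ 0 → IsNondegenerate G₂ G₄ 0 ξ η :=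
    fun _ _ hs => h.isNondegenerate_zero hs
  have h16 := h.ncard_solSet_zero
  rw [card_solSet_eq_two_mul hnd] at h16
  choose r hr using exists_isNormal_of_mem_image hg h
  have hneg : ∀ ξ ∈ Prod.fst '' solSet G₂ G₃ G₄ 0, -ξ ∈ Prod.fst '' solSet G₂ G₃ G₄ 0 := by
    intro ξ hξ
    obtain ⟨ρ, -, hρ⟩ := (hr ⟨ξ, hξ⟩).exists_neg
    exact hρ.mem_image hg
  have h2 := card_eq_two_mul_of_fiber (f := fun ξ => Quotient.mk (Rep.setoid g) (r ξ))
    (τ := fun ξ => ⟨-ξ.1, hneg _ ξ.2⟩) ?_ ?_ ?_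
  · rw [RepClass]
    omega
  · refine Quotient.ind fun ρ => ?_
    obtain ⟨ρ', ξ, he, hξ⟩ := ρ.exists_isNormal_zero hg
    refine ⟨⟨ξ, hξ.mem_image hg⟩, Quotient.sound ?_⟩
    exact Rep.equivalent_trans ((hr _).equivalent hg h hnd hξ) (Rep.equivalent_symm he)
  · rintro ⟨_, ⟨ξ, η⟩, hs, rfl⟩ h0
    have h1 : -ξ = ξ := congrArg Subtype.val h0
    exact (hnd ξ η hs).fst_ne_zero (self_eq_neg.1 h1.symm)
  · intro ξ ξ'
    rw [Quotient.eq]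
    constructor
    · intro he
      rcases (hr ξ).eq_of_equivalent_zero hg h (hr ξ') (Rep.equivalent_symm he) with h1 | h1
      · exact Or.inl (Subtype.ext h1)
      · exact Or.inr (Subtype.ext h1)
    · rintro (rfl | rfl)
      · exact Rep.equivalent_refl _
      · obtain ⟨ρ, he, hρ⟩ := (hr ξ).exists_neg
        exact Rep.equivalent_trans ((hr _).equivalent hg h hnd hρ) (Rep.equivalent_symm he)

/-- For `s = 1`, the polynomial `ξ` of a normal form is an invariant of the class. -/
theorem IsGeneric.card_repClass (h : IsGeneric G₂ G₃ G₄) (hg : IsQuartic g G₂ G₃ G₄ 1) :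
    Nat.card (RepClass g) = 8 := by
  have hnd : ∀ ξ η, (ξ, η) ∈ solSet G₂ G₃ G₄ 1 → IsNondegenerate G₂ G₄ 1 ξ η :=
    fun _ _ hs => h.isNondegenerate one_ne_zero hs
  have h16 := h.ncard_solSet_one
  rw [card_solSet_eq_two_mul hnd] at h16
  choose r hr using exists_isNormal_of_mem_image hg h.toIsRegular
  have h1 := Nat.card_eq_of_bijective (fun ξ => Quotient.mk (Rep.setoid g) (r ξ)) ⟨?_, ?_⟩
  · rw [RepClass]
    omega
  · intro ξ ξ' he
    exact Subtype.ext ((hr ξ).eq_of_equivalent_one (hr ξ') (Quotient.exact he))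
  · refine Quotient.ind fun ρ => ?_
    obtain ⟨ρ', ξ, he, hξ⟩ := ρ.exists_isNormal_one hg
    refine ⟨⟨ξ, hξ.mem_image hg⟩, Quotient.sound ?_⟩
    exact Rep.equivalent_trans ((hr _).equivalent hg h.toIsRegular hnd hξ) (Rep.equivalent_symm he)

/-! ### Invariance under linear changes of coordinates -/

theorem coordChange_coordChange (A B : Matrix (Fin 3) (Fin 3) ℝ) (p : MvPolynomial (Fin 3) ℝ) :
    coordChange B (coordChange A p) = coordChange (A * B) p :=
  MvPolynomial.funext fun v => by simp only [eval_coordChange, Matrix.mulVec_mulVec]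

theorem coordChange_one (p : MvPolynomial (Fin 3) ℝ) : coordChange 1 p = p :=
  MvPolynomial.funext fun v => by rw [eval_coordChange, Matrix.one_mulVec]

theorem isHomogeneous_coordChange (A : Matrix (Fin 3) (Fin 3) ℝ) {p : MvPolynomial (Fin 3) ℝ}
    {d : ℕ} (hp : p.IsHomogeneous d) : (coordChange A p).IsHomogeneous d := by
  have := hp.aeval (fun i => ∑ j, MvPolynomial.C (A i j) * MvPolynomial.X j) (n := 1) fun i =>
    MvPolynomial.IsHomogeneous.sum _ _ _ fun j _ => (MvPolynomial.isHomogeneous_X ℝ j).C_mul _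
  rwa [one_mul] at this

/-- The representation of `f ∘ A` that is obtained from a representation of `f`. -/
def Rep.map (A : Matrix (Fin 3) (Fin 3) ℝ) {f g : MvPolynomial (Fin 3) ℝ}
    (h : g = coordChange A f) (ρ : Rep f) : Rep g :=
  ⟨fun i => coordChange A (ρ.1 i), fun i => isHomogeneous_coordChange A (ρ.2.1 i), by
    refine h.trans ((congrArg (coordChange A) ρ.2.2).trans ?_)
    simp only [coordChange, map_sum, map_pow]⟩

theorem Rep.Equivalent.map (A : Matrix (Fin 3) (Fin 3) ℝ) {f g : MvPolynomial (Fin 3) ℝ}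
    (h : g = coordChange A f) {ρ ρ' : Rep f} (he : ρ.Equivalent ρ') :
    (ρ.map A h).Equivalent (ρ'.map A h) := by
  obtain ⟨S, hS, hp⟩ := he
  refine ⟨S, hS, fun j => (congrArg (coordChange A) (hp j)).trans ?_⟩
  simp [coordChange, Rep.map, MvPolynomial.algebraMap_eq]

theorem Rep.map_map {A B : Matrix (Fin 3) (Fin 3) ℝ} (hAB : A * B = 1)
    {f g : MvPolynomial (Fin 3) ℝ} (h : g = coordChange A f) (h' : f = coordChange B g)
    (ρ : Rep f) : (ρ.map A h).map B h' = ρ :=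
  Subtype.ext (funext fun i => by
    change coordChange B (coordChange A (ρ.1 i)) = ρ.1 i
    rw [coordChange_coordChange, hAB, coordChange_one])

theorem card_repClass_coordChange {A : Matrix (Fin 3) (Fin 3) ℝ} (hA : IsUnit A.det)
    {f g : MvPolynomial (Fin 3) ℝ} (h : g = coordChange A f) :
    Nat.card (RepClass f) = Nat.card (RepClass g) := by
  have h1 : A * A⁻¹ = 1 := Matrix.mul_nonsing_inv A hA
  have h2 : A⁻¹ * A = 1 := Matrix.nonsing_inv_mul A hA
  have h' : f = coordChange A⁻¹ g := by
    rw [h, coordChange_coordChange, h1, coordChange_one]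
  refine Nat.card_congr ⟨Quotient.map (Rep.map A h) fun _ _ => Rep.Equivalent.map A h,
    Quotient.map (Rep.map A⁻¹ h') fun _ _ => Rep.Equivalent.map A⁻¹ h',
    Quotient.ind fun ρ => ?_, Quotient.ind fun ρ => ?_⟩
  · exact congrArg (Quotient.mk _) (ρ.map_map h1 h h')
  · exact congrArg (Quotient.mk _) (ρ.map_map h2 h' h)

end

section

/-! ### Regularity and genericity from the exceptional conditions -/

open Polynomial

theorem dehom_eq_aeval (p : MvPolynomial (Fin 2) ℝ) :
    dehom p = (MvPolynomial.aeval ![X, 1] : MvPolynomial (Fin 2) ℝ →ₐ[ℝ] ℝ[X]) p := rfl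

theorem natDegree_dehom_le {p : MvPolynomial (Fin 2) ℝ} {d : ℕ} (hp : p.IsHomogeneous d) :
    (dehom p).natDegree ≤ d := by
  have h := natDegree_coeff_affine_le (p := liftXY p) (d := d) hp.rename_isHomogeneous 0
  rwa [affine_liftXY, coeff_C_zero] at h

/-- The quotient is linear, so it is the dehomogenization of a linear form. -/
theorem dvd_of_dehom_dvd {f₂ f₃ : MvPolynomial (Fin 2) ℝ} (h₂ : f₂.IsHomogeneous 2)
    (h₃ : f₃.IsHomogeneous 3) (hd : (dehom f₂).natDegree = 2) (h : dehom f₂ ∣ dehom f₃) :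
    f₂ ∣ f₃ := by
  obtain ⟨m, hm⟩ := h
  have hm1 : m.natDegree ≤ 1 := by
    by_cases hm0 : m = 0
    · simp [hm0]
    have h0 : dehom f₂ ≠ 0 := fun h0 => by simp [h0] at hd
    have := natDegree_dehom_le h₃
    rw [hm, natDegree_mul h0 hm0] at this
    omega
  have hh : (MvPolynomial.C (m.coeff 1) * MvPolynomial.X 0
      + MvPolynomial.C (m.coeff 0) * MvPolynomial.X 1 : MvPolynomial (Fin 2) ℝ).IsHomogeneous 1 :=
    ((MvPolynomial.isHomogeneous_X ℝ _).C_mul _).add ((MvPolynomial.isHomogeneous_X ℝ _).C_mul _)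
  refine ⟨_, dehom_injective h₃ (h₂.mul hh) ?_⟩
  rw [hm, dehom_eq_aeval, dehom_eq_aeval, map_mul]
  congr 1
  conv_lhs => rw [eq_X_add_C_of_natDegree_le_one hm1]
  simp

variable {f₂ f₃ f₄ : MvPolynomial (Fin 2) ℝ}

theorem isRegular_of_avoids (h₂ : f₂.IsHomogeneous 2) (h₃ : f₃.IsHomogeneous 3)
    (h₄ : f₄.IsHomogeneous 4) (hpsd : ∀ x z : ℝ, 0 ≤ (dehom f₂).eval x * z ^ 2
      + (dehom f₃).eval x * z + (dehom f₄).eval x) (h1 : ¬ E1 f₂) (h2 : ¬ E2 f₂ f₃)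
    (h3 : ¬ E3 f₂ f₃ f₄) : IsRegular (dehom f₂) (dehom f₃) (dehom f₄) := by
  have hG2 := natDegree_dehom_le h₂
  have hG3 := natDegree_dehom_le h₃
  have hG4 := natDegree_dehom_le h₄
  have h3' : disc 6 (4 * dehom f₂ * dehom f₄ - dehom f₃ ^ 2) ≠ 0 := by
    have : dehom (4 * f₂ * f₄ - f₃ ^ 2) = 4 * dehom f₂ * dehom f₄ - dehom f₃ ^ 2 := by
      simp only [dehom_eq_aeval, map_sub, map_mul, map_pow, map_ofNat]
    rw [← this]
    exact h3
  obtain ⟨hs2, hd2⟩ := separable_of_disc_ne_zero le_rfl h1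
  obtain ⟨hs6, hd6⟩ := separable_of_disc_ne_zero (by norm_num) h3'
  have hnn2 : ∀ x, 0 ≤ (dehom f₂).eval x := fun x => by
    have hd : (C ((dehom f₂).eval x) * X ^ 2 + C ((dehom f₃).eval x) * X
        + C ((dehom f₄).eval x)).natDegree ≤ 2 := natDegree_quadratic_le
    have := coeff_nonneg_of_eval_nonneg hd fun z => by simpa using hpsd x z
    simpa [coeff_X, coeff_C] using this
  have hnn6 : ∀ x, 0 ≤ (4 * dehom f₂ * dehom f₄ - dehom f₃ ^ 2).eval x := fun x => by
    have := discrim_le_zero fun z => by simpa [sq] using hpsd x z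
    rw [discrim] at this
    simp only [eval_sub, eval_mul, eval_pow, eval_ofNat]
    linarith
  have hpos2 := eval_pos_of_squarefree hnn2 hs2.squarefree
  have he2 := even_natDegree_of_eval_nonneg hnn2
  have he6 := even_natDegree_of_eval_nonneg hnn6
  have hle6 : (4 * dehom f₂ * dehom f₄ - dehom f₃ ^ 2).natDegree ≤ 6 := by
    refine (natDegree_sub_le _ _).trans (max_le ?_ (natDegree_pow_le.trans (by omega)))
    rw [← C_ofNat, mul_assoc]
    exact (natDegree_C_mul_le _ _).trans (natDegree_mul_le.trans (by omega))
  have hd2' : (dehom f₂).natDegree = 2 := by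
    obtain ⟨k, hk⟩ := he2
    omega
  refine ⟨hd2', hG3, hG4, hpos2, ?_, ?_, hs6, eval_pos_of_squarefree hnn6 hs6.squarefree⟩
  · have hirr : Irreducible (dehom f₂) := by
      rw [irreducible_iff_roots_eq_zero_of_degree_le_three (by omega) (by omega),
        Multiset.eq_zero_iff_forall_notMem]
      exact fun x hx => (hpos2 x).ne' (isRoot_of_mem_roots hx)
    exact (hirr.coprime_iff_not_dvd).2 fun h => h2 (dvd_of_dehom_dvd h₂ h₃ hd2' h)
  · obtain ⟨k, hk⟩ := he6
    omega

/-- The top coefficients cancel in a weighted Wronskian. -/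
theorem natDegree_weightedWronskian_le {i j : ℕ} {p q : ℝ[X]} (hp : p.natDegree ≤ i + 1)
    (hq : q.natDegree ≤ j + 1) : (weightedWronskian (i + 1) (j + 1) p q).natDegree ≤ i + j := by
  have hp' : (derivative p).natDegree ≤ i := (natDegree_derivative_le p).trans (by omega)
  have hq' : (derivative q).natDegree ≤ j := (natDegree_derivative_le q).trans (by omega)
  have e : weightedWronskian (i + 1) (j + 1) p q = C ((i : ℝ) + 1) * (p * derivative q)
      - C ((j : ℝ) + 1) * (q * derivative p) := by
    simp only [weightedWronskian, map_add, map_natCast, map_one]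
    push_cast
    ring
  have h1 : (p * derivative q).coeff (i + 1 + j) = p.coeff (i + 1) * (derivative q).coeff j :=
    coeff_mul_add_eq_of_natDegree_le hp hq'
  have h2 : (q * derivative p).coeff (j + 1 + i) = q.coeff (j + 1) * (derivative p).coeff i :=
    coeff_mul_add_eq_of_natDegree_le hq hp'
  rw [natDegree_le_iff_coeff_eq_zero]
  intro n hn
  rw [e, coeff_sub, coeff_C_mul, coeff_C_mul]
  rcases (Nat.succ_le_of_lt hn).eq_or_lt with rfl | hn
  · rw [show (i + j).succ = i + 1 + j by omega, h1, show i + 1 + j = j + 1 + i by omega, h2,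
      coeff_derivative, coeff_derivative]
    ring
  · rw [coeff_eq_zero_of_natDegree_lt, coeff_eq_zero_of_natDegree_lt]
    · ring
    · exact natDegree_mul_le.trans_lt (by omega)
    · exact natDegree_mul_le.trans_lt (by omega)

theorem isGeneric_of_avoids (h₂ : f₂.IsHomogeneous 2) (h₃ : f₃.IsHomogeneous 3)
    (h₄ : f₄.IsHomogeneous 4) (h : IsRegular (dehom f₂) (dehom f₃) (dehom f₄)) (h4 : ¬ E4 f₃)
    (h8 : ¬ E8 f₂ f₃ f₄) (h10 : ¬ E10 f₂ f₃ f₄) :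
    IsGeneric (dehom f₂) (dehom f₃) (dehom f₄) := by
  have hG2 := natDegree_dehom_le h₂
  have hG3 := natDegree_dehom_le h₃
  have hG4 := natDegree_dehom_le h₄
  have h23 : (gPol 2 3 f₂ f₃).natDegree ≤ 3 :=
    natDegree_weightedWronskian_le (i := 1) (j := 2) hG2 hG3
  have h24 : (gPol 2 4 f₂ f₄).natDegree ≤ 4 :=
    natDegree_weightedWronskian_le (i := 1) (j := 3) hG2 hG4
  obtain ⟨hs3, hd3⟩ := separable_of_disc_ne_zero (by norm_num) h4
  have hmul : ∀ {p q : ℝ[X]} {m n k : ℕ}, p.natDegree ≤ m → q.natDegree ≤ n → m + n = k →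
      (p * q).natDegree ≤ k := fun hp hq hk => hk ▸ natDegree_mul_le.trans (add_le_add hp hq)
  have hsq : ∀ {p : ℝ[X]} {m : ℕ}, p.natDegree ≤ m → (p ^ 2).natDegree ≤ 2 * m := fun hp =>
    natDegree_pow_le.trans (Nat.mul_le_mul_left 2 hp)
  have hnum : ∀ {p : ℝ[X]} {m : ℕ} (a : ℝ), p.natDegree ≤ m → (C a * p).natDegree ≤ m :=
    fun a hp => (natDegree_C_mul_le _ _).trans hp
  have hsub : ∀ {p q : ℝ[X]} {m : ℕ}, p.natDegree ≤ m → q.natDegree ≤ m →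
      (p - q).natDegree ≤ m := fun hp hq => (natDegree_sub_le _ _).trans (max_le hp hq)
  have hQ : (polQ f₂ f₃ f₄).natDegree ≤ 18 := by
    rw [polQ, ← C_ofNat]
    exact hmul (hmul (hsq hG4) h23 rfl) (hsub (hmul (hnum _ hG4) h23 rfl) (hmul hG3 h24 rfl)) rfl
  have hR : (polR f₂ f₃ f₄ ^ 2).natDegree ≤ 18 := by
    refine hsq (m := 9) ?_
    rw [polR, ← C_ofNat, ← C_ofNat, ← C_ofNat]
    exact natDegree_add_le_of_degree_le (hmul (hsub (hmul (hnum _ hG2) hG4 rfl)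
      (hnum _ (hsq hG3))) h23 rfl) (hmul (hmul (hnum _ hG2) hG3 rfl) h24 rfl)
  refine ⟨h, hs3, by omega, fun α r him hα hr => h8 ?_, fun α r him hα hr => h10 ?_⟩
  · exact Phi_eq_zero_of_nonreal_root (by norm_num) (by norm_num) (hsq hG2) hG4 hα him hr
  · exact Phi_eq_zero_of_nonreal_root (by norm_num) (by norm_num) hQ hR hα him hr

/-! ### The two normal forms of the quartic -/

variable {g : MvPolynomial (Fin 3) ℝ}

theorem affine_eq_of_isHomogeneous (hg : g.IsHomogeneous 4) :
    affine g = C ((affine g).coeff 4) * X ^ 4 + C ((affine g).coeff 3) * X ^ 3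
      + C (dehom (binForm g 2)) * X ^ 2 + C (dehom (binForm g 3)) * X
      + C (dehom (binForm g 4)) := by
  conv_lhs => rw [(affine g).as_sum_range_C_mul_X_pow' (Nat.lt_succ_of_le (natDegree_affine_le hg))]
  simp only [dehom_binForm, Finset.sum_range_succ, Finset.sum_range_zero]
  norm_num
  ring

theorem eval_affine_nonneg (h : IsPSD g) (x z : ℝ) : 0 ≤ (affine g).evalEval x z :=
  eval_eq_evalEval_affine x z g ▸ h _

theorem coeff_four_affine (hg : g.IsHomogeneous 4) :
    (affine g).coeff 4 = C (MvPolynomial.eval ![0, 0, 1] g) := by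
  rw [eq_C_of_natDegree_eq_zero (Nat.le_zero.1 (natDegree_coeff_affine_le hg 4)), coeff_affine hg,
    if_pos (by norm_num), MvPolynomial.eval_eq', Finset.sum_eq_single (expo 0 0 4)]
  · simp [expo, Fin.prod_univ_three]
  · intro e he hne
    by_cases h : e 0 = 0 ∧ e 1 = 0
    · have hd := hg (MvPolynomial.mem_support_iff.1 he)
      rw [Finsupp.weight_apply, Finsupp.sum_fintype _ _ (by simp)] at hd
      simp only [Pi.one_apply, smul_eq_mul, mul_one, Fin.sum_univ_three] at hd
      refine absurd ?_ hne
      ext i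
      fin_cases i
      · exact h.1
      · exact h.2
      · change e 2 = 4
        omega
    · refine mul_eq_zero_of_right _ ?_
      rw [Fin.prod_univ_three]
      rcases not_and_or.1 h with h | h <;> simp [h]
  · intro h
    rw [MvPolynomial.notMem_support_iff.1 h, zero_mul]

theorem isQuartic_zero (hg : g.IsHomogeneous 4) (hpsd : IsPSD g)
    (h0 : MvPolynomial.eval ![0, 0, 1] g = 0) :
    IsQuartic g (dehom (binForm g 2)) (dehom (binForm g 3)) (dehom (binForm g 4)) 0 := by
  have h4 : (affine g).coeff 4 = 0 := by rw [coeff_four_affine hg, h0, C_0]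
  have h3 : (affine g).coeff 3 = 0 := by
    refine Polynomial.funext fun x => ?_
    rw [eval_zero]
    by_contra hx
    -- a psd polynomial in `z` has no leading term of degree three
    have hnn : ∀ z, 0 ≤ ((affine g).map (evalRingHom x)).eval z := fun z => by
      rw [map_evalRingHom_eval]
      exact eval_affine_nonneg hpsd x z
    have hd : ((affine g).map (evalRingHom x)).natDegree = 3 := by
      refine le_antisymm ?_ (le_natDegree_of_ne_zero (by rwa [coeff_map]))
      rw [natDegree_le_iff_coeff_eq_zero]
      intro n hn
      rw [coeff_map]
      rcases (Nat.succ_le_of_lt hn).eq_or_lt with rfl | hn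
      · rw [h4, map_zero]
      · rw [coeff_eq_zero_of_natDegree_lt ((natDegree_affine_le hg).trans_lt hn), map_zero]
    have := even_natDegree_of_eval_nonneg hnn
    rw [hd] at this
    exact absurd this (by decide)
  refine ⟨hg, ?_⟩
  conv_lhs => rw [affine_eq_of_isHomogeneous hg, h3, h4]
  simp

theorem IsNormalized.isQuartic_one (hg : g.IsHomogeneous 4) (h : IsNormalized g) :
    IsQuartic g (dehom (binForm g 2)) (dehom (binForm g 3)) (dehom (binForm g 4)) 1 := by
  refine ⟨hg, ?_⟩
  have hX : affine (MvPolynomial.X 2) = X := by simp [affine]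
  conv_lhs => rw [h.1]
  simp only [map_add, map_mul, map_pow, affine_liftXY, hX]
  simp

end

end TernaryQuartic

end

theorem mainTheorem2
    (f : MvPolynomial (Fin 3) ℝ) (hf : f.IsHomogeneous 4) (hpsd : IsPSD f)
    (A : Matrix (Fin 3) (Fin 3) ℝ) (hA : IsUnit A.det)
    (g : MvPolynomial (Fin 3) ℝ) (hg : g = coordChange A f) :
    (MvPolynomial.eval ![0, 0, 1] g = 0 →
      AvoidsE1E3 (binForm g 2) (binForm g 3) (binForm g 4) →
        Nat.card (RepClass f) = 4) ∧
    (IsPosDef f → IsNormalized g →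
      AvoidsE1E11 (binForm g 2) (binForm g 3) (binForm g 4) →
        Nat.card (RepClass f) = 8) := by
  have hg4 : g.IsHomogeneous 4 := hg ▸ isHomogeneous_coordChange A hf
  have hgpsd : IsPSD g := fun v => by rw [hg, eval_coordChange]; exact hpsd _
  have h₂ := isHomogeneous_binForm hg4 (j := 2) (by norm_num)
  have h₃ := isHomogeneous_binForm hg4 (j := 3) (by norm_num)
  have h₄ := isHomogeneous_binForm hg4 (j := 4) le_rfl
  rw [card_repClass_coordChange hA hg]
  constructor
  · rintro h0 ⟨h1, h2, h3⟩
    have hq := isQuartic_zero hg4 hgpsd h0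
    refine (isRegular_of_avoids h₂ h₃ h₄ (fun x z => ?_) h1 h2 h3).card_repClass hq
    have := eval_affine_nonneg hgpsd x z
    rw [hq.2] at this
    simpa [Polynomial.evalEval] using this
  · rintro - hN ⟨h1, h2, h3, h4, -, -, -, h8, -, h10, -⟩
    have hq := hN.isQuartic_one hg4
    have hr := isRegular_of_avoids h₂ h₃ h₄ (fun x z => ?_) h1 h2 h3
    · exact (isGeneric_of_avoids h₂ h₃ h₄ hr h4 h8 h10).card_repClass hq
    · have := hN.2 ![x, 1, z]
      rw [map_sub, eval_eq_evalEval_affine, hq.2] at this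
      simp [Polynomial.evalEval] at this
      linarith
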